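/- Let $b>0$, $r\in(0,1]$, $h\ge 0$ and $c>2\sqrt{1-r}$, and let $\lambda<\mu$ be the roots of $z^2-cz+(1-r)=0$. Consider the delayed Belousov–Zhabotinsky system $$u_t(t,x)=\Delta u(t,x)+u(t,x)\bigl(1-u(t,x)-r\,v(t-h,x)\bigr),\qquad v_t(t,x)=\Delta v(t,x)-b\,u(t,x)v(t,x),\qquad (\ast)$$ and the profile system $$\phi''(t)-c\phi'(t)+\phi(t)(1-r-\phi(t)+r\psi(t))=0,\qquad \psi''(t)-c\psi'(t)+b\phi(t-ch)(1-\psi(t))=0 .\qquad (\ast\ast)$$ A pair $(\psi_+,\phi_+)$ is called a regular super-solution of $(\ast\ast)$ if there are $t_1,t_2\in\mathbb R$ and a finite set $D\subset(-\infty,\min\{t_1,t_2\})$ such that the following holds. On some open neighbourhoods of $(-\infty,t_1]$ and $(-\infty,t_2]$, respectively, $\psi_+$ and $\phi_+$ are continuous and positive and, off $D$, of class $C^2$ with positive derivatives; at each $d\in D$ the derivatives have finite one-sided limits with $\psi_+'(d-)\ge\psi_+'(d+)$ and $\phi_+'(d-)\ge\phi_+'(d+)$; $\psi_+(-\infty)=\phi_+(-\infty)=0$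 and $\psi_+(t_1)=\phi_+(t_2)=1$; $\phi_+$ is defined and strictly increasing on $[t_2,+\infty)$; and * (D1) for some positive $\nu\in(\lambda,\mu)$, $m\in\{0,1\}$ and $C_1>0$, as $t\to-\infty$, $\psi_+(t)=O(te^{\nu t})$ and $(\phi_+,\phi_+',\phi_+'')(t)=C_1(-t)^me^{\nu t}(1,\nu,\nu^2)(1+o(1))$; * (D2) for all $t\le\min\{t_1,t_2\}$, $t\notin D$: $\phi_+''(t)-c\phi_+'(t)+\phi_+(t)(1-r-\phi_+(t)+r\psi_+(t))<0$ and $\psi_+''(t)-c\psi_+'(t)+b\phi_+(t-ch)(1-\psi_+(t))<0$; * (D3) if $t_1<t_2$, then $\phi_+''(t)-c\phi_+'(t)+\phi_+(t)(1-\phi_+(t))<0$ for $t\in[t_1,t_2]$; * (D4) if $t_1>t_2$, then $\psi_+''(t)-c\psi_+'(t)+b\min\{1,\phi_+(t-ch)\}(1-\psi_+(t))<0$ for $t\in[t_2,t_1]$. Suppose that $(\ast\ast)$ has a regular super-solution. Then $(\ast)$ has a positive monotone wavefront with speed $c$: there are positive functions $\phi,\theta:\mathbb R\to\mathbb R$,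 $\phi$ strictly increasing and $\theta$ strictly decreasing, with $(\phi,\theta)(-\infty)=(0,1)$ and $(\phi,\theta)(+\infty)=(1,0)$, such that in every dimension $n$ and for every unit vector $e\in\mathbb R^n$ the plane wave $(u,v)(t,x)=(\phi,\theta)(e\cdot x+ct)$ is a classical solution of $(\ast)$ for all $t\in\mathbb R$, $x\in\mathbb R^n$. Moreover, $(\phi,\theta)$ can be chosen so that, as $t\to-\infty$: * if $r=1$, then $$\phi(t)=\frac{2c^2/b}{t^2}-\frac{8c}{3b}\Bigl(c^2\bigl(1+h+\tfrac1b\bigr)-4\Bigr)\frac{\ln(-t)}{t^3}+O\Bigl(\frac1{t^3}\Bigr),$$ $$\theta(t)=1+\frac{2c}{t}-\frac43\Bigl(c^2\bigl(1+h+\tfrac1b\bigr)-4\Bigr)\frac{\ln(-t)}{t^2}+O\Bigl(\frac1{t^2}\Bigr);$$ * if $r\in(0,1)$, then, for some $\varepsilon>0$, $$\phi(t)=e^{\lambda t}+O(e^{(\lambda+\varepsilon)t}),\qquad \theta(t)=1-\frac{b\,e^{\lambda t}}{1-r}+O(e^{(\lambda+\varepsilon)t}).$$ -/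

import Mathlib

noncomputable section

open Filter Topology

/-- The smaller root `λ` of the characteristic equation `z² - c z + (1 - r) = 0`. -/
def bzLambda (c r : ℝ) : ℝ := (c - √(c ^ 2 - 4 * (1 - r))) / 2

/-- The larger root `μ` of the characteristic equation `z² - c z + (1 - r) = 0`. -/
def bzMu (c r : ℝ) : ℝ := (c + √(c ^ 2 - 4 * (1 - r))) / 2

/-- `(u, v)` is a classical entire solution, on `ℝ × ℝⁿ`, of the delayed BZ system
`u_t = Δu + u (1 - u - r v(t - h, x))`, `v_t = Δv - b u v`. -/
def IsBZSolution (n : ℕ) (b r h : ℝ) (u v : ℝ → EuclideanSpace ℝ (Fin n) → ℝ) : Prop :=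
  (∀ t, ContDiff ℝ 2 (u t) ∧ ContDiff ℝ 2 (v t)) ∧
  ∀ t x,
    HasDerivAt (fun s => u s x)
      (Laplacian.laplacian (u t) x + u t x * (1 - u t x - r * v (t - h) x)) t ∧
    HasDerivAt (fun s => v s x)
      (Laplacian.laplacian (v t) x - b * u t x * v t x) t

/-- `(φ, θ)` is the profile of a positive, componentwise (strictly) monotone wavefront of the
delayed BZ system which connects `(0, 1)` with `(1, 0)` and moves at the speed `c`: in each space
dimension and for each unit vector `e`, the plane wave `(u, v)(t, x) = (φ, θ)(e · x + c t)` is a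
solution. -/
structure IsMonotoneWavefront (b c r h : ℝ) (φ θ : ℝ → ℝ) : Prop where
  pos : ∀ t, 0 < φ t ∧ 0 < θ t
  strictMono : StrictMono φ
  strictAnti : StrictAnti θ
  tendsto_atBot : Tendsto φ atBot (𝓝 0) ∧ Tendsto θ atBot (𝓝 1)
  tendsto_atTop : Tendsto φ atTop (𝓝 1) ∧ Tendsto θ atTop (𝓝 0)
  solution : ∀ (n : ℕ) (e : EuclideanSpace ℝ (Fin n)), ‖e‖ = 1 →
    IsBZSolution n b r h (fun t x => φ (inner ℝ e x + c * t)) (fun t x => θ (inner ℝ e x + c * t))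

/-- The asymptotics of the front at `-∞` when `r = 1`. -/
def CriticalAsymptotics (b c h : ℝ) (φ θ : ℝ → ℝ) : Prop :=
  (fun t => φ t - (2 * c ^ 2 / b / t ^ 2
      - 8 * c / (3 * b) * (c ^ 2 * (1 + h + 1 / b) - 4) * (Real.log (-t) / t ^ 3)))
    =O[atBot] (fun t : ℝ => 1 / t ^ 3) ∧
  (fun t => θ t - (1 + 2 * c / t
      - 4 / 3 * (c ^ 2 * (1 + h + 1 / b) - 4) * (Real.log (-t) / t ^ 2)))
    =O[atBot] (fun t : ℝ => 1 / t ^ 2)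

/-- The asymptotics of the front at `-∞` when `r < 1`. -/
def NoncriticalAsymptotics (b c r : ℝ) (φ θ : ℝ → ℝ) : Prop :=
  ∃ ε > 0,
    (fun t => φ t - Real.exp (bzLambda c r * t))
      =O[atBot] (fun t => Real.exp ((bzLambda c r + ε) * t)) ∧
    (fun t => θ t - (1 - b * Real.exp (bzLambda c r * t) / (1 - r)))
      =O[atBot] (fun t => Real.exp ((bzLambda c r + ε) * t))

/-- The differential expression `φ'' - c φ' + φ (1 - r - φ + r ψ)`. -/
def bzOp₁ (c r : ℝ) (φ ψ : ℝ → ℝ) (t : ℝ) : ℝ :=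
  deriv (deriv φ) t - c * deriv φ t + φ t * (1 - r - φ t + r * ψ t)

/-- The differential expression `ψ'' - c ψ' + b φ(t - c h) (1 - ψ)`. -/
def bzOp₂ (b c h : ℝ) (φ ψ : ℝ → ℝ) (t : ℝ) : ℝ :=
  deriv (deriv ψ) t - c * deriv ψ t + b * φ (t - c * h) * (1 - ψ t)

/-- At the point `d` the derivative of `f` has finite one-sided limits and does not jump upwards:
`f'(d-) ≥ f'(d+)`. -/
def DerivJumpsDown (f : ℝ → ℝ) (d : ℝ) : Prop :=
  ∃ p q : ℝ, Tendsto (deriv f) (𝓝[<] d) (𝓝 p) ∧ Tendsto (deriv f) (𝓝[>] d) (𝓝 q) ∧ q ≤ p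

/-- On an open neighbourhood of `(-∞, τ]`, the function `f` is positive, continuous, and, off the
finite set `D`, of class `C²` with positive derivative; at the points of `D` the derivative can
only jump downwards; `f(-∞) = 0` and `f(τ) = 1`. -/
structure IsSuperSolutionComponent (f : ℝ → ℝ) (τ : ℝ) (D : Finset ℝ) : Prop where
  regular : ∃ O : Set ℝ, IsOpen O ∧ Set.Iic τ ⊆ O ∧ ContinuousOn f O ∧ (∀ t ∈ O, 0 < f t) ∧
    ∀ t ∈ O, t ∉ D → ContDiffAt ℝ 2 f t ∧ 0 < deriv f t
  jump : ∀ d ∈ D, DerivJumpsDown f d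
  tendsto_atBot : Tendsto f atBot (𝓝 0)
  eq_one : f τ = 1

/-- Regular super-solutions `(ψ, φ)` of the profile system
`φ'' - c φ' + φ (1 - r - φ + r ψ) = 0`, `ψ'' - c ψ' + b φ(t - c h) (1 - ψ) = 0`. -/
def IsRegularSuperSolution (b c r h : ℝ) (ψ φ : ℝ → ℝ) : Prop :=
  ∃ (t₁ t₂ : ℝ) (D : Finset ℝ),
    (∀ d ∈ D, d < min t₁ t₂) ∧
    IsSuperSolutionComponent ψ t₁ D ∧
    IsSuperSolutionComponent φ t₂ D ∧
    StrictMonoOn φ (Set.Ici t₂) ∧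
    -- behaviour at `-∞`
    (∃ (ν C : ℝ) (m : ℕ), 0 < ν ∧ bzLambda c r < ν ∧ ν < bzMu c r ∧ m ≤ 1 ∧ 0 < C ∧
      ψ =O[atBot] (fun t => t * Real.exp (ν * t)) ∧
      Asymptotics.IsEquivalent atBot φ
        (fun t => C * (-t) ^ m * Real.exp (ν * t)) ∧
      Asymptotics.IsEquivalent atBot (deriv φ)
        (fun t => C * (-t) ^ m * Real.exp (ν * t) * ν) ∧
      Asymptotics.IsEquivalent atBot (deriv (deriv φ))
        (fun t => C * (-t) ^ m * Real.exp (ν * t) * ν ^ 2)) ∧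
    -- differential inequalities
    (∀ t ≤ min t₁ t₂, t ∉ D → bzOp₁ c r φ ψ t < 0 ∧ bzOp₂ b c h φ ψ t < 0) ∧
    (t₁ < t₂ → ∀ t ∈ Set.Icc t₁ t₂,
      deriv (deriv φ) t - c * deriv φ t + φ t * (1 - φ t) < 0) ∧
    (t₂ < t₁ → ∀ t ∈ Set.Icc t₂ t₁,
      deriv (deriv ψ) t - c * deriv ψ t + b * min 1 (φ (t - c * h)) * (1 - ψ t) < 0)

end

noncomputable section
open Filter Topology
open MeasureTheory Set

/-! With `θ(t) = 1 - ψ(t + c h)` the profile system is cooperative. Once `K φ` and `K ψ` are added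
to the reaction terms, `K` large, it says that `(φ, ψ)` is fixed by `profileMap₁`, `profileMap₂`,
which are order preserving and translation invariant on pairs with values in `[0, 1]`. Order alone
gives a monotone fixed point between a sub- and a super-solution that are separated by monotone
functions (`exists_monotone_fixedPoint`). If it vanishes at `-∞` and its first component is positive
there, it is a strictly monotone front (`isMonotoneWavefront_of_fixedPoint`).

The difficulty is that the given super-solution decays at a rate `ν > λ`, whereas the front sought
decays slowly (like `e^{λt}`, or like `1/t²` if `r = 1`), so it cannot lie above that front. Near
`-∞` there are explicit slow super- and sub-solutions `(p, q)` and `(f, g)` (`IsSlowPair`), but they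
are known only on a half-line. The remedy is to add the two super-solutions, as `φ + p(· - S)` and
`ψ + q(· - S)` with `S` so large that the slow terms are tiny where they are used. In the second
equation the cross terms have the favourable sign. In the first, `φ q + ψ p` must be paid for by
strictness of the inequality for `φ`. Near `-∞` the margin is a multiple of `φ`, because `ν` lies
strictly between the roots, and `t p(t) → 0` compensates for `ψ = O(-t φ)`. On the remaining compact
interval the margin may degenerate at the corners `D`, so a small corrector `G ≤ 0` with `G = G' = 0
> G''` on `D` is added as well (`IsTruncatedSuper.exists_params`). A maximum principle that admits
downward jumps of the derivative (`nonneg_of_differential_ineq`) turns the sum, truncated at `1`,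
into a super-solution of the integral equations.

The resulting front (`exists_front_of_slowPair`) is trapped near `-∞` between `f` and `p + φ(· +
S)`, and likewise in the second component. The fast terms are below the claimed error, so the
asymptotics are those of the slow pair. For `r < 1` the pair consists of sums of `e^{λt}` and
`e^{ζt}` with `λ < ζ < min(2λ, μ)`. For `r = 1` the smaller root is `0`, and the pair lives on an
approximate slow manifold `φ = y²/(2b) + β y³` with `1/y = s/(2c) + a log s + σ/√s`, `s = -t`. The
constants `a` and `β` cancel the residual to order `1/s`, and the sign of `σ` decides between sub-
and super-solution. -/

/-- The negative root of `z² - c z - K = 0`. -/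
def greenNeg (c K : ℝ) : ℝ := (c - √(c ^ 2 + 4 * K)) / 2

/-- The positive root of `z² - c z - K = 0`. -/
def greenPos (c K : ℝ) : ℝ := (c + √(c ^ 2 + 4 * K)) / 2

/-- The Green kernel of `-(d²/dt² - c d/dt - K)` on the line. -/
def greenKernel (c K s : ℝ) : ℝ :=
  if 0 ≤ s then Real.exp (greenNeg c K * s) / √(c ^ 2 + 4 * K)
  else Real.exp (greenPos c K * s) / √(c ^ 2 + 4 * K)

/-- The bounded solution `w` of `w'' - c w' - K w = -g`. -/
def green (c K : ℝ) (g : ℝ → ℝ) (t : ℝ) : ℝ := ∫ s, greenKernel c K s * g (t - s)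

/-! ### Green potentials of `w'' - c w' - K w = -g` on the line. -/

section GreenOperator

variable {c K : ℝ}

lemma greenDisc_pos (hK : 0 < K) : 0 < √(c ^ 2 + 4 * K) := Real.sqrt_pos.2 (by positivity)

lemma greenNeg_neg (hK : 0 < K) : greenNeg c K < 0 := by
  have h : c < √(c ^ 2 + 4 * K) := Real.lt_sqrt_of_sq_lt (by linarith)
  unfold greenNeg; linarith

lemma greenPos_pos (hK : 0 < K) : 0 < greenPos c K := by
  have h : -c < √(c ^ 2 + 4 * K) := Real.lt_sqrt_of_sq_lt (by nlinarith)
  unfold greenPos; linarith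

lemma greenNeg_sq (hK : 0 < K) : greenNeg c K ^ 2 = c * greenNeg c K + K := by
  have h := Real.sq_sqrt (show 0 ≤ c ^ 2 + 4 * K by positivity)
  unfold greenNeg; nlinarith

lemma greenPos_sq (hK : 0 < K) : greenPos c K ^ 2 = c * greenPos c K + K := by
  have h := Real.sq_sqrt (show 0 ≤ c ^ 2 + 4 * K by positivity)
  unfold greenPos; nlinarith

lemma greenPos_sub_greenNeg : greenPos c K - greenNeg c K = √(c ^ 2 + 4 * K) := by
  unfold greenPos greenNeg; ring

lemma greenKernel_pos (hK : 0 < K) (s : ℝ) : 0 < greenKernel c K s := by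
  have := greenDisc_pos (c := c) hK
  unfold greenKernel; split_ifs <;> positivity

lemma greenKernel_eqOn_Ici : EqOn (greenKernel c K)
    (fun s => Real.exp (greenNeg c K * s) / √(c ^ 2 + 4 * K)) (Ici 0) := fun s hs => by
  simp only [mem_Ici] at hs
  simp [greenKernel, hs]

lemma greenKernel_eqOn_Iio : EqOn (greenKernel c K)
    (fun s => Real.exp (greenPos c K * s) / √(c ^ 2 + 4 * K)) (Iio 0) := fun s hs => by
  simp only [mem_Iio] at hs
  simp [greenKernel, not_le.2 hs]

lemma integrableOn_greenKernel_Ioi (hK : 0 < K) : IntegrableOn (greenKernel c K) (Ioi 0) :=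
  IntegrableOn.congr_fun (Integrable.div_const (integrableOn_exp_mul_Ioi (greenNeg_neg hK) 0) _)
    (fun _ hs => (greenKernel_eqOn_Ici (mem_Ici.2 (le_of_lt hs))).symm) measurableSet_Ioi

lemma integrableOn_greenKernel_Iic (hK : 0 < K) : IntegrableOn (greenKernel c K) (Iic 0) := by
  rw [integrableOn_Iic_iff_integrableOn_Iio]
  exact IntegrableOn.congr_fun (Integrable.div_const
    ((integrableOn_exp_mul_Iic (greenPos_pos hK) 0).mono_set Iio_subset_Iic_self) _) (fun s hs => (greenKernel_eqOn_Iio hs).symm) measurableSet_Iio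

lemma integrable_greenKernel (hK : 0 < K) : Integrable (greenKernel c K) := by
  rw [← integrableOn_univ, ← Iic_union_Ioi (a := (0 : ℝ))]
  exact (integrableOn_greenKernel_Iic hK).union (integrableOn_greenKernel_Ioi hK)

lemma integral_greenKernel (hK : 0 < K) : ∫ s, greenKernel c K s = 1 / K := by
  have hd := greenDisc_pos (c := c) hK
  have hn := greenNeg_neg (c := c) hK
  have hp := greenPos_pos (c := c) hK
  have e1 : ∫ s in Ioi 0, greenKernel c K s = -1 / greenNeg c K / √(c ^ 2 + 4 * K) := by
    rw [setIntegral_congr_fun measurableSet_Ioi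
      (fun s hs => greenKernel_eqOn_Ici (mem_Ici.2 (le_of_lt hs))), integral_div,
      integral_exp_mul_Ioi hn]
    simp
  have e2 : ∫ s in Iic 0, greenKernel c K s = 1 / greenPos c K / √(c ^ 2 + 4 * K) := by
    rw [integral_Iic_eq_integral_Iio, setIntegral_congr_fun measurableSet_Iio
      greenKernel_eqOn_Iio, integral_div, ← integral_Iic_eq_integral_Iio,
      integral_exp_mul_Iic hp]
    simp
  rw [← integral_add_compl (measurableSet_Iic (a := (0 : ℝ))) (integrable_greenKernel hK),
    compl_Iic, e1, e2, ← greenPos_sub_greenNeg]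
  have hprod : greenNeg c K * greenPos c K = -K := by
    have h := Real.sq_sqrt (show 0 ≤ c ^ 2 + 4 * K by positivity)
    unfold greenPos greenNeg; nlinarith
  have : greenPos c K - greenNeg c K ≠ 0 := by linarith
  have hn' := hn.ne
  have hp' := hp.ne'
  have hK' := hK.ne'
  field_simp
  linear_combination (-1) * (greenPos c K - greenNeg c K) * hprod

lemma integrable_green {g : ℝ → ℝ} {M : ℝ} (hK : 0 < K) (hg : Measurable g)
    (hM : ∀ s, |g s| ≤ M) (t : ℝ) : Integrable (fun s => greenKernel c K s * g (t - s)) := by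
  have := (integrable_greenKernel (c := c) hK).bdd_mul (f := fun s => g (t - s)) (c := M)
    (hg.comp (measurable_const.sub measurable_id)).aestronglyMeasurable
    (Eventually.of_forall fun s => by simpa using hM _)
  simpa [mul_comm] using this

lemma green_mono {g g' : ℝ → ℝ} {M : ℝ} (hK : 0 < K) (hg : Measurable g) (hg' : Measurable g')
    (hM : ∀ s, |g s| ≤ M) (hM' : ∀ s, |g' s| ≤ M) (h : ∀ s, g s ≤ g' s) (t : ℝ) :
    green c K g t ≤ green c K g' t :=
  integral_mono (integrable_green hK hg hM t) (integrable_green hK hg' hM' t)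
    fun _ => mul_le_mul_of_nonneg_left (h _) (greenKernel_pos hK _).le

lemma green_const (hK : 0 < K) (a t : ℝ) : green c K (fun _ => a) t = a / K := by
  unfold green
  rw [integral_mul_const, integral_greenKernel hK]; ring

lemma green_shift (g : ℝ → ℝ) (a t : ℝ) :
    green c K (fun s => g (s + a)) t = green c K g (t + a) := by
  unfold green
  congr 1; ext s; beta_reduce; rw [show t - s + a = t + a - s by ring]

lemma green_sub {g g' : ℝ → ℝ} {M : ℝ} (hK : 0 < K) (hg : Measurable g) (hg' : Measurable g')
    (hM : ∀ s, |g s| ≤ M) (hM' : ∀ s, |g' s| ≤ M) (t : ℝ) :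
    green c K (fun s => g s - g' s) t = green c K g t - green c K g' t := by
  unfold green
  rw [← integral_sub (integrable_green hK hg hM t) (integrable_green hK hg' hM' t)]
  congr 1; ext s; ring

/-- A nonnegative continuous function whose Green potential vanishes somewhere is zero. -/
lemma green_pos {g : ℝ → ℝ} {M : ℝ} (hK : 0 < K) (hg : Continuous g) (hM : ∀ s, |g s| ≤ M)
    (h : ∀ s, 0 ≤ g s) {t₀ : ℝ} (ht₀ : 0 < g t₀) (t : ℝ) : 0 < green c K g t := by
  refine (integral_pos_iff_support_of_nonneg
    (fun s => mul_nonneg (greenKernel_pos hK _).le (h _)) (integrable_green hK hg.measurable hM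
      t)).2 ?_
  have ho : IsOpen {s | 0 < g (t - s)} := isOpen_lt continuous_const (by fun_prop)
  refine (ho.measure_pos volume ⟨t - t₀, by simpa using ht₀⟩).trans_le (measure_mono fun s hs => ?_)
  exact (mul_pos (greenKernel_pos hK _) hs).ne'

lemma tendsto_green {g : ℝ → ℝ} {M a : ℝ} (hK : 0 < K) (hg : Measurable g) (hM : ∀ s, |g s| ≤ M)
    {l : Filter ℝ} [l.IsCountablyGenerated] (hl : ∀ s, Tendsto (fun t => t - s) l l)
    (h : Tendsto g l (𝓝 a)) : Tendsto (green c K g) l (𝓝 (a / K)) := by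
  rw [← green_const (c := c) hK a 0]
  refine tendsto_integral_filter_of_dominated_convergence (fun s => greenKernel c K s * M)
    (Eventually.of_forall fun t => (integrable_green hK hg hM t).aestronglyMeasurable)
    (Eventually.of_forall fun t => Eventually.of_forall fun s => ?_)
    ((integrable_greenKernel hK).mul_const _)
    (Eventually.of_forall fun s => ((h.comp (hl s)).const_mul _))
  rw [norm_mul, Real.norm_of_nonneg (greenKernel_pos hK _).le]
  exact mul_le_mul_of_nonneg_left (hM _) (greenKernel_pos hK _).le

/-- The kernel is exponential on each side of the diagonal, so the exponentials in `t` factor out.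
What remains are primitives, continuous for bounded measurable `g` and differentiable for continuous
`g`. -/
lemma green_eq {g : ℝ → ℝ} {M : ℝ} (hK : 0 < K) (hg : Measurable g) (hM : ∀ s, |g s| ≤ M)
    (t : ℝ) : green c K g t =
      (Real.exp (greenNeg c K * t) * ∫ s in Iic t, Real.exp (-greenNeg c K * s) * g s) /
        √(c ^ 2 + 4 * K) +
      (Real.exp (greenPos c K * t) * ∫ s in Ioi t, Real.exp (-greenPos c K * s) * g s) /
        √(c ^ 2 + 4 * K) := by
  have h0 : green c K g t = ∫ s, greenKernel c K (t - s) * g s := by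
    unfold green
    rw [← integral_sub_left_eq_self _ volume t]
    simp
  have hi : Integrable (fun s => greenKernel c K (t - s) * g s) := by
    have := (integrable_green (c := c) hK hg hM t).comp_sub_left t
    simpa using this
  rw [h0, ← integral_add_compl (measurableSet_Iic (a := t)) hi, compl_Iic]
  congr 1
  · rw [← integral_const_mul, ← integral_div]
    refine setIntegral_congr_fun measurableSet_Iic fun s hs => ?_
    have : greenKernel c K (t - s) = _ := greenKernel_eqOn_Ici (mem_Ici.2 (sub_nonneg.2 hs))
    simp only [this]
    rw [← mul_assoc, ← Real.exp_add]
    ring_nf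
  · rw [← integral_const_mul, ← integral_div]
    refine setIntegral_congr_fun measurableSet_Ioi fun s hs => ?_
    have : greenKernel c K (t - s) = _ := greenKernel_eqOn_Iio (mem_Iio.2 (sub_neg.2 hs))
    simp only [this]
    rw [← mul_assoc, ← Real.exp_add]
    ring_nf

lemma integral_Iic_eq_add {f : ℝ → ℝ} (hi : ∀ t, IntegrableOn f (Iic t)) (t : ℝ) :
    ∫ s in Iic t, f s = (∫ s in Iic 0, f s) + ∫ s in (0 : ℝ)..t, f s := by
  rw [← intervalIntegral.integral_Iic_sub_Iic (hi 0) (hi t)]; ring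

lemma integral_Ioi_eq_sub {f : ℝ → ℝ} (hi : ∀ t, IntegrableOn f (Ioi t)) (t : ℝ) :
    ∫ s in Ioi t, f s = (∫ s in Ioi 0, f s) - ∫ s in (0 : ℝ)..t, f s := by
  rcases le_total 0 t with h | h
  · rw [← intervalIntegral.integral_Ioi_sub_Ioi (hi 0) h]; ring
  · rw [intervalIntegral.integral_symm, ← intervalIntegral.integral_Ioi_sub_Ioi (hi t) h]; ring

lemma integrableOn_Iic_green {g : ℝ → ℝ} {M : ℝ} (hK : 0 < K) (hg : Measurable g)
    (hM : ∀ s, |g s| ≤ M) (t : ℝ) :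
    IntegrableOn (fun s => Real.exp (-greenNeg c K * s) * g s) (Iic t) := by
  have := (integrableOn_exp_mul_Iic (neg_pos.2 (greenNeg_neg (c := c) hK)) t).bdd_mul (f := g)
    (c := M) hg.aestronglyMeasurable (Eventually.of_forall fun s => by simpa using hM s)
  simpa [mul_comm, IntegrableOn] using this

lemma integrableOn_Ioi_green {g : ℝ → ℝ} {M : ℝ} (hK : 0 < K) (hg : Measurable g)
    (hM : ∀ s, |g s| ≤ M) (t : ℝ) :
    IntegrableOn (fun s => Real.exp (-greenPos c K * s) * g s) (Ioi t) := by
  have := (integrableOn_exp_mul_Ioi (neg_neg_of_pos (greenPos_pos (c := c) hK)) t).bdd_mul (f := g)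
    (c := M) hg.aestronglyMeasurable (Eventually.of_forall fun s => by simpa using hM s)
  simpa [mul_comm, IntegrableOn] using this

lemma continuous_green {g : ℝ → ℝ} {M : ℝ} (hK : 0 < K) (hg : Measurable g)
    (hM : ∀ s, |g s| ≤ M) : Continuous (green c K g) := by
  rw [funext fun t => green_eq (c := c) hK hg hM t]
  have hi₁ := integrableOn_Iic_green (c := c) hK hg hM
  have hi₂ := integrableOn_Ioi_green (c := c) hK hg hM
  have h₁ : Continuous fun t => ∫ s in Iic t, Real.exp (-greenNeg c K * s) * g s := by
    rw [funext (integral_Iic_eq_add hi₁)]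
    exact continuous_const.add (intervalIntegral.continuous_primitive (fun x y =>
      ⟨(hi₁ y).mono_set Ioc_subset_Iic_self, (hi₁ x).mono_set Ioc_subset_Iic_self⟩) 0)
  have h₂ : Continuous fun t => ∫ s in Ioi t, Real.exp (-greenPos c K * s) * g s := by
    rw [funext (integral_Ioi_eq_sub hi₂)]
    exact continuous_const.sub (intervalIntegral.continuous_primitive (fun x y =>
      ⟨(hi₂ x).mono_set Ioc_subset_Ioi_self, (hi₂ y).mono_set Ioc_subset_Ioi_self⟩) 0)
  fun_prop

lemma hasDerivAt_integral_Iic {f : ℝ → ℝ} (hf : Continuous f) (hi : ∀ t, IntegrableOn f (Iic t))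
    (t : ℝ) : HasDerivAt (fun t => ∫ s in Iic t, f s) (f t) t := by
  rw [funext (integral_Iic_eq_add hi)]
  exact (intervalIntegral.integral_hasDerivAt_right (hf.intervalIntegrable _ _)
    (hf.stronglyMeasurableAtFilter _ _) hf.continuousAt).const_add _

lemma hasDerivAt_integral_Ioi {f : ℝ → ℝ} (hf : Continuous f) (hi : ∀ t, IntegrableOn f (Ioi t))
    (t : ℝ) : HasDerivAt (fun t => ∫ s in Ioi t, f s) (-f t) t := by
  rw [funext (integral_Ioi_eq_sub hi)]
  exact (intervalIntegral.integral_hasDerivAt_right (hf.intervalIntegrable _ _)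
    (hf.stronglyMeasurableAtFilter _ _) hf.continuousAt).const_sub _

/-- Variation of constants: the boundary terms of the two integrals cancel in the first derivative
and add up to `(z₁ - z₂) g / d = -g` in the second, where `z₁`, `z₂` are the roots and `d` is their
distance. -/
lemma exists_deriv_green {g : ℝ → ℝ} {M : ℝ} (hK : 0 < K) (hg : Continuous g)
    (hM : ∀ s, |g s| ≤ M) : ∃ w' : ℝ → ℝ, (∀ t, HasDerivAt (green c K g) (w' t) t) ∧
      ∀ t, HasDerivAt w' (c * w' t + K * green c K g t - g t) t := by
  have hd := greenDisc_pos (c := c) hK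
  have hz : greenNeg c K - greenPos c K = -√(c ^ 2 + 4 * K) := by
    rw [← greenPos_sub_greenNeg]; ring
  have hn2 := greenNeg_sq (c := c) hK
  have hp2 := greenPos_sq (c := c) hK
  have hfun := funext fun t => green_eq (c := c) hK hg.measurable hM t
  set z₁ := greenNeg c K with hz₁
  set z₂ := greenPos c K with hz₂
  set d := √(c ^ 2 + 4 * K)
  have hA := hasDerivAt_integral_Iic (f := fun s => Real.exp (-z₁ * s) * g s) (by fun_prop)
    (integrableOn_Iic_green hK hg.measurable hM)
  have hB := hasDerivAt_integral_Ioi (f := fun s => Real.exp (-z₂ * s) * g s) (by fun_prop)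
    (integrableOn_Ioi_green hK hg.measurable hM)
  set A := fun t => ∫ s in Iic t, Real.exp (-z₁ * s) * g s with hAdef
  set B := fun t => ∫ s in Ioi t, Real.exp (-z₂ * s) * g s with hBdef
  have hE (z t : ℝ) : HasDerivAt (fun t => Real.exp (z * t)) (Real.exp (z * t) * z) t := by
    have := ((hasDerivAt_id t).const_mul z).exp
    simpa using this
  have hcancel (z t : ℝ) : Real.exp (z * t) * (Real.exp (-z * t) * g t) = g t := by
    rw [← mul_assoc, ← Real.exp_add]; simp
  refine ⟨fun t => (Real.exp (z₁ * t) * z₁ * A t) / d + (Real.exp (z₂ * t) * z₂ * B t) / d,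
    fun t => ?_, fun t => ?_⟩
  · rw [hfun]
    refine ((((hE z₁ t).mul (hA t)).div_const d).add (((hE z₂ t).mul (hB t)).div_const d)).congr_deriv
      ?_
    rw [mul_neg, hcancel, hcancel]
    ring
  · have h := ((((hE z₁ t).mul_const z₁).mul (hA t)).div_const d).add
      ((((hE z₂ t).mul_const z₂).mul (hB t)).div_const d)
    refine h.congr_deriv ?_
    have c₁ := hcancel z₁ t
    have c₂ := hcancel z₂ t
    have hg' : green c K g t = (Real.exp (z₁ * t) * A t) / d + (Real.exp (z₂ * t) * B t) / d :=
      congrFun hfun t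
    rw [hg']
    clear h hg'
    beta_reduce
    generalize Real.exp (z₁ * t) = E₁ at *
    generalize Real.exp (z₂ * t) = E₂ at *
    generalize Real.exp (-z₁ * t) = e₁ at *
    generalize Real.exp (-z₂ * t) = e₂ at *
    field_simp
    linear_combination E₁ * A t * hn2 + E₂ * B t * hp2 + z₁ * c₁ - z₂ * c₂ + g t * hz

end GreenOperator

/-! ### Derivatives of `C²` functions and downward jumps. -/

/-- The derivative of a `C²` function is `C¹`. -/
lemma ContDiffAt.contDiffAt_deriv {z : ℝ → ℝ} {s : ℝ} (h : ContDiffAt ℝ 2 z s) :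
    ContDiffAt ℝ 1 (deriv z) s :=
  (h.fderiv_right (m := 1) (by norm_num)).clm_apply (contDiffAt_const (c := (1 : ℝ)))

lemma ContDiffAt.deriv_add_eventuallyEq {f g : ℝ → ℝ} {s : ℝ} (h : ContDiffAt ℝ 2 f s)
    (h' : ContDiffAt ℝ 2 g s) :
    deriv (fun t => f t + g t) =ᶠ[𝓝 s] fun t => deriv f t + deriv g t := by
  filter_upwards [h.eventually (by simp), h'.eventually (by simp)] with t a b
  exact deriv_add (a.differentiableAt (by simp)) (b.differentiableAt (by simp))

lemma ContDiffAt.deriv_deriv_add {f g : ℝ → ℝ} {s : ℝ} (h : ContDiffAt ℝ 2 f s)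
    (h' : ContDiffAt ℝ 2 g s) :
    deriv (deriv fun t => f t + g t) s = deriv (deriv f) s + deriv (deriv g) s := by
  rw [(h.deriv_add_eventuallyEq h').deriv_eq]
  exact deriv_add (h.contDiffAt_deriv.differentiableAt (by simp))
    (h'.contDiffAt_deriv.differentiableAt (by simp))

lemma ContDiffAt.deriv_sub_eventuallyEq {f g : ℝ → ℝ} {s : ℝ} (h : ContDiffAt ℝ 2 f s)
    (h' : ContDiffAt ℝ 2 g s) :
    deriv (fun t => f t - g t) =ᶠ[𝓝 s] fun t => deriv f t - deriv g t := by
  filter_upwards [h.eventually (by simp), h'.eventually (by simp)] with t a b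
  exact deriv_sub (a.differentiableAt (by simp)) (b.differentiableAt (by simp))

lemma ContDiffAt.deriv_deriv_sub {f g : ℝ → ℝ} {s : ℝ} (h : ContDiffAt ℝ 2 f s)
    (h' : ContDiffAt ℝ 2 g s) :
    deriv (deriv fun t => f t - g t) s = deriv (deriv f) s - deriv (deriv g) s := by
  rw [(h.deriv_sub_eventuallyEq h').deriv_eq]
  exact deriv_sub (h.contDiffAt_deriv.differentiableAt (by simp))
    (h'.contDiffAt_deriv.differentiableAt (by simp))

/-- A `C²` perturbation keeps downward jumps of the derivative. -/
lemma DerivJumpsDown.add {f g : ℝ → ℝ} {d : ℝ} (h : DerivJumpsDown f d)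
    (hf : ∀ᶠ s in 𝓝[≠] d, DifferentiableAt ℝ f s) (hg : ContDiffAt ℝ 2 g d) :
    DerivJumpsDown (fun t => f t + g t) d := by
  obtain ⟨p, q, hp, hq, hqp⟩ := h
  have hev : ∀ᶠ s in 𝓝[≠] d, deriv f s + deriv g s = deriv (fun t => f t + g t) s := by
    filter_upwards [hf, nhdsWithin_le_nhds (hg.eventually (by simp))] with s a b
    exact (deriv_add a (b.differentiableAt (by simp))).symm
  have hg' := hg.contDiffAt_deriv.continuousAt.tendsto
  refine ⟨p + deriv g d, q + deriv g d, ?_, ?_, by linarith⟩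
  · exact (hp.add (hg'.mono_left nhdsWithin_le_nhds)).congr'
      (hev.filter_mono (nhdsWithin_mono _ fun s hs => ne_of_lt hs))
  · exact (hq.add (hg'.mono_left nhdsWithin_le_nhds)).congr'
      (hev.filter_mono (nhdsWithin_mono _ fun s hs => ne_of_gt hs))

/-- A `C²` function has matching one-sided derivatives. -/
lemma ContDiffAt.derivJumpsDown {f : ℝ → ℝ} {d : ℝ} (h : ContDiffAt ℝ 2 f d) :
    DerivJumpsDown f d :=
  have := h.contDiffAt_deriv.continuousAt
  ⟨_, _, this.tendsto.mono_left nhdsWithin_le_nhds, this.tendsto.mono_left nhdsWithin_le_nhds,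
    le_rfl⟩

/-! ### Maximum principle on a half-line with corners. -/

section MaximumPrinciple

lemma exists_isMinOn_Iic {z : ℝ → ℝ} {τ : ℝ} (hcont : ContinuousOn z (Iic τ))
    (hbot : Tendsto z atBot (𝓝 0)) {t : ℝ} (ht : t ≤ τ) (hz : z t < 0) :
    ∃ t₀ ≤ τ, z t₀ < 0 ∧ IsMinOn z (Iic τ) t₀ := by
  obtain ⟨R, hR⟩ := eventually_atBot.1 (hbot.eventually (lt_mem_nhds (show z t < 0 from hz)))
  have hRt : R ≤ t := by
    by_contra! h
    exact lt_irrefl _ (hR t h.le)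
  obtain ⟨t₀, ht₀, hmin⟩ := isCompact_Icc.exists_isMinOn (s := Icc R τ) ⟨t, hRt, ht⟩
    (hcont.mono Icc_subset_Iic_self)
  have h0 : z t₀ ≤ z t := hmin ⟨hRt, ht⟩
  refine ⟨t₀, ht₀.2, h0.trans_lt hz, fun s hs => ?_⟩
  rcases le_total R s with h | h
  · exact hmin ⟨h, hs⟩
  · exact h0.trans (hR s h).le

/-- A function cannot have a negative minimum at a point where its derivative jumps downwards and
around which `z'' - c z' - K z ≤ 0`. -/
lemma not_isLocalMin_of_derivJumpsDown {c K : ℝ} (hK : 0 < K) {z : ℝ → ℝ} {d : ℝ}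
    (hcont : ContinuousAt z d) (hd : z d < 0) (hj : DerivJumpsDown z d)
    (hreg : ∀ᶠ s in 𝓝[≠] d, ContDiffAt ℝ 2 z s ∧ deriv (deriv z) s - c * deriv z s - K * z s ≤ 0)
    (hmin : IsLocalMin z d) : False := by
  obtain ⟨p, q, hp, hq, hqp⟩ := hj
  have hca : ∀ᶠ s in 𝓝[≠] d, ContinuousAt z s := hreg.mono fun s hs => hs.1.continuousAt
  -- At a minimum the derivative cannot stay positive on the left, where `z` would increase up to
  -- `d`. As jumps go down, the right limit `q` is nonpositive too.
  have hp0 : p ≤ 0 := by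
    by_contra! hpos
    have h1 : ∀ᶠ s in 𝓝[<] d, 0 < deriv z s := hp.eventually (lt_mem_nhds hpos)
    have h2 : ∀ᶠ s in 𝓝[<] d, ContinuousAt z s :=
      hca.filter_mono (nhdsWithin_mono _ fun s hs => ne_of_lt hs)
    have h3 : ∀ᶠ s in 𝓝[<] d, z d ≤ z s := hmin.filter_mono nhdsWithin_le_nhds
    obtain ⟨l, hl, hl'⟩ := (mem_nhdsLT_iff_exists_Ioo_subset.1 (h1.and (h2.and h3)))
    have hmono : StrictMonoOn z (Icc ((l + d) / 2) d) := by
      refine strictMonoOn_of_deriv_pos (convex_Icc _ _) (fun s hs => ?_) fun s hs => ?_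
      · rcases hs.2.eq_or_lt with rfl | h
        · exact hcont.continuousWithinAt
        · exact (hl' ⟨by have := hs.1; simp only [mem_Iio] at hl; linarith, h⟩).2.1.continuousWithinAt
      · rw [interior_Icc] at hs
        exact (hl' ⟨by have := hs.1; simp only [mem_Iio] at hl; linarith, hs.2⟩).1
    simp only [mem_Iio] at hl
    have hlt := hmono (left_mem_Icc.2 (by linarith)) (right_mem_Icc.2 (by linarith))
      (show (l + d) / 2 < d by linarith)
    have hge := (hl' (show (l + d) / 2 ∈ Ioo l d from ⟨by linarith, by linarith⟩)).2.2
    linarith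
  have hreg' : ∀ᶠ s in 𝓝[>] d,
      ContDiffAt ℝ 2 z s ∧ deriv (deriv z) s - c * deriv z s - K * z s ≤ 0 :=
    hreg.filter_mono (nhdsWithin_mono _ fun s hs => ne_of_gt hs)
  -- If `q = 0`, then `z'' ≤ c z' + K z < 0` just to the right of `d`, so `z'` decreases strictly
  -- from `0`. In either case `z` decreases to the right of `d`, which contradicts minimality.
  have hneg : ∀ᶠ s in 𝓝[>] d, deriv z s < 0 := by
    rcases (hqp.trans hp0).lt_or_eq with h | h
    · exact hq.eventually (gt_mem_nhds h)
    · subst h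
      have hlim : Tendsto (fun s => c * deriv z s + K * z s) (𝓝[>] d) (𝓝 (c * 0 + K * z d)) :=
        (hq.const_mul c).add ((hcont.tendsto.mono_left nhdsWithin_le_nhds).const_mul K)
      have h1 : ∀ᶠ s in 𝓝[>] d, c * deriv z s + K * z s < 0 :=
        hlim.eventually (gt_mem_nhds (by nlinarith))
      obtain ⟨l, hl, hl'⟩ := (mem_nhdsGT_iff_exists_Ioo_subset.1 (h1.and hreg'))
      have hanti : StrictAntiOn (deriv z) (Ioo d l) := by
        refine strictAntiOn_of_deriv_neg (convex_Ioo _ _) (fun s hs => ?_) fun s hs => ?_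
        · exact (hl' hs).2.1.contDiffAt_deriv.continuousAt.continuousWithinAt
        · rw [interior_Ioo] at hs
          have := hl' hs
          linarith [this.1, this.2.2]
      filter_upwards [Ioo_mem_nhdsGT hl] with s hs
      have hm : (d + s) / 2 ∈ Ioo d l := ⟨by linarith [hs.1], by linarith [hs.1, hs.2]⟩
      have h2 : deriv z s < deriv z ((d + s) / 2) := hanti hm hs (by linarith [hs.1])
      have h3 : deriv z ((d + s) / 2) ≤ 0 := by
        refine ge_of_tendsto hq ?_
        filter_upwards [Ioo_mem_nhdsGT hm.1] with r hr
        exact (hanti ⟨hr.1, hr.2.trans hm.2⟩ hm hr.2).le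
      linarith
  have h3 : ∀ᶠ s in 𝓝[>] d, z d ≤ z s := hmin.filter_mono nhdsWithin_le_nhds
  obtain ⟨l, hl, hl'⟩ := (mem_nhdsGT_iff_exists_Ioo_subset.1 (hneg.and (hreg'.and h3)))
  simp only [mem_Ioi] at hl
  have hanti : StrictAntiOn z (Icc d ((l + d) / 2)) := by
    refine strictAntiOn_of_deriv_neg (convex_Icc _ _) (fun s hs => ?_) fun s hs => ?_
    · rcases hs.1.eq_or_lt with rfl | h
      · exact hcont.continuousWithinAt
      · exact (hl' ⟨h, by have := hs.2; linarith⟩).2.1.1.continuousAt.continuousWithinAt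
    · rw [interior_Icc] at hs
      exact (hl' ⟨hs.1, by have := hs.2; linarith⟩).1
  have hlt := hanti (left_mem_Icc.2 (by linarith)) (right_mem_Icc.2 (by linarith))
    (show d < (l + d) / 2 by linarith)
  have hge := (hl' (show (l + d) / 2 ∈ Ioo d l from ⟨by linarith, by linarith⟩)).2.2
  linarith

/-- Maximum principle on a half-line for piecewise smooth functions. -/
theorem nonneg_of_differential_ineq {c K τ : ℝ} (hK : 0 < K) {z : ℝ → ℝ} {D : Finset ℝ}
    (hcont : ∀ t < τ, ContinuousAt z t) (hcont' : ContinuousWithinAt z (Iic τ) τ)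
    (hτ : 0 ≤ z τ) (hbot : Tendsto z atBot (𝓝 0))
    (hreg : ∀ t < τ, t ∉ D → z t < 0 →
      ContDiffAt ℝ 2 z t ∧ deriv (deriv z) t - c * deriv z t - K * z t ≤ 0)
    (hjump : ∀ d ∈ D, DerivJumpsDown z d) : ∀ t ≤ τ, 0 ≤ z t := by
  by_contra! h
  obtain ⟨t, ht, hz⟩ := h
  have hc : ContinuousOn z (Iic τ) := fun s hs => by
    rcases (mem_Iic.1 hs).eq_or_lt with rfl | h
    · exact hcont'
    · exact (hcont s h).continuousWithinAt
  obtain ⟨t₀, ht₀, hneg, hmin⟩ := exists_isMinOn_Iic hc hbot ht hz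
  have hlt : t₀ < τ := ht₀.lt_of_ne (by rintro rfl; linarith)
  have hloc : IsLocalMin z t₀ := hmin.isLocalMin (Iic_mem_nhds hlt)
  have hev : ∀ᶠ s in 𝓝[≠] t₀,
      ContDiffAt ℝ 2 z s ∧ deriv (deriv z) s - c * deriv z s - K * z s ≤ 0 := by
    have h1 : ∀ᶠ s in 𝓝[≠] t₀, s < τ := nhdsWithin_le_nhds (Iio_mem_nhds hlt)
    have h2 : ∀ᶠ s in 𝓝[≠] t₀, z s < 0 :=
      nhdsWithin_le_nhds ((hcont t₀ hlt).eventually (gt_mem_nhds hneg))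
    have h3 : ∀ᶠ s in 𝓝[≠] t₀, s ∉ D := by
      have : ((D : Set ℝ) \ {t₀})ᶜ ∈ 𝓝 t₀ :=
        (D.finite_toSet.subset sdiff_subset).isClosed.isOpen_compl.mem_nhds (by simp)
      filter_upwards [nhdsWithin_le_nhds this, self_mem_nhdsWithin] with s hs hs'
      simpa [show s ≠ t₀ from hs'] using hs
    filter_upwards [h1, h2, h3] with s a b c using hreg s a c b
  refine not_isLocalMin_of_derivJumpsDown hK (hcont t₀ hlt) hneg ?_ hev hloc
  by_cases hD : t₀ ∈ D
  · exact hjump t₀ hD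
  · exact (hreg t₀ hlt hD hneg).1.derivJumpsDown

end MaximumPrinciple

/-! ### The monotone integral operators and their fixed points. -/

/-- The first reaction term, shifted by `K x`. -/
def react₁ (r K x y : ℝ) : ℝ := K * x + x * (1 - r - x + r * y)

/-- The second reaction term, shifted by `K y`; `x` is the delayed argument. -/
def react₂ (b K x y : ℝ) : ℝ := K * y + b * x * (1 - y)

/-- First component of the integral operator whose fixed points are the profiles. -/
def profileMap₁ (c r K : ℝ) (φ ψ : ℝ → ℝ) : ℝ → ℝ :=
  green c K fun s => react₁ r K (φ s) (ψ s)

/-- Second component of the integral operator whose fixed points are the profiles. -/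
def profileMap₂ (b c h K : ℝ) (φ ψ : ℝ → ℝ) : ℝ → ℝ :=
  green c K fun s => react₂ b K (φ (s - c * h)) (ψ s)

/-- A pair of measurable functions with values in the unit interval. -/
structure UnitPair (φ ψ : ℝ → ℝ) : Prop where
  meas₁ : Measurable φ
  meas₂ : Measurable ψ
  mem₁ : ∀ t, φ t ∈ Icc (0 : ℝ) 1
  mem₂ : ∀ t, ψ t ∈ Icc (0 : ℝ) 1

section ProfileMap

variable {b c h r K : ℝ}

/-- On the unit square the reaction `x (1 - r - x + r y)` has `x`-derivative at least `-2`, so `K ≥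
3` leaves slope at least `1`. This slack `x' - x`, beyond mere monotonicity, later gives strict
monotonicity of the profile. -/
lemma react₁_mono (hr₀ : 0 ≤ r) (hr₁ : r ≤ 1) (hK : 3 ≤ K) {x x' y y' : ℝ} (hx : 0 ≤ x)
    (hxx : x ≤ x') (hx' : x' ≤ 1) (hy : 0 ≤ y) (hyy : y ≤ y') :
    react₁ r K x y + (x' - x) ≤ react₁ r K x' y' := by
  unfold react₁
  have h1 : 0 ≤ r * x' * (y' - y) := by
    have : 0 ≤ x' := hx.trans hxx
    have : 0 ≤ y' - y := by linarith
    positivity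
  have h2 : 0 ≤ (x' - x) * (K - 3 + (1 - r) + (2 - x - x') + r * y) := by
    have : 0 ≤ r * y := by positivity
    exact mul_nonneg (by linarith) (by linarith)
  nlinarith

lemma react₂_mono (hb : 0 ≤ b) (hK : b + 3 ≤ K) {x x' y y' : ℝ}
    (hxx : x ≤ x') (hx' : x' ≤ 1) (hyy : y ≤ y') (hy' : y' ≤ 1) :
    react₂ b K x y + (y' - y) ≤ react₂ b K x' y' := by
  unfold react₂
  have h1 : 0 ≤ b * (x' - x) * (1 - y') :=
    mul_nonneg (mul_nonneg hb (by linarith)) (by linarith)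
  have h2 : 0 ≤ (y' - y) * (K - 1 - b * x) := by
    refine mul_nonneg (by linarith) ?_
    have : b * x ≤ b * 1 := mul_le_mul_of_nonneg_left (by linarith) hb
    linarith
  nlinarith

lemma react₁_mem (hr₀ : 0 ≤ r) (hr₁ : r ≤ 1) (hK : 3 ≤ K) {x y : ℝ} (hx : x ∈ Icc (0 : ℝ) 1)
    (hy : y ∈ Icc (0 : ℝ) 1) : react₁ r K x y ∈ Icc 0 K := by
  have h0 := react₁_mono hr₀ hr₁ hK le_rfl hx.1 hx.2 le_rfl hy.1
  have h1 := react₁_mono hr₀ hr₁ hK hx.1 hx.2 le_rfl hy.1 hy.2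
  simp only [react₁] at *
  constructor <;> linarith [hx.1, hx.2]

lemma react₂_mem (hb : 0 ≤ b) (hK : b + 3 ≤ K) {x y : ℝ} (hx : x ∈ Icc (0 : ℝ) 1)
    (hy : y ∈ Icc (0 : ℝ) 1) : react₂ b K x y ∈ Icc 0 K := by
  have h0 := react₂_mono hb hK hx.1 hx.2 hy.1 hy.2
  have h1 := react₂_mono hb hK hx.2 le_rfl hy.2 le_rfl
  simp only [react₂] at *
  constructor <;> linarith [hy.1, hy.2]

lemma UnitPair.measurable_react₁ {φ ψ : ℝ → ℝ} (hu : UnitPair φ ψ) :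
    Measurable fun s => react₁ r K (φ s) (ψ s) := by
  have := hu.meas₁
  have := hu.meas₂
  unfold react₁; fun_prop

lemma UnitPair.measurable_react₂ {φ ψ : ℝ → ℝ} (hu : UnitPair φ ψ) :
    Measurable fun s => react₂ b K (φ (s - c * h)) (ψ s) := by
  have := hu.meas₁
  have := hu.meas₂
  unfold react₂; fun_prop

lemma UnitPair.abs_react₁_le {φ ψ : ℝ → ℝ} (hu : UnitPair φ ψ) (hr₀ : 0 ≤ r) (hr₁ : r ≤ 1)
    (hK : 3 ≤ K) (s : ℝ) : |react₁ r K (φ s) (ψ s)| ≤ K := by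
  have := react₁_mem hr₀ hr₁ hK (hu.mem₁ s) (hu.mem₂ s)
  rw [abs_of_nonneg this.1]; exact this.2

lemma UnitPair.abs_react₂_le {φ ψ : ℝ → ℝ} (hu : UnitPair φ ψ) (hb : 0 ≤ b)
    (hK : b + 3 ≤ K) (s : ℝ) : |react₂ b K (φ (s - c * h)) (ψ s)| ≤ K := by
  have := react₂_mem hb hK (hu.mem₁ (s - c * h)) (hu.mem₂ s)
  rw [abs_of_nonneg this.1]; exact this.2

lemma profileMap₁_mono (hr₀ : 0 ≤ r) (hr₁ : r ≤ 1) (hK : 3 ≤ K) {φ ψ φ' ψ' : ℝ → ℝ}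
    (hu : UnitPair φ ψ) (hu' : UnitPair φ' ψ') (h₁ : φ ≤ φ') (h₂ : ψ ≤ ψ') :
    profileMap₁ c r K φ ψ ≤ profileMap₁ c r K φ' ψ' :=
  green_mono (by linarith) hu.measurable_react₁ hu'.measurable_react₁
    (hu.abs_react₁_le hr₀ hr₁ hK) (hu'.abs_react₁_le hr₀ hr₁ hK) fun s => by
      have := react₁_mono hr₀ hr₁ hK (hu.mem₁ s).1 (h₁ s) (hu'.mem₁ s).2 (hu.mem₂ s).1 (h₂ s)
      linarith [h₁ s]

lemma profileMap₂_mono (hb : 0 ≤ b) (hK : b + 3 ≤ K) {φ ψ φ' ψ' : ℝ → ℝ}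
    (hu : UnitPair φ ψ) (hu' : UnitPair φ' ψ') (h₁ : φ ≤ φ') (h₂ : ψ ≤ ψ') :
    profileMap₂ b c h K φ ψ ≤ profileMap₂ b c h K φ' ψ' :=
  green_mono (by linarith) hu.measurable_react₂ hu'.measurable_react₂
    (hu.abs_react₂_le hb hK) (hu'.abs_react₂_le hb hK) fun s => by
      have := react₂_mono hb hK (h₁ (s - c * h)) (hu'.mem₁ _).2 (h₂ s) (hu'.mem₂ s).2
      linarith [h₂ s]

lemma profileMap₁_shift (φ ψ : ℝ → ℝ) (a t : ℝ) :
    profileMap₁ c r K (fun s => φ (s + a)) (fun s => ψ (s + a)) t =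
      profileMap₁ c r K φ ψ (t + a) :=
  green_shift (fun s => react₁ r K (φ s) (ψ s)) a t

lemma profileMap₂_shift (φ ψ : ℝ → ℝ) (a t : ℝ) :
    profileMap₂ b c h K (fun s => φ (s + a)) (fun s => ψ (s + a)) t =
      profileMap₂ b c h K φ ψ (t + a) := by
  rw [profileMap₂, profileMap₂, ← green_shift]
  congr 1; ext s; rw [show s - c * h + a = s + a - c * h by ring]

lemma UnitPair.shift {φ ψ : ℝ → ℝ} (hu : UnitPair φ ψ) (a : ℝ) :
    UnitPair (fun s => φ (s + a)) fun s => ψ (s + a) :=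
  ⟨hu.meas₁.comp (measurable_id.add_const a), hu.meas₂.comp (measurable_id.add_const a),
    fun _ => hu.mem₁ _, fun _ => hu.mem₂ _⟩

lemma unitPair_one : UnitPair (fun _ => 1) fun _ => 1 :=
  ⟨measurable_const, measurable_const, fun _ => by simp, fun _ => by simp⟩

lemma profileMap₁_nonneg (hr₀ : 0 ≤ r) (hr₁ : r ≤ 1) (hK : 3 ≤ K) {φ ψ : ℝ → ℝ}
    (hu : UnitPair φ ψ) (t : ℝ) : 0 ≤ profileMap₁ c r K φ ψ t :=
  integral_nonneg fun s => mul_nonneg (greenKernel_pos (by linarith) _).le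
    (react₁_mem hr₀ hr₁ hK (hu.mem₁ _) (hu.mem₂ _)).1

lemma profileMap₂_nonneg (hb : 0 ≤ b) (hK : b + 3 ≤ K) {φ ψ : ℝ → ℝ}
    (hu : UnitPair φ ψ) (t : ℝ) : 0 ≤ profileMap₂ b c h K φ ψ t :=
  integral_nonneg fun s => mul_nonneg (greenKernel_pos (by linarith) _).le
    (react₂_mem hb hK (hu.mem₁ _) (hu.mem₂ _)).1

/-- Comparison with the constant pair `(1, 1)`, an equilibrium of the profile system and hence fixed
by the operators. -/
lemma profileMap₁_le_one (hr₀ : 0 ≤ r) (hr₁ : r ≤ 1) (hK : 3 ≤ K) {φ ψ : ℝ → ℝ}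
    (hu : UnitPair φ ψ) (t : ℝ) : profileMap₁ c r K φ ψ t ≤ 1 := by
  have hK0 : 0 < K := by linarith
  have := profileMap₁_mono (c := c) hr₀ hr₁ hK hu unitPair_one (fun s => (hu.mem₁ s).2)
    (fun s => (hu.mem₂ s).2) t
  rw [profileMap₁, profileMap₁, green_const hK0] at this
  simpa [react₁, hK0.ne', profileMap₁] using this

lemma profileMap₂_le_one (hb : 0 ≤ b) (hK : b + 3 ≤ K) {φ ψ : ℝ → ℝ}
    (hu : UnitPair φ ψ) (t : ℝ) : profileMap₂ b c h K φ ψ t ≤ 1 := by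
  have hK0 : 0 < K := by linarith
  have := profileMap₂_mono (c := c) (h := h) hb hK hu unitPair_one (fun s => (hu.mem₁ s).2)
    (fun s => (hu.mem₂ s).2) t
  rw [profileMap₂, profileMap₂, green_const hK0] at this
  simpa [react₂, hK0.ne', profileMap₂] using this

/-- Between a sub-solution and a super-solution of the integral equations that are separated by
a pair of monotone functions there is a monotone solution. -/
theorem exists_monotone_fixedPoint (hb : 0 ≤ b) (hr₀ : 0 ≤ r) (hr₁ : r ≤ 1) (hK : b + 3 ≤ K)
    {a₁ a₂ m₁ m₂ f₁ f₂ : ℝ → ℝ} (ha : UnitPair a₁ a₂) (hf : UnitPair f₁ f₂)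
    (hm₁ : Monotone m₁) (hm₂ : Monotone m₂) (ham₁ : a₁ ≤ m₁) (ham₂ : a₂ ≤ m₂) (hmf₁ : m₁ ≤ f₁)
    (hmf₂ : m₂ ≤ f₂) (hsub₁ : a₁ ≤ profileMap₁ c r K a₁ a₂)
    (hsub₂ : a₂ ≤ profileMap₂ b c h K a₁ a₂) (hsup₁ : profileMap₁ c r K f₁ f₂ ≤ f₁)
    (hsup₂ : profileMap₂ b c h K f₁ f₂ ≤ f₂) :
    ∃ φ ψ : ℝ → ℝ, Monotone φ ∧ Monotone ψ ∧ a₁ ≤ φ ∧ φ ≤ f₁ ∧ a₂ ≤ ψ ∧ ψ ≤ f₂ ∧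
      profileMap₁ c r K φ ψ = φ ∧ profileMap₂ b c h K φ ψ = ψ := by
  have hK3 : 3 ≤ K := by linarith
  -- A Knaster–Tarski argument: the monotone super-solutions above `(a₁, a₂)` are closed under
  -- infima and under the operators, so the pointwise infimum of `X` is a fixed point. No
  -- compactness is needed.
  let X : Set ((ℝ → ℝ) × (ℝ → ℝ)) := {p | Monotone p.1 ∧ Monotone p.2 ∧ a₁ ≤ p.1 ∧ a₂ ≤ p.2 ∧
    (∀ t, p.1 t ≤ 1) ∧ (∀ t, p.2 t ≤ 1) ∧ profileMap₁ c r K p.1 p.2 ≤ p.1 ∧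
    profileMap₂ b c h K p.1 p.2 ≤ p.2}
  have hXu : ∀ p ∈ X, UnitPair p.1 p.2 := fun p hp =>
    ⟨hp.1.measurable, hp.2.1.measurable, fun t => ⟨(ha.mem₁ t).1.trans (hp.2.2.1 t),
      hp.2.2.2.2.1 t⟩, fun t => ⟨(ha.mem₂ t).1.trans (hp.2.2.2.1 t), hp.2.2.2.2.2.1 t⟩⟩
  -- the infimum of the forward translates of the super-solution
  obtain ⟨g, hgX, hg₁, hg₂⟩ : ∃ g ∈ X, g.1 ≤ f₁ ∧ g.2 ≤ f₂ := by
    have bdd (f : ℝ → ℝ) (hf : ∀ t, f t ∈ Icc (0 : ℝ) 1) (t : ℝ) :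
        BddBelow (f '' Ici t) := ⟨0, by rintro _ ⟨s, -, rfl⟩; exact (hf s).1⟩
    have hne (f : ℝ → ℝ) (t : ℝ) : (f '' Ici t).Nonempty := ⟨f t, t, mem_Ici.2 le_rfl, rfl⟩
    have hmono (f : ℝ → ℝ) (hf : ∀ t, f t ∈ Icc (0 : ℝ) 1) :
        Monotone fun t => sInf (f '' Ici t) := fun t t' htt =>
      csInf_le_csInf (bdd f hf t) (hne f t') (image_mono (Ici_subset_Ici.2 htt))
    have hle (f : ℝ → ℝ) (hf : ∀ t, f t ∈ Icc (0 : ℝ) 1) {t s : ℝ} (hts : t ≤ s) :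
        sInf (f '' Ici t) ≤ f s := csInf_le (bdd f hf t) ⟨s, hts, rfl⟩
    have hge (f a m : ℝ → ℝ) (hm : Monotone m) (ham : a ≤ m) (hmf : m ≤ f) (t : ℝ) :
        a t ≤ sInf (f '' Ici t) := by
      refine le_csInf (hne f t) ?_
      rintro _ ⟨s, hs, rfl⟩
      exact (ham t).trans ((hm hs).trans (hmf s))
    -- The given super-solution need not be monotone. Translates of super-solutions are
    -- super-solutions, hence so is the infimum over forward translates, which is monotone. It stays
    -- above `a₁` because the monotone `m₁` separates `a₁` from `f₁`.
    let g₁ : ℝ → ℝ := fun t => sInf (f₁ '' Ici t)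
    let g₂ : ℝ → ℝ := fun t => sInf (f₂ '' Ici t)
    have hg₁f : g₁ ≤ f₁ := fun t => hle f₁ hf.mem₁ le_rfl
    have hg₂f : g₂ ≤ f₂ := fun t => hle f₂ hf.mem₂ le_rfl
    have ha₁ : a₁ ≤ g₁ := hge f₁ a₁ m₁ hm₁ ham₁ hmf₁
    have ha₂ : a₂ ≤ g₂ := hge f₂ a₂ m₂ hm₂ ham₂ hmf₂
    have hg : UnitPair g₁ g₂ := ⟨(hmono f₁ hf.mem₁).measurable, (hmono f₂ hf.mem₂).measurable,
      fun t => ⟨(ha.mem₁ t).1.trans (ha₁ t), (hg₁f t).trans (hf.mem₁ t).2⟩,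
      fun t => ⟨(ha.mem₂ t).1.trans (ha₂ t), (hg₂f t).trans (hf.mem₂ t).2⟩⟩
    refine ⟨(g₁, g₂), ⟨hmono f₁ hf.mem₁, hmono f₂ hf.mem₂, ha₁, ha₂, fun t => (hg.mem₁ t).2,
      fun t => (hg.mem₂ t).2, fun t => ?_, fun t => ?_⟩, hg₁f, hg₂f⟩
    · refine le_csInf (hne f₁ t) ?_
      rintro _ ⟨s, hs, rfl⟩
      have hs : 0 ≤ s - t := sub_nonneg.2 hs
      have h1 := profileMap₁_mono (c := c) hr₀ hr₁ hK3 hg (hf.shift (s - t))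
        (fun u => hle f₁ hf.mem₁ (by linarith)) (fun u => hle f₂ hf.mem₂ (by linarith)) t
      rw [profileMap₁_shift] at h1
      refine h1.trans ?_
      have := hsup₁ s
      simpa using this
    · refine le_csInf (hne f₂ t) ?_
      rintro _ ⟨s, hs, rfl⟩
      have hs : 0 ≤ s - t := sub_nonneg.2 hs
      have h1 := profileMap₂_mono (c := c) (h := h) hb hK hg (hf.shift (s - t))
        (fun u => hle f₁ hf.mem₁ (by linarith)) (fun u => hle f₂ hf.mem₂ (by linarith)) t
      rw [profileMap₂_shift] at h1
      refine h1.trans ?_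
      have := hsup₂ s
      simpa using this
  -- the least super-solution
  let x₁ : ℝ → ℝ := fun t => sInf ((fun p : (ℝ → ℝ) × (ℝ → ℝ) => p.1 t) '' X)
  let x₂ : ℝ → ℝ := fun t => sInf ((fun p : (ℝ → ℝ) × (ℝ → ℝ) => p.2 t) '' X)
  have hx₁ : ∀ p ∈ X, x₁ ≤ p.1 := fun p hp t =>
    csInf_le ⟨a₁ t, by rintro _ ⟨q, hq, rfl⟩; exact hq.2.2.1 t⟩ ⟨p, hp, rfl⟩
  have hx₂ : ∀ p ∈ X, x₂ ≤ p.2 := fun p hp t =>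
    csInf_le ⟨a₂ t, by rintro _ ⟨q, hq, rfl⟩; exact hq.2.2.2.1 t⟩ ⟨p, hp, rfl⟩
  have hle₁ (t y : ℝ) (hy : ∀ p ∈ X, y ≤ p.1 t) : y ≤ x₁ t :=
    le_csInf ⟨_, g, hgX, rfl⟩ (by rintro _ ⟨q, hq, rfl⟩; exact hy q hq)
  have hle₂ (t y : ℝ) (hy : ∀ p ∈ X, y ≤ p.2 t) : y ≤ x₂ t :=
    le_csInf ⟨_, g, hgX, rfl⟩ (by rintro _ ⟨q, hq, rfl⟩; exact hy q hq)
  have hax₁ : a₁ ≤ x₁ := fun t => hle₁ t _ fun p hp => hp.2.2.1 t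
  have hax₂ : a₂ ≤ x₂ := fun t => hle₂ t _ fun p hp => hp.2.2.2.1 t
  have hmx₁ : Monotone x₁ := fun t t' htt => hle₁ _ _ fun p hp => (hx₁ p hp t).trans (hp.1 htt)
  have hmx₂ : Monotone x₂ := fun t t' htt => hle₂ _ _ fun p hp => (hx₂ p hp t).trans (hp.2.1 htt)
  have hx1 : ∀ t, x₁ t ≤ 1 := fun t => (hx₁ g hgX t).trans (hgX.2.2.2.2.1 t)
  have hx2 : ∀ t, x₂ t ≤ 1 := fun t => (hx₂ g hgX t).trans (hgX.2.2.2.2.2.1 t)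
  have hxu : UnitPair x₁ x₂ := ⟨hmx₁.measurable, hmx₂.measurable,
    fun t => ⟨(ha.mem₁ t).1.trans (hax₁ t), hx1 t⟩, fun t => ⟨(ha.mem₂ t).1.trans (hax₂ t), hx2 t⟩⟩
  have hT₁ : profileMap₁ c r K x₁ x₂ ≤ x₁ := fun t => hle₁ _ _ fun p hp =>
    (profileMap₁_mono hr₀ hr₁ hK3 hxu (hXu p hp) (hx₁ p hp) (hx₂ p hp) t).trans
      (hp.2.2.2.2.2.2.1 t)
  have hT₂ : profileMap₂ b c h K x₁ x₂ ≤ x₂ := fun t => hle₂ _ _ fun p hp =>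
    (profileMap₂_mono hb hK hxu (hXu p hp) (hx₁ p hp) (hx₂ p hp) t).trans
      (hp.2.2.2.2.2.2.2 t)
  have hmT₁ : Monotone (profileMap₁ c r K x₁ x₂) := fun t t' htt => by
    have := profileMap₁_mono (c := c) hr₀ hr₁ hK3 hxu (hxu.shift (t' - t))
      (fun s => hmx₁ (by linarith)) (fun s => hmx₂ (by linarith)) t
    rw [profileMap₁_shift] at this
    simpa using this
  have hmT₂ : Monotone (profileMap₂ b c h K x₁ x₂) := fun t t' htt => by
    have := profileMap₂_mono (c := c) (h := h) hb hK hxu (hxu.shift (t' - t))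
      (fun s => hmx₁ (by linarith)) (fun s => hmx₂ (by linarith)) t
    rw [profileMap₂_shift] at this
    simpa using this
  have hTu : UnitPair (profileMap₁ c r K x₁ x₂) (profileMap₂ b c h K x₁ x₂) :=
    ⟨hmT₁.measurable, hmT₂.measurable,
      fun t => ⟨profileMap₁_nonneg hr₀ hr₁ hK3 hxu t, profileMap₁_le_one hr₀ hr₁ hK3 hxu t⟩,
      fun t => ⟨profileMap₂_nonneg hb hK hxu t, profileMap₂_le_one hb hK hxu t⟩⟩
  -- The image of the least element lies again in `X`, which gives the inequality opposite to `hT₁`,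
  -- `hT₂`.
  have hTX : (profileMap₁ c r K x₁ x₂, profileMap₂ b c h K x₁ x₂) ∈ X :=
    ⟨hmT₁, hmT₂, hsub₁.trans (profileMap₁_mono hr₀ hr₁ hK3 ha hxu hax₁ hax₂),
      hsub₂.trans (profileMap₂_mono hb hK ha hxu hax₁ hax₂), fun t => (hTu.mem₁ t).2,
      fun t => (hTu.mem₂ t).2, profileMap₁_mono hr₀ hr₁ hK3 hTu hxu hT₁ hT₂,
      profileMap₂_mono hb hK hTu hxu hT₁ hT₂⟩
  exact ⟨x₁, x₂, hmx₁, hmx₂, hax₁, (hx₁ g hgX).trans hg₁, hax₂, (hx₂ g hgX).trans hg₂,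
    le_antisymm hT₁ (hx₁ _ hTX), le_antisymm hT₂ (hx₂ _ hTX)⟩

end ProfileMap

/-! ### From fixed points of the integral operators to plane waves. -/

lemma contDiff_two_of_hasDerivAt {f f' f'' : ℝ → ℝ} (h : ∀ t, HasDerivAt f (f' t) t)
    (h' : ∀ t, HasDerivAt f' (f'' t) t) (hc : Continuous f'') : ContDiff ℝ 2 f := by
  have e : deriv f = f' := funext fun t => (h t).deriv
  have e' : deriv f' = f'' := funext fun t => (h' t).deriv
  have h1 : ContDiff ℝ 1 f' := contDiff_one_iff_deriv.2 ⟨fun t => (h' t).differentiableAt, e' ▸ hc⟩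
  have : ContDiff ℝ (1 + 1) f := contDiff_succ_iff_deriv.2
    ⟨fun t => (h t).differentiableAt, by simp, e ▸ h1⟩
  simpa [one_add_one_eq_two] using this

/-- The Laplacian of a plane wave. -/
lemma laplacian_planeWave {n : ℕ} {e : EuclideanSpace ℝ (Fin n)} (he : ‖e‖ = 1)
    {f f' f'' : ℝ → ℝ} (h : ∀ t, HasDerivAt f (f' t) t) (h' : ∀ t, HasDerivAt f' (f'' t) t)
    (k : ℝ) (x : EuclideanSpace ℝ (Fin n)) :
    Laplacian.laplacian (fun x => f (inner ℝ e x + k)) x = f'' (inner ℝ e x + k) := by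
  have hl (x : EuclideanSpace ℝ (Fin n)) :
      HasFDerivAt (fun x => inner ℝ e x + k) (innerSL ℝ e) x :=
    ((innerSL ℝ e).hasFDerivAt (x := x)).add_const k
  have h1 : fderiv ℝ (fun x => f (inner ℝ e x + k)) =
      fun x => f' (inner ℝ e x + k) • innerSL ℝ e :=
    funext fun x => ((h _).comp_hasFDerivAt x (hl x)).fderiv
  have h2 : fderiv ℝ (fderiv ℝ (fun x => f (inner ℝ e x + k))) x =
      (f'' (inner ℝ e x + k) • innerSL ℝ e).smulRight (innerSL ℝ e) := by
    rw [h1]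
    exact (((h' _).comp_hasFDerivAt x (hl x)).smul_const (innerSL ℝ e)).fderiv
  rw [InnerProductSpace.laplacian_eq_iteratedFDeriv_stdOrthonormalBasis]
  simp only [iteratedFDeriv_two_apply, h2]
  simp only [Matrix.cons_val_zero, Matrix.cons_val_one, ContinuousLinearMap.smulRight_apply,
    smul_apply, innerSL_apply_apply, smul_eq_mul]
  have := (stdOrthonormalBasis ℝ (EuclideanSpace ℝ (Fin n))).sum_sq_norm_inner_left e
  rw [he] at this
  rw [one_pow] at this
  refine Eq.trans ?_ (mul_one _)
  rw [← this, Finset.mul_sum]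
  refine Finset.sum_congr rfl fun i _ => ?_
  rw [Real.norm_eq_abs, sq_abs]; ring

/-- Monotone solutions of the integral equations that vanish at `-∞` are wavefront profiles. -/
theorem isMonotoneWavefront_of_fixedPoint {b c r h K : ℝ} (hb : 0 < b) (hr₀ : 0 ≤ r)
    (hr₁ : r ≤ 1) (hK : b + 3 ≤ K) {φ ψ : ℝ → ℝ} (hu : UnitPair φ ψ) (hφm : Monotone φ)
    (hψm : Monotone ψ) (hφ : profileMap₁ c r K φ ψ = φ) (hψ : profileMap₂ b c h K φ ψ = ψ)
    (hφ0 : Tendsto φ atBot (𝓝 0)) (hψ0 : Tendsto ψ atBot (𝓝 0)) {τ : ℝ}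
    (hpos : ∀ t ≤ τ, 0 < φ t) :
    IsMonotoneWavefront b c r h φ (fun t => 1 - ψ (t + c * h)) := by
  have hK0 : 0 < K := by linarith
  have hK3 : 3 ≤ K := by linarith
  have hφpos (t : ℝ) : 0 < φ t :=
    (hpos _ (min_le_left τ t)).trans_le (hφm (min_le_right τ t))
  have hφc : Continuous φ := hφ ▸ continuous_green hK0 hu.measurable_react₁ (hu.abs_react₁_le hr₀ hr₁ hK3)
  have hψc : Continuous ψ := hψ ▸ continuous_green hK0 hu.measurable_react₂ (hu.abs_react₂_le hb.le hK)
  have hr₁c : Continuous fun s => react₁ r K (φ s) (ψ s) := by unfold react₁; fun_prop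
  have hr₂c : Continuous fun s => react₂ b K (φ (s - c * h)) (ψ s) := by unfold react₂; fun_prop
  obtain ⟨φ', hφ', hφ''⟩ := exists_deriv_green (c := c) hK0 hr₁c (hu.abs_react₁_le hr₀ hr₁ hK3)
  obtain ⟨ψ', hψ', hψ''⟩ := exists_deriv_green (c := c) hK0 hr₂c (hu.abs_react₂_le hb.le hK)
  rw [show green c K _ = φ from hφ] at hφ' hφ''
  rw [show green c K _ = ψ from hψ] at hψ' hψ''
  -- limits at `+∞`
  have lim (f : ℝ → ℝ) (hf : Monotone f) (hf1 : ∀ t, f t ≤ 1) :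
      ∃ l, Tendsto f atTop (𝓝 l) ∧ ∀ t, f t ≤ l := by
    have hbdd : BddAbove (range f) := ⟨1, by rintro _ ⟨s, rfl⟩; exact hf1 s⟩
    exact ⟨_, tendsto_atTop_ciSup hf hbdd, fun t => le_ciSup hbdd t⟩
  obtain ⟨l, hl, hlφ⟩ := lim φ hφm fun t => (hu.mem₁ t).2
  obtain ⟨k, hk, -⟩ := lim ψ hψm fun t => (hu.mem₂ t).2
  have hshift (a : ℝ) : Tendsto (fun t : ℝ => t - a) atTop atTop :=
    tendsto_atTop_add_const_right _ _ tendsto_id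
  have hl0 : 0 < l := (hφpos 0).trans_le (hlφ 0)
  -- In the limit the integral equations become `b l (1 - k) = 0` and `l (1 - r - l + r k) = 0`. As
  -- `l > 0`, they force `k = 1` and then `l = 1`.
  have hk1 : k = 1 := by
    have h1 : Tendsto (fun s => react₂ b K (φ (s - c * h)) (ψ s)) atTop (𝓝 (react₂ b K l k)) := by
      unfold react₂
      exact (hk.const_mul K).add (((hl.comp (hshift (c * h))).const_mul b).mul
        (tendsto_const_nhds.sub hk))
    have h2 := tendsto_green (c := c) hK0 hu.measurable_react₂ (hu.abs_react₂_le hb.le hK) hshift h1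
    rw [show green c K _ = ψ from hψ] at h2
    have h3 := tendsto_nhds_unique h2 hk
    rw [div_eq_iff hK0.ne', react₂] at h3
    have h4 : b * l * (1 - k) = 0 := by linarith
    have : b * l ≠ 0 := by positivity
    linarith [(mul_eq_zero.1 h4).resolve_left this]
  have hl1 : l = 1 := by
    have h1 : Tendsto (fun s => react₁ r K (φ s) (ψ s)) atTop (𝓝 (react₁ r K l k)) := by
      unfold react₁
      exact (hl.const_mul K).add (hl.mul ((tendsto_const_nhds.sub hl).add (hk.const_mul r)))
    have h2 := tendsto_green (c := c) hK0 hu.measurable_react₁ (hu.abs_react₁_le hr₀ hr₁ hK3)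
      hshift h1
    rw [show green c K _ = φ from hφ] at h2
    have h3 := tendsto_nhds_unique h2 hl
    rw [div_eq_iff hK0.ne', react₁, hk1] at h3
    have h4 : l * (1 - l) = 0 := by linarith
    linarith [(mul_eq_zero.1 h4).resolve_left hl0.ne']
  subst hk1 hl1
  -- strict monotonicity
  have hstrict (f : ℝ → ℝ) (g : ℝ → ℝ) (hg : Continuous g) (hgK : ∀ s, |g s| ≤ K)
      (hf : green c K g = f) (hfg : ∀ s s', s ≤ s' → g s + (f s' - f s) ≤ g s') (hfm : Monotone f)
      (h0 : Tendsto f atBot (𝓝 0)) (h1 : Tendsto f atTop (𝓝 1)) : StrictMono f := by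
    intro t t' htt
    by_contra! hle
    -- By the slack in `hfg`, the increment of `g` over `t' - t` dominates that of `f`. Were the
    -- latter positive somewhere, the Green potential of the former would be positive everywhere, in
    -- particular `f t < f t'`. So `f` has period `t' - t`, which contradicts its distinct limits
    -- `0` and `1`.
    have hd : ∀ s, f (s + (t' - t)) = f s := by
      by_contra! hne
      obtain ⟨s, hs⟩ := hne
      have hs' : f s < f (s + (t' - t)) := lt_of_le_of_ne (hfm (by linarith)) hs.symm
      have hp := green_pos (c := c) (g := fun s => g (s + (t' - t)) - g s) (M := K + K) hK0
        (by fun_prop) (fun s => (abs_sub _ _).trans (add_le_add (hgK _) (hgK _)))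
        (fun s => by
          have := hfg s (s + (t' - t)) (by linarith)
          have := hfm (show s ≤ s + (t' - t) by linarith)
          linarith) (t₀ := s) (by
          have := hfg s (s + (t' - t)) (by linarith)
          linarith) t
      rw [green_sub hK0 (by fun_prop) (by fun_prop) (fun s => hgK _) hgK, green_shift, hf] at hp
      simp only [add_sub_cancel] at hp
      linarith
    have hn (n : ℕ) : f (n * (t' - t)) = f 0 := by
      induction n with
      | zero => simp
      | succ n ih => rw [← ih, ← hd (n * (t' - t))]; congr 1; push_cast; ring
    have hn' (n : ℕ) : f (-(n * (t' - t))) = f 0 := by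
      induction n with
      | zero => simp
      | succ n ih => rw [← ih, ← hd (-((n + 1 : ℕ) * (t' - t)))]; congr 1; push_cast; ring
    have htop : Tendsto (fun n : ℕ => (n : ℝ) * (t' - t)) atTop atTop :=
      tendsto_natCast_atTop_atTop.atTop_mul_const (by linarith)
    have e1 := tendsto_nhds_unique (h1.comp htop)
      (tendsto_const_nhds.congr fun n => (hn n).symm)
    have e2 := tendsto_nhds_unique (h0.comp (tendsto_neg_atTop_atBot.comp htop))
      (tendsto_const_nhds.congr fun n => (hn' n).symm)
    linarith
  have hφs : StrictMono φ := hstrict φ _ hr₁c (hu.abs_react₁_le hr₀ hr₁ hK3) hφ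
    (fun s s' hs => react₁_mono hr₀ hr₁ hK3 (hu.mem₁ s).1 (hφm hs) (hu.mem₁ s').2 (hu.mem₂ s).1
      (hψm hs)) hφm hφ0 hl
  have hψs : StrictMono ψ := hstrict ψ _ hr₂c (hu.abs_react₂_le hb.le hK) hψ
    (fun s s' hs => react₂_mono hb.le hK (hφm (by linarith)) (hu.mem₁ _).2
      (hψm hs) (hu.mem₂ s').2) hψm hψ0 hk
  have hψ1 (t : ℝ) : ψ t < 1 := (hψs (lt_add_one t)).trans_le (hu.mem₂ _).2
  -- the equations
  have eq₁ (t : ℝ) : HasDerivAt φ' (c * φ' t - φ t * (1 - r - φ t + r * ψ t)) t := by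
    refine (hφ'' t).congr_deriv ?_
    unfold react₁; ring
  have eq₂ (t : ℝ) : HasDerivAt ψ' (c * ψ' t - b * φ (t - c * h) * (1 - ψ t)) t := by
    refine (hψ'' t).congr_deriv ?_
    unfold react₂; ring
  -- The advance by `c h` gives `θ(t - c h) = 1 - ψ(t)`: it trades the delay of `v` in the first
  -- equation of the system for the delay of `φ` in the second profile equation.
  set θ : ℝ → ℝ := fun t => 1 - ψ (t + c * h) with hθ
  have hθ' (t : ℝ) : HasDerivAt θ (-ψ' (t + c * h)) t :=
    ((hψ' _).comp_add_const t (c * h)).const_sub 1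
  have hθ'' (t : ℝ) : HasDerivAt (fun t => -ψ' (t + c * h))
      (-(c * ψ' (t + c * h) - b * φ t * θ t)) t := by
    refine ((eq₂ _).comp_add_const t (c * h)).fun_neg.congr_deriv ?_
    simp [hθ]
  have hφ'c : Continuous φ' := continuous_iff_continuousAt.2 fun t => (eq₁ t).continuousAt
  have hψ'c : Continuous ψ' := continuous_iff_continuousAt.2 fun t => (eq₂ t).continuousAt
  have hφ2 : ContDiff ℝ 2 φ := contDiff_two_of_hasDerivAt hφ' eq₁ (by fun_prop)
  have hθ2 : ContDiff ℝ 2 θ := contDiff_two_of_hasDerivAt hθ' hθ'' (by fun_prop)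
  have hshift' (a : ℝ) : Tendsto (fun t : ℝ => t + a) atTop atTop :=
    tendsto_atTop_add_const_right _ _ tendsto_id
  have hshift'' (a : ℝ) : Tendsto (fun t : ℝ => t + a) atBot atBot :=
    tendsto_atBot_add_const_right _ _ tendsto_id
  refine ⟨fun t => ⟨hφpos t, sub_pos.2 (hψ1 _)⟩, hφs, fun s t hst => ?_, ⟨hφ0, ?_⟩, ⟨hl, ?_⟩, ?_⟩
  · exact sub_lt_sub_left (hψs (by linarith)) 1
  · simpa using (hψ0.comp (hshift'' (c * h))).const_sub 1
  · simpa using (hk.comp (hshift' (c * h))).const_sub 1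
  · intro n e he
    refine ⟨fun t => ⟨?_, ?_⟩, fun t x => ⟨?_, ?_⟩⟩
    · exact hφ2.comp ((contDiff_const.inner ℝ contDiff_id).add contDiff_const)
    · exact hθ2.comp ((contDiff_const.inner ℝ contDiff_id).add contDiff_const)
    · rw [laplacian_planeWave he hφ' eq₁]
      have hd : HasDerivAt (fun s : ℝ => inner ℝ e x + c * s) c t := by
        simpa using ((hasDerivAt_id t).const_mul c).const_add (inner ℝ e x)
      refine ((hφ' _).comp t hd).congr_deriv ?_
      rw [hθ]
      simp only [show inner ℝ e x + c * (t - h) + c * h = inner ℝ e x + c * t by ring]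
      ring
    · rw [laplacian_planeWave he hθ' hθ'']
      have hd : HasDerivAt (fun s : ℝ => inner ℝ e x + c * s) c t := by
        simpa using ((hasDerivAt_id t).const_mul c).const_add (inner ℝ e x)
      refine ((hθ' _).comp t hd).congr_deriv ?_
      ring

/-! ### Comparison of differential inequalities with Green potentials. -/

section Comparison

variable {c K : ℝ}

lemma contDiffAt_green {g : ℝ → ℝ} {M : ℝ} (hK : 0 < K) (hg : Continuous g)
    (hM : ∀ s, |g s| ≤ M) : ContDiff ℝ 2 (green c K g) ∧
      ∀ t, deriv (deriv (green c K g)) t - c * deriv (green c K g) t - K * green c K g t = -g t := by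
  obtain ⟨w', h', h''⟩ := exists_deriv_green (c := c) hK hg hM
  have e : deriv (green c K g) = w' := funext fun t => (h' t).deriv
  have hwc : Continuous (green c K g) := continuous_green hK hg.measurable hM
  have hwc' : Continuous w' := continuous_iff_continuousAt.2 fun t => (h'' t).continuousAt
  refine ⟨contDiff_two_of_hasDerivAt h' h'' (by fun_prop), fun t => ?_⟩
  rw [e, (h'' t).deriv]; ring

/-- Piecewise smooth super-solutions, truncated at `1`, dominate the Green potential. -/
theorem green_le_of_differential_ineq {f g : ℝ → ℝ} {M τ : ℝ} {D : Finset ℝ} (hK : 0 < K)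
    (hg : Continuous g) (hM : ∀ s, |g s| ≤ M) (hgK : ∀ s, g s ≤ K) (hg0 : Tendsto g atBot (𝓝 0))
    (hf : ∀ t ≤ τ, ContinuousAt f t) (hfτ : 1 ≤ f τ) (hf0 : Tendsto f atBot (𝓝 0))
    (hreg : ∀ t < τ, t ∉ D → f t < 1 →
      ContDiffAt ℝ 2 f t ∧ deriv (deriv f) t - c * deriv f t - K * f t ≤ -g t)
    (hjump : ∀ d ∈ D, DerivJumpsDown f d)
    (hdiff : ∀ d ∈ D, ∀ᶠ s in 𝓝[≠] d, DifferentiableAt ℝ f s) :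
    ∀ t ≤ τ, green c K g t ≤ f t := by
  obtain ⟨hw, hweq⟩ := contDiffAt_green (c := c) hK hg hM
  have hw1 (t : ℝ) : green c K g t ≤ 1 := by
    have := green_mono (c := c) (M := max M K) hK hg.measurable measurable_const
      (fun s => (hM s).trans (le_max_left _ _))
      (fun s => by rw [abs_of_pos hK]; exact le_max_right _ _) hgK t
    rwa [green_const hK, div_self hK.ne'] at this
  have hw0 : Tendsto (green c K g) atBot (𝓝 0) := by
    have := tendsto_green (c := c) hK hg.measurable hM (l := atBot)
      (fun s => tendsto_atBot_add_const_right _ _ tendsto_id) hg0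
    simpa using this
  have key := nonneg_of_differential_ineq (c := c) (K := K) (τ := τ)
    (z := fun t => f t - green c K g t) (D := D) hK
    (fun t ht => (hf t ht.le).sub hw.continuous.continuousAt)
    ((hf τ le_rfl).sub hw.continuous.continuousAt).continuousWithinAt
    (by linarith [hw1 τ]) (by simpa using hf0.sub hw0)
    (fun t ht hD hz => by
      -- The potential is at most `1`, so a point where `f` lies below it satisfies `f < 1`. This is
      -- why the inequality for `f` is needed only below level `1`.
      obtain ⟨h1, h2⟩ := hreg t ht hD (by linarith [hw1 t])
      refine ⟨h1.sub hw.contDiffAt, ?_⟩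
      rw [h1.deriv_deriv_sub hw.contDiffAt,
        (h1.deriv_sub_eventuallyEq hw.contDiffAt).eq_of_nhds]
      linarith [hweq t])
    (fun d hd => by
      have := (hjump d hd).add (hdiff d hd) (g := fun t => -green c K g t) hw.contDiffAt.neg
      simpa [sub_eq_add_neg] using this)
  exact fun t ht => by linarith [key t ht]

/-- Smooth sub-solutions, truncated at `0`, are dominated by the Green potential. -/
theorem le_green_of_differential_ineq {f g : ℝ → ℝ} {M τ : ℝ} (hK : 0 < K)
    (hg : Continuous g) (hM : ∀ s, |g s| ≤ M) (hgn : ∀ s, 0 ≤ g s) (hg0 : Tendsto g atBot (𝓝 0))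
    (hf : ∀ t ≤ τ, ContDiffAt ℝ 2 f t) (hfτ : f τ ≤ 0) (hf0 : Tendsto f atBot (𝓝 0))
    (hreg : ∀ t < τ, 0 < f t → -g t ≤ deriv (deriv f) t - c * deriv f t - K * f t) :
    ∀ t ≤ τ, f t ≤ green c K g t := by
  obtain ⟨hw, hweq⟩ := contDiffAt_green (c := c) hK hg hM
  have hwn (t : ℝ) : 0 ≤ green c K g t :=
    integral_nonneg fun s => mul_nonneg (greenKernel_pos hK _).le (hgn _)
  have hw0 : Tendsto (green c K g) atBot (𝓝 0) := by
    have := tendsto_green (c := c) hK hg.measurable hM (l := atBot)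
      (fun s => tendsto_atBot_add_const_right _ _ tendsto_id) hg0
    simpa using this
  have key := nonneg_of_differential_ineq (c := c) (K := K) (τ := τ)
    (z := fun t => green c K g t - f t) (D := ∅) hK
    (fun t ht => hw.continuous.continuousAt.sub (hf t ht.le).continuousAt)
    (hw.continuous.continuousAt.sub (hf τ le_rfl).continuousAt).continuousWithinAt
    (by linarith [hwn τ]) (by simpa using hw0.sub hf0)
    (fun t ht _ hz => by
      have h1 := hf t ht.le
      refine ⟨hw.contDiffAt.sub h1, ?_⟩
      rw [hw.contDiffAt.deriv_deriv_sub h1, (hw.contDiffAt.deriv_sub_eventuallyEq h1).eq_of_nhds]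
      linarith [hweq t, hreg t ht (by linarith [hwn t])])
    (by simp)
  exact fun t ht => by linarith [key t ht]

end Comparison

/-! ### Correctors that restore uniform strictness at the corners. -/

section Corrector

/-- Polynomial growth is negligible against exponential decay at `-∞`. -/
lemma tendsto_polynomial_mul_exp_atBot (P : Polynomial ℝ) :
    Tendsto (fun t => P.eval t * Real.exp t) atBot (𝓝 0) := by
  have h := ((P.comp (-Polynomial.X)).tendsto_div_exp_atTop).comp tendsto_neg_atBot_atTop
  refine h.congr fun t => ?_
  simp [Real.exp_neg]

/-- A nonpositive smooth function with nondegenerate zeros on a finite set and with prescribed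
exponential decay at `-∞`. -/
lemma exists_corrector (D : Finset ℝ) (ν : ℝ) : ∃ G : ℝ → ℝ, ContDiff ℝ 2 G ∧ (∀ t, G t ≤ 0) ∧
    (∀ d ∈ D, G d = 0 ∧ deriv G d = 0 ∧ deriv (deriv G) d < 0) ∧
    Tendsto (fun t => G t / Real.exp (ν * t)) atBot (𝓝 0) ∧
    Tendsto (fun t => deriv G t / Real.exp (ν * t)) atBot (𝓝 0) ∧
    Tendsto (fun t => deriv (deriv G) t / Real.exp (ν * t)) atBot (𝓝 0) := by
  classical
  -- The corrector is `-P² e^{(ν+1)t}`. The zeros of `P` are simple, so its second derivative at `d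
  -- ∈ D` is `-2 P'(d)² e^{(ν+1)d} < 0`; the rate `ν + 1` makes it negligible against `e^{νt}` at
  -- `-∞`.
  let P : Polynomial ℝ := ∏ d ∈ D, (Polynomial.X - Polynomial.C d)
  have hE (B t : ℝ) : HasDerivAt (fun t => Real.exp (B * t)) (Real.exp (B * t) * B) t := by
    have := ((hasDerivAt_id t).const_mul B).exp
    simpa using this
  have hd (R : Polynomial ℝ) (t : ℝ) : HasDerivAt (fun t => R.eval t * Real.exp ((ν + 1) * t))
      ((R.derivative + Polynomial.C (ν + 1) * R).eval t * Real.exp ((ν + 1) * t)) t := by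
    refine ((R.hasDerivAt t).mul (hE (ν + 1) t)).congr_deriv ?_
    simp; ring
  have hlim (R : Polynomial ℝ) :
      Tendsto (fun t => R.eval t * Real.exp ((ν + 1) * t) / Real.exp (ν * t)) atBot (𝓝 0) := by
    refine (tendsto_polynomial_mul_exp_atBot R).congr fun t => ?_
    rw [mul_div_assoc, ← Real.exp_sub]; ring_nf
  set Q : Polynomial ℝ := -P ^ 2 with hQ
  set Q₁ := Q.derivative + Polynomial.C (ν + 1) * Q with hQ₁
  set Q₂ := Q₁.derivative + Polynomial.C (ν + 1) * Q₁ with hQ₂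
  have e₁ : deriv (fun t => Q.eval t * Real.exp ((ν + 1) * t)) =
      fun t => Q₁.eval t * Real.exp ((ν + 1) * t) := funext fun t => (hd Q t).deriv
  have e₂ : deriv (fun t => Q₁.eval t * Real.exp ((ν + 1) * t)) =
      fun t => Q₂.eval t * Real.exp ((ν + 1) * t) := funext fun t => (hd Q₁ t).deriv
  refine ⟨fun t => Q.eval t * Real.exp ((ν + 1) * t), ?_, fun t => ?_, fun d hdD => ?_, hlim Q, ?_, ?_⟩
  · exact contDiff_two_of_hasDerivAt (hd Q) (hd Q₁) (by fun_prop)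
  · have : Q.eval t ≤ 0 := by simp [hQ, sq_nonneg]
    exact mul_nonpos_of_nonpos_of_nonneg this (Real.exp_pos _).le
  · rw [e₁, e₂]
    have h0 : P.eval d = 0 := by
      rw [Polynomial.eval_prod]
      exact Finset.prod_eq_zero hdD (by simp)
    have hsep : P.Separable := Polynomial.separable_prod_X_sub_C_iff'.2 fun x _ y _ h => h
    have h1 : P.derivative.eval d ≠ 0 := by
      have := hsep.eval₂_derivative_ne_zero (RingHom.id ℝ) (x := d) (by simpa using h0)
      simpa using this
    refine ⟨by simp [hQ, h0], by simp [hQ₁, hQ, h0, Polynomial.derivative_pow], ?_⟩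
    refine mul_neg_of_neg_of_pos ?_ (Real.exp_pos _)
    have : Q₂.eval d = -(2 * (P.derivative.eval d) ^ 2) := by
      simp [hQ₂, hQ₁, hQ, h0, Polynomial.derivative_pow]
      ring
    rw [this]
    have := sq_pos_of_ne_zero h1 
    linarith
  · rw [e₁]; exact hlim Q₁
  · rw [e₁, e₂]; exact hlim Q₂

/-- A function that is negative off a finite set becomes uniformly negative on a compact interval
after adding a small multiple of a function which is negative on this finite set. -/
lemma exists_uniform_neg {N H : ℝ → ℝ} {A τ : ℝ} {D : Finset ℝ}
    (hN : ∀ t ∈ Icc A τ, t ∉ D → ContinuousWithinAt N (Icc A τ) t ∧ N t < 0) (hH : Continuous H)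
    (hHD : ∀ d ∈ D, H d < 0) :
    ∃ ε₀ > 0, ∀ ε, 0 < ε → ε ≤ ε₀ → ∃ δ > 0, ∀ t ∈ Icc A τ, t ∉ D → N t + ε * H t ≤ -δ := by
  -- Where `H < -κ` the corrector alone contributes `-ε κ`. The rest of the interval is compact and
  -- avoids `D`, so `N` is there bounded away from `0`, and a small `ε H` cannot spoil this.
  obtain ⟨κ, hκ, hκD⟩ : ∃ κ > 0, ∀ d ∈ D, H d < -κ := by
    rcases D.eq_empty_or_nonempty with rfl | hne
    · exact ⟨1, one_pos, by simp⟩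
    · obtain ⟨d, hd, hmax⟩ := D.exists_max_image H hne
      refine ⟨-H d / 2, by linarith [hHD d hd], fun d' hd' => ?_⟩
      linarith [hmax d' hd', hHD d hd]
  have hcomp : IsCompact (Icc A τ ∩ {t | -κ ≤ H t}) :=
    isCompact_Icc.inter_right (isClosed_le continuous_const hH)
  obtain ⟨m, hm, hmN⟩ : ∃ m > 0, ∀ t ∈ Icc A τ ∩ {t | -κ ≤ H t}, N t ≤ -m := by
    rcases (Icc A τ ∩ {t | -κ ≤ H t}).eq_empty_or_nonempty with he | hne
    · exact ⟨1, one_pos, by simp [he]⟩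
    · have hnD (t : ℝ) (ht : t ∈ Icc A τ ∩ {t | -κ ≤ H t}) : t ∉ D := fun hD =>
        absurd ht.2 (not_le.2 (hκD t hD))
      obtain ⟨t₀, ht₀, hmax⟩ := hcomp.exists_isMaxOn hne fun t ht =>
        (hN t ht.1 (hnD t ht)).1.mono inter_subset_left
      exact ⟨-N t₀, by linarith [(hN t₀ ht₀.1 (hnD t₀ ht₀)).2], fun t ht => by
        have : N t ≤ N t₀ := hmax ht
        linarith⟩
  obtain ⟨M, hM⟩ := (isCompact_Icc (a := A) (b := τ)).bddAbove_image hH.continuousOn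
  have hM' (t : ℝ) (ht : t ∈ Icc A τ) : H t ≤ |M| + 1 :=
    (hM ⟨t, ht, rfl⟩).trans ((le_abs_self M).trans (by linarith))
  have hM0 : 0 < |M| + 1 := by positivity
  refine ⟨m / (2 * (|M| + 1)), by positivity, fun ε hε hε' => ⟨min (ε * κ) (m / 2), by positivity,
    fun t ht hD => ?_⟩⟩
  rcases le_or_gt (-κ) (H t) with h | h
  · have h1 := hmN t ⟨ht, h⟩
    have h2 : ε * H t ≤ m / 2 := by
      calc ε * H t ≤ ε * (|M| + 1) := mul_le_mul_of_nonneg_left (hM' t ht) hε.le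
        _ ≤ m / (2 * (|M| + 1)) * (|M| + 1) := mul_le_mul_of_nonneg_right hε' hM0.le
        _ = m / 2 := by field_simp
    linarith [min_le_right (ε * κ) (m / 2)]
  · have h1 := (hN t ht hD).2
    have h2 : ε * H t ≤ ε * -κ := mul_le_mul_of_nonneg_left h.le hε.le
    linarith [min_le_left (ε * κ) (m / 2)]

end Corrector

/-! ### Slow pairs near `-∞` and their truncated sub-solutions. -/

/-- Near `-∞`: an increasing super-solution `(p, q)` of the profile system and, below it, a
sub-solution `(f, g)` which is nonpositive at `-T`. -/
structure IsSlowPair (b c r h T : ℝ) (p q f g : ℝ → ℝ) : Prop where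
  contDiffAt_p : ∀ t ≤ -T, ContDiffAt ℝ 2 p t
  contDiffAt_q : ∀ t ≤ -T, ContDiffAt ℝ 2 q t
  contDiffAt_f : ∀ t ≤ -T, ContDiffAt ℝ 2 f t
  contDiffAt_g : ∀ t ≤ -T, ContDiffAt ℝ 2 g t
  pos_p : ∀ t ≤ -T, 0 < p t
  pos_q : ∀ t ≤ -T, 0 < q t
  le_one_p : ∀ t ≤ -T, p t ≤ 1
  le_one_q : ∀ t ≤ -T, q t ≤ 1
  mono_p : MonotoneOn p (Iic (-T))
  mono_q : MonotoneOn q (Iic (-T))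
  super₁ : ∀ t ≤ -T, bzOp₁ c r p q t ≤ 0
  super₂ : ∀ t ≤ -T, bzOp₂ b c h p q t ≤ 0
  tendsto_p : Tendsto (fun t => t * p t) atBot (𝓝 0)
  tendsto_q : Tendsto q atBot (𝓝 0)
  le_p : ∀ t ≤ -T, f t ≤ p t
  le_q : ∀ t ≤ -T, g t ≤ q t
  end_f : f (-T) ≤ 0
  end_g : g (-T) ≤ 0
  pos_f : ∀ᶠ t in atBot, 0 < f t
  tendsto_f : Tendsto f atBot (𝓝 0)
  tendsto_g : Tendsto g atBot (𝓝 0)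
  sub₁ : ∀ t ≤ -T, 0 < f t → 0 ≤ bzOp₁ c r f (fun s => max 0 (g s)) t
  sub₂ : ∀ t ≤ -T, 0 < g t → 0 ≤ bzOp₂ b c h (fun s => max 0 (f s)) g t

/-- Extension of `f` from `(-∞, τ]` by the constant `a`. -/
def extendConst (τ a : ℝ) (f : ℝ → ℝ) (t : ℝ) : ℝ := if t ≤ τ then f t else a

lemma continuous_extendConst {τ a : ℝ} {f : ℝ → ℝ} (hf : ContinuousOn f (Iic τ)) (h : f τ = a) :
    Continuous (extendConst τ a f) := by
  refine continuous_if_le continuous_id continuous_const hf continuousOn_const ?_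
  rintro t rfl
  exact h

lemma extendConst_of_le {τ a : ℝ} {f : ℝ → ℝ} {t : ℝ} (h : t ≤ τ) :
    extendConst τ a f t = f t := if_pos h

lemma extendConst_of_lt {τ a : ℝ} {f : ℝ → ℝ} {t : ℝ} (h : τ < t) :
    extendConst τ a f t = a := if_neg (not_le.2 h)

lemma tendsto_extendConst {τ a : ℝ} {f : ℝ → ℝ} {l : Filter ℝ} (h : Tendsto f atBot l) :
    Tendsto (extendConst τ a f) atBot l :=
  h.congr' ((eventually_le_atBot τ).mono fun _ ht => (extendConst_of_le ht).symm)

lemma react₁_continuous {r K : ℝ} {φ ψ : ℝ → ℝ} (hφ : Continuous φ) (hψ : Continuous ψ) :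
    Continuous fun s => react₁ r K (φ s) (ψ s) := by unfold react₁; fun_prop

lemma react₂_continuous {b c h K : ℝ} {φ ψ : ℝ → ℝ} (hφ : Continuous φ) (hψ : Continuous ψ) :
    Continuous fun s => react₂ b K (φ (s - c * h)) (ψ s) := by unfold react₂; fun_prop

lemma react₁_tendsto {r K : ℝ} {φ ψ : ℝ → ℝ} (hφ : Tendsto φ atBot (𝓝 0))
    (hψ : Tendsto ψ atBot (𝓝 0)) :
    Tendsto (fun s => react₁ r K (φ s) (ψ s)) atBot (𝓝 0) := by
  have : Tendsto (fun s => react₁ r K (φ s) (ψ s)) atBot (𝓝 (react₁ r K 0 0)) := by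
    unfold react₁
    exact (hφ.const_mul K).add (hφ.mul ((tendsto_const_nhds.sub hφ).add (hψ.const_mul r)))
  simpa [react₁] using this

lemma react₂_tendsto {b c h K : ℝ} {φ ψ : ℝ → ℝ} (hφ : Tendsto φ atBot (𝓝 0))
    (hψ : Tendsto ψ atBot (𝓝 0)) :
    Tendsto (fun s => react₂ b K (φ (s - c * h)) (ψ s)) atBot (𝓝 0) := by
  have hs : Tendsto (fun s : ℝ => s - c * h) atBot atBot :=
    tendsto_atBot_add_const_right _ _ tendsto_id
  have : Tendsto (fun s => react₂ b K (φ (s - c * h)) (ψ s)) atBot (𝓝 (react₂ b K 0 0)) := by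
    unfold react₂
    exact (hψ.const_mul K).add (((hφ.comp hs).const_mul b).mul (tendsto_const_nhds.sub hψ))
  simpa [react₂] using this

section SubSolution

variable {b c r h K T : ℝ} {p q f g : ℝ → ℝ}

/-- The truncation at zero of the sub-solution of a slow pair. -/
lemma IsSlowPair.sub (hp : IsSlowPair b c r h T p q f g) (hb : 0 ≤ b) (hc : 0 ≤ c) (hh : 0 ≤ h)
    (hr₀ : 0 ≤ r) (hr₁ : r ≤ 1) (hK : b + 3 ≤ K) :
    UnitPair (extendConst (-T) 0 fun t => max 0 (f t)) (extendConst (-T) 0 fun t => max 0 (g t)) ∧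
    (extendConst (-T) 0 fun t => max 0 (f t)) ≤ profileMap₁ c r K
      (extendConst (-T) 0 fun t => max 0 (f t)) (extendConst (-T) 0 fun t => max 0 (g t)) ∧
    (extendConst (-T) 0 fun t => max 0 (g t)) ≤ profileMap₂ b c h K
      (extendConst (-T) 0 fun t => max 0 (f t)) (extendConst (-T) 0 fun t => max 0 (g t)) := by
  set a₁ := extendConst (-T) 0 fun t => max 0 (f t) with ha₁
  set a₂ := extendConst (-T) 0 fun t => max 0 (g t) with ha₂
  have hK0 : 0 < K := by linarith
  have hK3 : 3 ≤ K := by linarith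
  have hc₁ : Continuous a₁ := continuous_extendConst
    (fun t ht => (show ContinuousAt (fun t => max 0 (f t)) t from
      continuousAt_const.max (hp.contDiffAt_f t ht).continuousAt).continuousWithinAt)
    (max_eq_left hp.end_f)
  have hc₂ : Continuous a₂ := continuous_extendConst
    (fun t ht => (show ContinuousAt (fun t => max 0 (g t)) t from
      continuousAt_const.max (hp.contDiffAt_g t ht).continuousAt).continuousWithinAt)
    (max_eq_left hp.end_g)
  have mem (u v : ℝ → ℝ) (huv : ∀ t ≤ -T, u t ≤ v t) (hv : ∀ t ≤ -T, v t ≤ 1) (t : ℝ) :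
      extendConst (-T) 0 (fun t => max 0 (u t)) t ∈ Icc (0 : ℝ) 1 := by
    rcases le_or_gt t (-T) with ht | ht
    · rw [extendConst_of_le ht]
      exact ⟨le_max_left _ _, max_le zero_le_one ((huv t ht).trans (hv t ht))⟩
    · rw [extendConst_of_lt ht]; simp
  have hu : UnitPair a₁ a₂ := ⟨hc₁.measurable, hc₂.measurable, mem f p hp.le_p hp.le_one_p,
    mem g q hp.le_q hp.le_one_q⟩
  have lim (u : ℝ → ℝ) (hu : Tendsto u atBot (𝓝 0)) :
      Tendsto (extendConst (-T) 0 fun t => max 0 (u t)) atBot (𝓝 0) := by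
    refine tendsto_extendConst ?_
    simpa using (tendsto_const_nhds (x := (0 : ℝ))).max hu
  have hl₁ : Tendsto a₁ atBot (𝓝 0) := lim f hp.tendsto_f
  have hl₂ : Tendsto a₂ atBot (𝓝 0) := lim g hp.tendsto_g
  refine ⟨hu, fun t => ?_, fun t => ?_⟩
  · have hn := profileMap₁_nonneg (c := c) hr₀ hr₁ hK3 hu t
    rcases le_or_gt t (-T) with ht | ht
    · rw [ha₁, extendConst_of_le ht, ← ha₁]
      refine max_le hn (le_green_of_differential_ineq hK0 (react₁_continuous hc₁ hc₂)
        (hu.abs_react₁_le hr₀ hr₁ hK3) (fun s => (react₁_mem hr₀ hr₁ hK3 (hu.mem₁ s) (hu.mem₂ s)).1)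
        (react₁_tendsto hl₁ hl₂) hp.contDiffAt_f hp.end_f hp.tendsto_f (fun s hs hfs => ?_) t ht)
      have h1 := hp.sub₁ s hs.le hfs
      rw [ha₁, ha₂, extendConst_of_le hs.le, extendConst_of_le hs.le, max_eq_right hfs.le]
      simp only [bzOp₁] at h1
      simp only [react₁]
      linarith
    · rw [ha₁, extendConst_of_lt ht]; exact hn
  · have hn := profileMap₂_nonneg (c := c) (h := h) hb hK hu t
    rcases le_or_gt t (-T) with ht | ht
    · rw [ha₂, extendConst_of_le ht, ← ha₂]
      refine max_le hn (le_green_of_differential_ineq hK0 (react₂_continuous hc₁ hc₂)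
        (hu.abs_react₂_le hb hK)
        (fun s => (react₂_mem hb hK (hu.mem₁ (s - c * h)) (hu.mem₂ s)).1)
        (react₂_tendsto hl₁ hl₂) hp.contDiffAt_g hp.end_g hp.tendsto_g (fun s hs hfs => ?_) t ht)
      have h1 := hp.sub₂ s hs.le hfs
      have hch : 0 ≤ c * h := mul_nonneg hc hh
      rw [ha₁, ha₂, extendConst_of_le (show s - c * h ≤ -T by linarith), extendConst_of_le hs.le,
        max_eq_right hfs.le]
      simp only [bzOp₂] at h1
      simp only [react₂]
      linarith
    · rw [ha₂, extendConst_of_lt ht]; exact hn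

end SubSolution

/-! ### Truncated super-solutions of the integral equations. -/

section SuperSolution

/-- The truncated `min 1 f`, extended by `1` beyond `τ`. -/
def truncOne (τ : ℝ) (f : ℝ → ℝ) : ℝ → ℝ := extendConst τ 1 fun t => min 1 (f t)

variable {b c r h K : ℝ}

/-- Abstract criterion: functions that satisfy the differential inequalities below the level `1`
define, after truncation, a super-solution of the integral equations. -/
lemma profileMap_truncOne_le (hb : 0 ≤ b) (hr₀ : 0 ≤ r) (hr₁ : r ≤ 1) (hK : b + 3 ≤ K)
    {φ ψ : ℝ → ℝ} {t₁ t₂ : ℝ} {D : Finset ℝ} (hφ : ∀ t ≤ t₂, ContinuousAt φ t)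
    (hψ : ∀ t ≤ t₁, ContinuousAt ψ t) (hφpos : ∀ t ≤ t₂, 0 ≤ φ t) (hψpos : ∀ t ≤ t₁, 0 ≤ ψ t)
    (hφ1 : 1 ≤ φ t₂) (hψ1 : 1 ≤ ψ t₁) (hφ0 : Tendsto φ atBot (𝓝 0)) (hψ0 : Tendsto ψ atBot (𝓝 0))
    (hφC : ∀ t < t₂, t ∉ D → ContDiffAt ℝ 2 φ t) (hψC : ∀ t < t₁, t ∉ D → ContDiffAt ℝ 2 ψ t)
    (hφD : ∀ d ∈ D, DerivJumpsDown φ d) (hψD : ∀ d ∈ D, DerivJumpsDown ψ d)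
    (hD : ∀ d ∈ D, d < min t₁ t₂)
    (hφN : ∀ t < t₂, t ∉ D → φ t < 1 → bzOp₁ c r φ (truncOne t₁ ψ) t ≤ 0)
    (hψN : ∀ t < t₁, t ∉ D → ψ t < 1 → bzOp₂ b c h (truncOne t₂ φ) ψ t ≤ 0) :
    UnitPair (truncOne t₂ φ) (truncOne t₁ ψ) ∧ Tendsto (truncOne t₂ φ) atBot (𝓝 0) ∧
    Tendsto (truncOne t₁ ψ) atBot (𝓝 0) ∧
    profileMap₁ c r K (truncOne t₂ φ) (truncOne t₁ ψ) ≤ truncOne t₂ φ ∧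
    profileMap₂ b c h K (truncOne t₂ φ) (truncOne t₁ ψ) ≤ truncOne t₁ ψ := by
  have hK0 : 0 < K := by linarith
  have hK3 : 3 ≤ K := by linarith
  have cont (u : ℝ → ℝ) (τ : ℝ) (hu : ∀ t ≤ τ, ContinuousAt u t) (h1 : 1 ≤ u τ) :
      Continuous (truncOne τ u) := continuous_extendConst
    (fun t ht => (show ContinuousAt (fun t => min 1 (u t)) t from
      continuousAt_const.min (hu t ht)).continuousWithinAt) (min_eq_left h1)
  have mem (u : ℝ → ℝ) (τ : ℝ) (hu : ∀ t ≤ τ, 0 ≤ u t) (t : ℝ) :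
      truncOne τ u t ∈ Icc (0 : ℝ) 1 := by
    rw [truncOne]
    rcases le_or_gt t τ with ht | ht
    · rw [extendConst_of_le ht]; exact ⟨le_min zero_le_one (hu t ht), min_le_left _ _⟩
    · rw [extendConst_of_lt ht]; simp
  have lim (u : ℝ → ℝ) (τ : ℝ) (hu : Tendsto u atBot (𝓝 0)) :
      Tendsto (truncOne τ u) atBot (𝓝 0) := by
    refine tendsto_extendConst ?_
    simpa using (tendsto_const_nhds (x := (1 : ℝ))).min hu
  have hcφ := cont φ t₂ hφ hφ1
  have hcψ := cont ψ t₁ hψ hψ1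
  have hu : UnitPair (truncOne t₂ φ) (truncOne t₁ ψ) :=
    ⟨hcφ.measurable, hcψ.measurable, mem φ t₂ hφpos, mem ψ t₁ hψpos⟩
  have hlφ := lim φ t₂ hφ0
  have hlψ := lim ψ t₁ hψ0
  have hev (d : ℝ) (u : ℝ → ℝ) (τ : ℝ) (hd : d < τ)
      (hu : ∀ t < τ, t ∉ D → ContDiffAt ℝ 2 u t) : ∀ᶠ s in 𝓝[≠] d, DifferentiableAt ℝ u s := by
    have h1 : ∀ᶠ s in 𝓝[≠] d, s < τ := nhdsWithin_le_nhds (Iio_mem_nhds hd)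
    have h3 : ∀ᶠ s in 𝓝[≠] d, s ∉ D := by
      have : ((D : Set ℝ) \ {d})ᶜ ∈ 𝓝 d :=
        (D.finite_toSet.subset sdiff_subset).isClosed.isOpen_compl.mem_nhds (by simp)
      filter_upwards [nhdsWithin_le_nhds this, self_mem_nhdsWithin] with s hs hs'
      simpa [show s ≠ d from hs'] using hs
    filter_upwards [h1, h3] with s a b using (hu s a b).differentiableAt (by simp)
  refine ⟨hu, hlφ, hlψ, fun t => ?_, fun t => ?_⟩
  · have hle := profileMap₁_le_one (c := c) hr₀ hr₁ hK3 hu t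
    rcases le_or_gt t t₂ with ht | ht
    · conv_rhs => rw [truncOne, extendConst_of_le ht]
      refine le_min hle (green_le_of_differential_ineq hK0 (react₁_continuous hcφ hcψ)
        (hu.abs_react₁_le hr₀ hr₁ hK3) (fun s => (react₁_mem hr₀ hr₁ hK3 (hu.mem₁ s) (hu.mem₂ s)).2)
        (react₁_tendsto hlφ hlψ) hφ hφ1 hφ0 (fun s hs hsD hfs => ⟨hφC s hs hsD, ?_⟩) hφD
        (fun d hd => hev d φ t₂ ((hD d hd).trans_le (min_le_right _ _)) hφC) t ht)
      have h1 := hφN s hs hsD hfs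
      have e : truncOne t₂ φ s = φ s := by
        rw [truncOne, extendConst_of_le hs.le, min_eq_right hfs.le]
      rw [e]
      simp only [bzOp₁] at h1
      simp only [react₁]
      linarith
    · conv_rhs => rw [truncOne, extendConst_of_lt ht]
      exact hle
  · have hle := profileMap₂_le_one (c := c) (h := h) hb hK hu t
    rcases le_or_gt t t₁ with ht | ht
    · conv_rhs => rw [truncOne, extendConst_of_le ht]
      refine le_min hle (green_le_of_differential_ineq hK0 (react₂_continuous hcφ hcψ)
        (hu.abs_react₂_le hb hK)
        (fun s => (react₂_mem hb hK (hu.mem₁ (s - c * h)) (hu.mem₂ s)).2)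
        (react₂_tendsto hlφ hlψ) hψ hψ1 hψ0 (fun s hs hsD hfs => ⟨hψC s hs hsD, ?_⟩) hψD
        (fun d hd => hev d ψ t₁ ((hD d hd).trans_le (min_le_left _ _)) hψC) t ht)
      have h1 := hψN s hs hsD hfs
      have e : truncOne t₁ ψ s = ψ s := by
        rw [truncOne, extendConst_of_le hs.le, min_eq_right hfs.le]
      rw [e]
      simp only [bzOp₂] at h1
      simp only [react₂]
      linarith
    · conv_rhs => rw [truncOne, extendConst_of_lt ht]
      exact hle

end SuperSolution

/-! ### Elementary properties of the components of a super-solution. -/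

section Components

variable {f : ℝ → ℝ} {τ : ℝ} {D : Finset ℝ}

lemma IsSuperSolutionComponent.continuousAt (hf : IsSuperSolutionComponent f τ D) {t : ℝ}
    (ht : t ≤ τ) : ContinuousAt f t := by
  obtain ⟨O, hO, hsub, hc, -⟩ := hf.regular
  exact hc.continuousAt (hO.mem_nhds (hsub ht))

lemma IsSuperSolutionComponent.pos (hf : IsSuperSolutionComponent f τ D) {t : ℝ}
    (ht : t ≤ τ) : 0 < f t := by
  obtain ⟨O, hO, hsub, -, hp, -⟩ := hf.regular
  exact hp t (hsub ht)

lemma IsSuperSolutionComponent.contDiffAt (hf : IsSuperSolutionComponent f τ D) {t : ℝ}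
    (ht : t ≤ τ) (htD : t ∉ D) : ContDiffAt ℝ 2 f t := by
  obtain ⟨O, hO, hsub, -, -, hp⟩ := hf.regular
  exact (hp t (hsub ht) htD).1

lemma IsSuperSolutionComponent.eventually_differentiableAt (hf : IsSuperSolutionComponent f τ D)
    {d : ℝ} (hd : d < τ) : ∀ᶠ s in 𝓝[≠] d, DifferentiableAt ℝ f s := by
  have h1 : ∀ᶠ s in 𝓝[≠] d, s < τ := nhdsWithin_le_nhds (Iio_mem_nhds hd)
  have h3 : ∀ᶠ s in 𝓝[≠] d, s ∉ D := by
    have : ((D : Set ℝ) \ {d})ᶜ ∈ 𝓝 d :=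
      (D.finite_toSet.subset sdiff_subset).isClosed.isOpen_compl.mem_nhds (by simp)
    filter_upwards [nhdsWithin_le_nhds this, self_mem_nhdsWithin] with s hs hs'
    simpa [show s ≠ d from hs'] using hs
  filter_upwards [h1, h3] with s a b using (hf.contDiffAt a.le b).differentiableAt (by simp)

lemma IsSuperSolutionComponent.continuous_truncOne (hf : IsSuperSolutionComponent f τ D) :
    Continuous (truncOne τ f) :=
  continuous_extendConst (fun t ht => (show ContinuousAt (fun t => min 1 (f t)) t from
    continuousAt_const.min (hf.continuousAt ht)).continuousWithinAt) (min_eq_left hf.eq_one.ge)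

lemma truncOne_le {t : ℝ} (ht : t ≤ τ) : truncOne τ f t ≤ f t := by
  rw [truncOne, extendConst_of_le ht]; exact min_le_right _ _

lemma truncOne_le_one (t : ℝ) : truncOne τ f t ≤ 1 := by
  rw [truncOne]
  rcases le_or_gt t τ with ht | ht
  · rw [extendConst_of_le ht]; exact min_le_left _ _
  · rw [extendConst_of_lt ht]

lemma truncOne_nonneg (hf : ∀ t ≤ τ, 0 ≤ f t) (t : ℝ) : 0 ≤ truncOne τ f t := by
  rw [truncOne]
  rcases le_or_gt t τ with ht | ht
  · rw [extendConst_of_le ht]; exact le_min zero_le_one (hf t ht)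
  · rw [extendConst_of_lt ht]; exact zero_le_one

lemma truncOne_le_add {f' : ℝ → ℝ} {t e : ℝ} (he : 0 ≤ e) (h : t ≤ τ → f' t ≤ f t + e) :
    truncOne τ f' t ≤ truncOne τ f t + e := by
  rw [truncOne, truncOne]
  rcases le_or_gt t τ with ht | ht
  · rw [extendConst_of_le ht, extendConst_of_le ht, ← min_add_add_right]
    exact min_le_min (by linarith) (h ht)
  · rw [extendConst_of_lt ht, extendConst_of_lt ht]; linarith

end Components

/-! ### Strictness of the first inequality near `-∞`. -/

section RegularSuperSolution

variable {b c r h : ℝ}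

lemma bz_char_neg {ν : ℝ} (hr₁ : r ≤ 1) (hc : 2 * √(1 - r) < c) (h₁ : bzLambda c r < ν)
    (h₂ : ν < bzMu c r) : ν ^ 2 - c * ν + (1 - r) < 0 := by
  have hs := Real.sq_sqrt (show 0 ≤ 1 - r by linarith)
  have hs0 := Real.sqrt_nonneg (1 - r)
  have hd := Real.sq_sqrt (show 0 ≤ c ^ 2 - 4 * (1 - r) by nlinarith)
  unfold bzLambda at h₁
  unfold bzMu at h₂
  nlinarith

lemma bzOp₁_comp_sub (p q : ℝ → ℝ) (S t : ℝ) :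
    bzOp₁ c r (fun s => p (s - S)) (fun s => q (s - S)) t = bzOp₁ c r p q (t - S) := by
  have e (u : ℝ → ℝ) : deriv (fun s => u (s - S)) = fun s => deriv u (s - S) :=
    funext fun s => deriv_comp_sub_const ..
  simp only [bzOp₁, e]

lemma bzOp₂_comp_sub (p q : ℝ → ℝ) (S t : ℝ) :
    bzOp₂ b c h (fun s => p (s - S)) (fun s => q (s - S)) t = bzOp₂ b c h p q (t - S) := by
  have e (u : ℝ → ℝ) : deriv (fun s => u (s - S)) = fun s => deriv u (s - S) :=
    funext fun s => deriv_comp_sub_const ..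
  simp only [bzOp₂, e, show t - c * h - S = t - S - c * h by ring]

/-- The first differential expression is strictly negative, at the rate of `φ`, near `-∞`. -/
lemma eventually_bzOp₁_le {ν C : ℝ} {m : ℕ} {φ ψ ψ' : ℝ → ℝ} (hC : 0 < C)
    (hν : ν ^ 2 - c * ν + (1 - r) < 0) (hφpos : ∀ᶠ t in atBot, 0 < φ t)
    (hψ : ψ =O[atBot] (fun t => t * Real.exp (ν * t)))
    (hφ : Asymptotics.IsEquivalent atBot φ (fun t => C * (-t) ^ m * Real.exp (ν * t)))
    (hφ' : Asymptotics.IsEquivalent atBot (deriv φ) (fun t => C * (-t) ^ m * Real.exp (ν * t) * ν))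
    (hφ'' : Asymptotics.IsEquivalent atBot (deriv (deriv φ))
      (fun t => C * (-t) ^ m * Real.exp (ν * t) * ν ^ 2))
    (hφ0 : Tendsto φ atBot (𝓝 0)) (hψ0 : Tendsto ψ' atBot (𝓝 0)) :
    ∃ k > 0, ∃ M > 0, ∀ᶠ t in atBot, bzOp₁ c r φ ψ' t ≤ -k * φ t ∧ ψ t ≤ M * (-t) * φ t ∧
      Real.exp (ν * t) ≤ M * φ t := by
  have hE : ∀ᶠ t : ℝ in atBot, 0 < C * (-t) ^ m * Real.exp (ν * t) := by
    filter_upwards [eventually_lt_atBot (0 : ℝ)] with t ht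
    have : 0 < -t := by linarith
    positivity
  have hdiv (u : ℝ → ℝ) (a : ℝ)
      (hu : Asymptotics.IsEquivalent atBot u fun t => C * (-t) ^ m * Real.exp (ν * t) * a) :
      Tendsto (fun t => u t / φ t) atBot (𝓝 a) := by
    have h1 := (hu.div hφ)
    have h2 : Asymptotics.IsEquivalent atBot (fun t => u t / φ t) (Function.const ℝ a) := by
      refine h1.congr_right ?_
      filter_upwards [hE] with t ht
      exact mul_div_cancel_left₀ a ht.ne'
    by_cases ha : a = 0
    · subst ha
      have := Asymptotics.isEquivalent_zero_iff_eventually_zero.1 h2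
      exact tendsto_const_nhds.congr' (this.mono fun t ht => by simpa using ht.symm)
    · exact (Asymptotics.isEquivalent_const_iff_tendsto ha).1 h2
  have h1 := hdiv _ _ hφ'
  have h2 := hdiv _ _ hφ''
  -- Divided by `φ`, the operator tends to the characteristic polynomial at `ν`, negative by `hν`;
  -- half of its absolute value serves as the rate `k`.
  have hlim : Tendsto (fun t => deriv (deriv φ) t / φ t - c * (deriv φ t / φ t) +
      (1 - r - φ t + r * ψ' t)) atBot (𝓝 (ν ^ 2 - c * ν + (1 - r - 0 + r * 0))) :=
    (h2.sub (h1.const_mul c)).add ((tendsto_const_nhds.sub hφ0).add (hψ0.const_mul r))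
  obtain ⟨A, hA⟩ := hψ.bound
  set κ := -(ν ^ 2 - c * ν + (1 - r)) with hκ
  have hhalf : ∀ᶠ t in atBot, C * (-t) ^ m * Real.exp (ν * t) ≤ 2 * φ t := by
    have hl := hφ.isLittleO.def (c := 1 / 2) (by norm_num)
    filter_upwards [hl, hE] with t ht hE
    simp only [Pi.sub_apply, Real.norm_eq_abs, abs_of_pos hE] at ht
    linarith [(abs_le.1 ht).1]
  have hexp : ∀ᶠ t in atBot, Real.exp (ν * t) ≤ 2 / C * φ t := by
    filter_upwards [hhalf, eventually_le_atBot (-1 : ℝ)] with t ht ht1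
    have h1 : 1 ≤ (-t) ^ m := one_le_pow₀ (by linarith)
    have h2 : C * Real.exp (ν * t) ≤ C * (-t) ^ m * Real.exp (ν * t) := by
      have : C * 1 ≤ C * (-t) ^ m := mul_le_mul_of_nonneg_left h1 hC.le
      rw [mul_one] at this
      exact mul_le_mul_of_nonneg_right this (Real.exp_pos _).le
    rw [div_mul_eq_mul_div, le_div_iff₀ hC]
    linarith
  refine ⟨κ / 2, by linarith, (|A| + 1) * (2 / C), by positivity, ?_⟩
  filter_upwards [hlim.eventually (gt_mem_nhds (show _ < -(κ / 2) by rw [hκ]; linarith)), hA, hexp,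
    hφpos, eventually_le_atBot (-1 : ℝ)] with t ht hψt hexp hpos ht1
  have hA1 : A ≤ |A| + 1 := (le_abs_self A).trans (by linarith)
  have hA2 : 1 ≤ |A| + 1 := by linarith [abs_nonneg A]
  refine ⟨?_, ?_, ?_⟩
  · have : bzOp₁ c r φ ψ' t = (deriv (deriv φ) t / φ t - c * (deriv φ t / φ t) +
      (1 - r - φ t + r * ψ' t)) * φ t := by
      simp only [bzOp₁]; field_simp
    rw [this, neg_mul, ← neg_mul]
    exact mul_le_mul_of_nonneg_right ht.le hpos.le
  · rw [Real.norm_eq_abs, norm_mul, Real.norm_eq_abs, Real.norm_eq_abs, abs_of_pos (Real.exp_pos _),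
      abs_of_neg (by linarith : t < 0)] at hψt
    have h3 : 0 ≤ -t * Real.exp (ν * t) := mul_nonneg (by linarith) (Real.exp_pos _).le
    calc ψ t ≤ |ψ t| := le_abs_self _
      _ ≤ A * (-t * Real.exp (ν * t)) := hψt
      _ ≤ (|A| + 1) * (-t * Real.exp (ν * t)) := mul_le_mul_of_nonneg_right hA1 h3
      _ ≤ (|A| + 1) * (-t * (2 / C * φ t)) := by gcongr; linarith
      _ = _ := by ring
  · calc Real.exp (ν * t) ≤ 2 / C * φ t := hexp
      _ ≤ (|A| + 1) * (2 / C * φ t) := by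
        have : 0 ≤ 2 / C * φ t := by positivity
        nlinarith
      _ = _ := by ring

end RegularSuperSolution

/-! ### Adding a slow super-solution to the given fast one. -/

section FrontConstruction

variable {b c r h : ℝ}

/-- Perturbing `φ` by a slow super-solution and by a nonpositive corrector. -/
lemma bzOp₁_perturb_le {φ ψ' p q g ψ'' : ℝ → ℝ} {t : ℝ} (hr₀ : 0 ≤ r) (hr₁ : r ≤ 1)
    (hφ : ContDiffAt ℝ 2 φ t) (hp : ContDiffAt ℝ 2 p t) (hg : ContDiffAt ℝ 2 g t)
    (hφ0 : 0 ≤ φ t) (hp0 : 0 ≤ p t) (hq0 : 0 ≤ q t) (hg0 : g t ≤ 0) (hψ0 : 0 ≤ ψ' t)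
    (hgφ : -g t ≤ φ t / 2) (h1 : φ t + p t + g t < 1) (hψ : ψ'' t ≤ ψ' t + q t) :
    bzOp₁ c r (fun s => φ s + p s + g s) ψ'' t ≤ bzOp₁ c r φ ψ' t + bzOp₁ c r p q t +
      (deriv (deriv g) t - c * deriv g t - 4 * g t) + (φ t * q t + ψ' t * p t) := by
  have e1 : deriv (fun s => φ s + p s + g s) t = deriv φ t + deriv p t + deriv g t := by
    rw [((hφ.add hp).deriv_add_eventuallyEq hg).eq_of_nhds]
    have := (hφ.deriv_add_eventuallyEq hp).eq_of_nhds
    rw [← this]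
  have e2 : deriv (deriv fun s => φ s + p s + g s) t =
      deriv (deriv φ) t + deriv (deriv p) t + deriv (deriv g) t := by
    rw [(hφ.add hp).deriv_deriv_add hg, ← hφ.deriv_deriv_add hp]
  simp only [bzOp₁, e1, e2]
  generalize φ t = x at *
  generalize p t = P at *
  generalize q t = Q at *
  generalize g t = G at *
  generalize ψ' t = y at *
  generalize ψ'' t = z at *
  have hs : 0 ≤ x + P + G := by linarith
  have a1 : (x + P + G) * (r * z) ≤ (x + P) * (r * (y + Q)) := by
    calc (x + P + G) * (r * z) ≤ (x + P + G) * (r * (y + Q)) :=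
          mul_le_mul_of_nonneg_left (mul_le_mul_of_nonneg_left hψ hr₀) hs
      _ ≤ _ := mul_le_mul_of_nonneg_right (by linarith) (by positivity)
  have a2 : G * (1 - r) ≤ 0 := mul_nonpos_of_nonpos_of_nonneg hg0 (by linarith)
  -- From `-G ≤ x/2` and `x + P + G < 1` follows `x/2 + P < 1`, hence `x + P < 2`. The term `-2 G (x
  -- + P)` of the square is thus at most `-4 G`, the source of the coefficient `4`.
  have a3 : -(G * (x + P)) ≤ -(G * 2) := by nlinarith
  have a4 : 0 ≤ x * P := mul_nonneg hφ0 hp0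
  have a5 : r * (x * Q + y * P) ≤ x * Q + y * P := by
    have : 0 ≤ x * Q + y * P := by positivity
    nlinarith
  nlinarith [sq_nonneg G]

/-- The cross terms `-b φ q` and `-b p ψ` are nonpositive, so the second inequality is stable under
addition without any strictness and needs no corrector. -/
lemma bzOp₂_perturb_le {φ ψ p q φ' : ℝ → ℝ} {t : ℝ} (hb : 0 ≤ b)
    (hψ : ContDiffAt ℝ 2 ψ t) (hq : ContDiffAt ℝ 2 q t)
    (hφ0 : 0 ≤ φ (t - c * h)) (hp0 : 0 ≤ p (t - c * h)) (hq0 : 0 ≤ q t) (hψ0 : 0 ≤ ψ t)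
    (h1 : ψ t + q t < 1) (hφ : φ' (t - c * h) ≤ φ (t - c * h) + p (t - c * h)) :
    bzOp₂ b c h φ' (fun s => ψ s + q s) t ≤ bzOp₂ b c h φ ψ t + bzOp₂ b c h p q t := by
  rw [bzOp₂, hψ.deriv_deriv_add hq, (hψ.deriv_add_eventuallyEq hq).eq_of_nhds]
  simp only [bzOp₂]
  generalize φ (t - c * h) = x at *
  generalize p (t - c * h) = P at *
  generalize q t = Q at *
  generalize ψ t = y at *
  generalize φ' (t - c * h) = z at *
  have a1 : b * z * (1 - (y + Q)) ≤ b * (x + P) * (1 - (y + Q)) :=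
    mul_le_mul_of_nonneg_right (mul_le_mul_of_nonneg_left hφ hb) (by linarith)
  have a2 : 0 ≤ b * x * Q := by positivity
  have a3 : 0 ≤ b * P * y := by positivity
  nlinarith

/-- A regular super-solution with its corners and its differential inequalities, extended by `1`
to the right. -/
structure IsTruncatedSuper (b c r h t₁ t₂ : ℝ) (D : Finset ℝ) (ψ φ : ℝ → ℝ) : Prop where
  comp₁ : IsSuperSolutionComponent ψ t₁ D
  comp₂ : IsSuperSolutionComponent φ t₂ D
  lt_min : ∀ d ∈ D, d < min t₁ t₂
  neg₁ : ∀ t ≤ t₂, t ∉ D → bzOp₁ c r φ (truncOne t₁ ψ) t < 0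
  nonpos₂ : ∀ t ≤ t₁, t ∉ D → ψ t < 1 → bzOp₂ b c h (truncOne t₂ φ) ψ t ≤ 0

/-- Truncating the coupled function at `1` only lowers the operators (in the second one, where `ψ <
1`), so the inequalities survive up to `min t₁ t₂`. Between `t₁` and `t₂` the truncated function is
`1`, or `min 1 (φ (t - c h))`, which is the form of the hypotheses (D3) and (D4). -/
lemma IsRegularSuperSolution.exists_truncated {ψ φ : ℝ → ℝ} (hb : 0 ≤ b) (hr₀ : 0 ≤ r)
    (hr₁ : r ≤ 1) (hc : 2 * √(1 - r) < c) (hh : 0 ≤ h)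
    (hs : IsRegularSuperSolution b c r h ψ φ) :
    ∃ t₁ t₂ D, IsTruncatedSuper b c r h t₁ t₂ D ψ φ ∧ ∃ ν k M : ℝ, bzLambda c r < ν ∧ 0 < ν ∧
      0 < k ∧ 0 < M ∧ ψ =O[atBot] (fun t => t * Real.exp (ν * t)) ∧
      φ =O[atBot] (fun t => t * Real.exp (ν * t)) ∧
      ∀ᶠ t in atBot, bzOp₁ c r φ (truncOne t₁ ψ) t ≤ -k * φ t ∧ ψ t ≤ M * (-t) * φ t ∧
        Real.exp (ν * t) ≤ M * φ t := by
  obtain ⟨t₁, t₂, D, hD, h₁, h₂, hmono, ⟨ν, C, m, hν, hν₁, hν₂, hm, hC, hψO, hφE, hφE', hφE''⟩,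
    hineq, hineq₁, hineq₂⟩ := hs
  have hc0 : 0 ≤ c := by linarith [Real.sqrt_nonneg (1 - r)]
  have hch : 0 ≤ c * h := mul_nonneg hc0 hh
  have hψ0 : Tendsto (truncOne t₁ ψ) atBot (𝓝 0) := by
    refine tendsto_extendConst ?_
    simpa using (tendsto_const_nhds (x := (1 : ℝ))).min h₁.tendsto_atBot
  obtain ⟨k, hk, M, hM, hkM⟩ := eventually_bzOp₁_le hC (bz_char_neg hr₁ hc hν₁ hν₂)
    ((eventually_le_atBot t₂).mono fun t ht => h₂.pos ht) hψO hφE hφE' hφE'' h₂.tendsto_atBot hψ0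
  refine ⟨t₁, t₂, D, ⟨h₁, h₂, hD, fun t ht htD => ?_, fun t ht htD hψ1 => ?_⟩, ν, k, M, hν₁, hν, hk,
    hM, hψO, ?_, hkM⟩
  · rcases le_or_gt t t₁ with h | h
    · have := (hineq t (le_min h ht) htD).1
      refine lt_of_le_of_lt ?_ this
      simp only [bzOp₁]
      have : φ t * (r * truncOne t₁ ψ t) ≤ φ t * (r * ψ t) :=
        mul_le_mul_of_nonneg_left (mul_le_mul_of_nonneg_left (truncOne_le h) hr₀) (h₂.pos ht).le
      linarith
    · have := hineq₁ (h.trans_le ht) t ⟨h.le, ht⟩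
      rw [bzOp₁, truncOne, extendConst_of_lt h]
      linarith
  · rcases le_or_gt t t₂ with hle | h'
    · have := (hineq t (le_min ht hle) htD).2
      refine le_trans ?_ this.le
      simp only [bzOp₂]
      have : b * truncOne t₂ φ (t - c * h) * (1 - ψ t) ≤ b * φ (t - c * h) * (1 - ψ t) :=
        mul_le_mul_of_nonneg_right
          (mul_le_mul_of_nonneg_left (truncOne_le (show t - c * h ≤ t₂ by linarith)) hb)
          (by linarith)
      linarith
    · have := hineq₂ (h'.trans_le ht) t ⟨h'.le, ht⟩
      have e : truncOne t₂ φ (t - c * h) = min 1 (φ (t - c * h)) := by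
        rcases le_or_gt (t - c * h) t₂ with h3 | h3
        · rw [truncOne, extendConst_of_le h3]
        · rw [truncOne, extendConst_of_lt h3, min_eq_left]
          have := hmono (mem_Ici.2 (le_refl t₂)) h3.le h3
          rw [h₂.eq_one] at this
          exact this.le
      rw [bzOp₂, e]
      linarith
  · refine hφE.isBigO.trans (Asymptotics.IsBigO.of_bound C ?_)
    filter_upwards [eventually_le_atBot (-1 : ℝ)] with t ht
    have h1 : (-t) ^ m ≤ -t := by
      calc (-t) ^ m ≤ (-t) ^ 1 := pow_le_pow_right₀ (by linarith) hm
        _ = -t := pow_one _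
    have h2 : 0 < (-t) ^ m := pow_pos (by linarith) m
    rw [Real.norm_of_nonneg (by positivity), norm_mul, Real.norm_of_nonpos (by linarith),
      Real.norm_of_nonneg (Real.exp_pos _).le, mul_assoc]
    gcongr

/-- The parameters of the perturbed super-solution. -/
lemma IsTruncatedSuper.exists_params {t₁ t₂ : ℝ} {D : Finset ℝ} {ψ φ p q : ℝ → ℝ} {ν k M T : ℝ}
    (hs : IsTruncatedSuper b c r h t₁ t₂ D ψ φ) (hk : 0 < k) (hM : 0 < M)
    (hev : ∀ᶠ t in atBot, bzOp₁ c r φ (truncOne t₁ ψ) t ≤ -k * φ t ∧ ψ t ≤ M * (-t) * φ t ∧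
        Real.exp (ν * t) ≤ M * φ t)
    (hp : Tendsto (fun t => t * p t) atBot (𝓝 0)) (hq : Tendsto q atBot (𝓝 0))
    (hp0 : ∀ t ≤ -T, 0 < p t) (hq0 : ∀ t ≤ -T, 0 < q t) :
    ∃ (S : ℝ) (g : ℝ → ℝ), t₁ - S ≤ -T ∧ t₂ - S ≤ -T ∧ ContDiff ℝ 2 g ∧ (∀ t, g t ≤ 0) ∧
      (∀ t ≤ t₂, -g t ≤ φ t / 2) ∧ g t₂ = 0 ∧ Tendsto g atBot (𝓝 0) ∧
      ∀ t ≤ t₂, t ∉ D → bzOp₁ c r φ (truncOne t₁ ψ) t +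
        (deriv (deriv g) t - c * deriv g t - 4 * g t) +
        (φ t * q (t - S) + truncOne t₁ ψ t * p (t - S)) ≤ 0 := by
  -- The corrector vanishes at `t₂` as well, so that the perturbed first component still reaches the
  -- level `1` there.
  obtain ⟨G, hG2, hG0, hGD, hl₀, hl₁, hl₂⟩ := exists_corrector (insert t₂ D) ν
  set H : ℝ → ℝ := fun t => deriv (deriv G) t - c * deriv G t - 4 * G t with hH
  have hG1 : ContDiff ℝ 1 (deriv G) := contDiff_iff_contDiffAt.2 fun t =>
    hG2.contDiffAt.contDiffAt_deriv
  have hHc : Continuous H := by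
    have := hG1.continuous
    have := hG2.continuous
    have := hG1.continuous_deriv le_rfl
    fun_prop
  have hHD : ∀ d ∈ D, H d < 0 := fun d hd => by
    obtain ⟨e0, e1, e2⟩ := hGD d (Finset.mem_insert_of_mem hd)
    simp only [hH, e0, e1]; linarith
  have hHl : Tendsto (fun t => H t / Real.exp (ν * t)) atBot (𝓝 0) := by
    have := (hl₂.sub (hl₁.const_mul c)).sub (hl₀.const_mul 4)
    simp only [mul_zero, sub_zero] at this
    refine this.congr fun t => ?_
    simp only [hH]; ring
  have hsmall : ∀ᶠ t in atBot, H t ≤ k / 2 * φ t ∧ -G t ≤ φ t / 2 := by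
    filter_upwards [hev, hHl.eventually (gt_mem_nhds (show 0 < k / (2 * M) by positivity)),
      hl₀.eventually (lt_mem_nhds (show -(1 / (2 * M)) < 0 from neg_neg_of_pos (by positivity)))]
      with t ⟨_, _, h1⟩ h2 h3
    rw [div_lt_iff₀ (Real.exp_pos _)] at h2
    rw [lt_div_iff₀ (Real.exp_pos _)] at h3
    constructor
    · calc H t ≤ k / (2 * M) * Real.exp (ν * t) := h2.le
        _ ≤ k / (2 * M) * (M * φ t) := by gcongr
        _ = _ := by field_simp
    · calc -G t ≤ 1 / (2 * M) * Real.exp (ν * t) := by linarith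
        _ ≤ 1 / (2 * M) * (M * φ t) := by gcongr
        _ = _ := by field_simp
  -- Left of `A` the margin `k φ` is available and the corrector consumes at most half of it. On
  -- `[A, t₂]` a uniform margin `δ` comes from `exists_uniform_neg`.
  obtain ⟨A, hA⟩ := eventually_atBot.1 ((hev.and hsmall).and (eventually_le_atBot (min (min t₁ t₂) (-1))))
  have hAt : A ≤ t₂ := (hA A le_rfl).2.trans ((min_le_left _ _).trans (min_le_right _ _))
  have hψ0 : ∀ t, 0 ≤ truncOne t₁ ψ t := truncOne_nonneg fun t ht => (hs.comp₁.pos ht).le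
  -- the compact interval
  have hNc : ∀ t ∈ Icc A t₂, t ∉ D →
      ContinuousWithinAt (bzOp₁ c r φ (truncOne t₁ ψ)) (Icc A t₂) t ∧
        bzOp₁ c r φ (truncOne t₁ ψ) t < 0 := fun t ht htD => by
    refine ⟨ContinuousAt.continuousWithinAt ?_, hs.neg₁ t ht.2 htD⟩
    have h1 := hs.comp₂.contDiffAt ht.2 htD
    have h2 := h1.contDiffAt_deriv
    have h3 : ContinuousAt (deriv (deriv φ)) t :=
      ((h2.fderiv_right (m := 0) (by norm_num)).clm_apply
        (contDiffAt_const (c := (1 : ℝ)))).continuousAt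
    have h4 := h2.continuousAt
    have h5 := h1.continuousAt
    have h6 := hs.comp₁.continuous_truncOne.continuousAt (x := t)
    exact (h3.sub (continuousAt_const.mul h4)).add (h5.mul
      ((continuousAt_const.sub h5).add (continuousAt_const.mul h6)))
  obtain ⟨ε₀, hε₀, hunif⟩ := exists_uniform_neg hNc hHc hHD
  have hφc : ContinuousOn φ (Icc A t₂) := fun t ht => (hs.comp₂.continuousAt ht.2).continuousWithinAt
  obtain ⟨s, hs_mem, hs_min⟩ := isCompact_Icc.exists_isMinOn (nonempty_Icc.2 hAt) hφc
  obtain ⟨B, hB⟩ := (isCompact_Icc (a := A) (b := t₂)).bddAbove_image hφc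
  obtain ⟨B', hB'⟩ := (isCompact_Icc (a := A) (b := t₂)).bddBelow_image hG2.continuous.continuousOn
  have hφs := hs.comp₂.pos hs_mem.2
  set ε := min 1 (min ε₀ (φ s / (2 * (|B'| + 1)))) with hε
  have hB'0 : 0 < |B'| + 1 := by positivity
  have hε0 : 0 < ε := by positivity
  have hε1 : ε ≤ 1 := min_le_left _ _
  have hε2 : ε ≤ ε₀ := (min_le_right _ _).trans (min_le_left _ _)
  have hε3 : ε ≤ φ s / (2 * (|B'| + 1)) := (min_le_right _ _).trans (min_le_right _ _)
  obtain ⟨δ, hδ, hδN⟩ := hunif ε hε0 hε2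
  have hB0 : 0 < B := hφs.trans_le (hB ⟨s, hs_mem, rfl⟩)
  -- The allowed size of the shifted slow terms: the first entry fits the cross terms into the
  -- margin `δ`, where `φ ≤ B`; the second fits them into the remaining `k φ / 2` near `-∞`.
  set η := min (δ / (B + 1)) (k / (2 * (1 + M))) with hη
  have hη0 : 0 < η := by positivity
  have hη1 : (B + 1) * η ≤ δ := by
    have := min_le_left (δ / (B + 1)) (k / (2 * (1 + M)))
    rw [← hη, le_div_iff₀ (by positivity)] at this
    linarith
  have hη2 : (1 + M) * η ≤ k / 2 := by
    have := min_le_right (δ / (B + 1)) (k / (2 * (1 + M)))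
    rw [← hη, le_div_iff₀ (by positivity)] at this
    linarith
  obtain ⟨R, hR⟩ := eventually_atBot.1 (((hq.eventually (gt_mem_nhds hη0)).and
    (hp.eventually (lt_mem_nhds (neg_neg_of_pos hη0)))).and (eventually_le_atBot (min (-T) (-1))))
  set S := max 0 (max t₁ t₂ - R) with hS
  have hS0 : 0 ≤ S := le_max_left _ _
  have hS1 : max t₁ t₂ - R ≤ S := le_max_right _ _
  have hm1 := le_max_left t₁ t₂
  have hm2 := le_max_right t₁ t₂
  have hRT : R ≤ -T := (hR R le_rfl).2.trans (min_le_left _ _)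
  have hε_deriv : deriv (fun t => ε * G t) = fun t => ε * deriv G t :=
    funext fun t => deriv_const_mul_field ε
  have hε_deriv2 : deriv (deriv fun t => ε * G t) = fun t => ε * deriv (deriv G) t := by
    rw [hε_deriv]; exact funext fun t => deriv_const_mul_field ε
  refine ⟨S, fun t => ε * G t, by linarith, by linarith, contDiff_const.mul hG2,
    fun t => mul_nonpos_of_nonneg_of_nonpos hε0.le (hG0 t), fun t ht => ?_, ?_, ?_,
    fun t ht htD => ?_⟩
  · rcases le_or_gt t A with h | h
    · have h1 := (hA t h).1.2.2
      have h2 : ε * (-G t) ≤ 1 * (-G t) :=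
        mul_le_mul_of_nonneg_right hε1 (by linarith [hG0 t])
      linarith
    · have h1 : φ s ≤ φ t := hs_min ⟨h.le, ht⟩
      have h2 : -G t ≤ |B'| + 1 := by
        have : B' ≤ G t := hB' ⟨t, ⟨h.le, ht⟩, rfl⟩
        linarith [neg_abs_le B']
      have h3 : ε * (-G t) ≤ φ s / (2 * (|B'| + 1)) * (|B'| + 1) :=
        mul_le_mul hε3 h2 (by linarith [hG0 t]) (by positivity)
      have h4 : φ s / (2 * (|B'| + 1)) * (|B'| + 1) = φ s / 2 := by field_simp
      linarith
  · simp [(hGD t₂ (Finset.mem_insert_self _ _)).1]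
  · have hGl : Tendsto G atBot (𝓝 0) := by
      have h0 : Tendsto (fun t => -φ t / 2) atBot (𝓝 0) := by
        simpa using hs.comp₂.tendsto_atBot.neg.div_const 2
      refine tendsto_of_tendsto_of_tendsto_of_le_of_le' h0 tendsto_const_nhds ?_
        (Eventually.of_forall hG0)
      filter_upwards [hsmall] with t ht
      linarith [ht.2]
    simpa using hGl.const_mul ε
  · rw [hε_deriv2, hε_deriv]
    have hHt : ε * deriv (deriv G) t - c * (ε * deriv G t) - 4 * (ε * G t) = ε * H t := by
      simp only [hH]; ring
    rw [hHt]
    have htS : t - S ≤ R := by linarith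
    obtain ⟨⟨hq1, hp1⟩, ht1⟩ := hR _ htS
    have ht1' : t - S ≤ -1 := ht1.trans (min_le_right _ _)
    have htT : t - S ≤ -T := ht1.trans (min_le_left _ _)
    have hpp := hp0 _ htT
    have hp1' : p (t - S) ≤ η := by nlinarith
    have hφt := hs.comp₂.pos ht
    rcases le_or_gt t A with h | h
    · obtain ⟨⟨⟨hN, hψM, -⟩, hH', -⟩, htA⟩ := hA t h
      have htneg : t ≤ -1 := htA.trans (min_le_right _ _)
      have b1 : ε * H t ≤ k / 2 * φ t := by
        rcases le_total (H t) 0 with h0 | h0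
        · have : ε * H t ≤ 0 := mul_nonpos_of_nonneg_of_nonpos hε0.le h0
          have : 0 ≤ k / 2 * φ t := by positivity
          linarith
        · have : ε * H t ≤ 1 * H t := mul_le_mul_of_nonneg_right hε1 h0
          linarith
      have b2 : φ t * q (t - S) ≤ φ t * η := mul_le_mul_of_nonneg_left hq1.le hφt.le
      have b3 : truncOne t₁ ψ t ≤ M * (-t) * φ t :=
        (truncOne_le (htA.trans ((min_le_left _ _).trans (min_le_left _ _)))).trans hψM
      -- Here `t p(t) → 0` is used: `ψ` is bounded only by `M (-t) φ`, and `-t ≤ -(t - S)` as `S ≥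
      -- 0`.
      have b4 : -t * p (t - S) ≤ η := by
        have : -t * p (t - S) ≤ -(t - S) * p (t - S) :=
          mul_le_mul_of_nonneg_right (by linarith) hpp.le
        linarith
      have b5 : truncOne t₁ ψ t * p (t - S) ≤ M * φ t * η := by
        calc truncOne t₁ ψ t * p (t - S) ≤ M * (-t) * φ t * p (t - S) :=
              mul_le_mul_of_nonneg_right b3 hpp.le
          _ = M * φ t * (-t * p (t - S)) := by ring
          _ ≤ M * φ t * η := mul_le_mul_of_nonneg_left b4 (by positivity)
      have b6 : φ t * ((1 + M) * η) ≤ φ t * (k / 2) := mul_le_mul_of_nonneg_left hη2 hφt.le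
      nlinarith
    · have b1 := hδN t ⟨h.le, ht⟩ htD
      have b2 : φ t * q (t - S) ≤ B * η :=
        mul_le_mul (hB ⟨t, ⟨h.le, ht⟩, rfl⟩) hq1.le (hq0 _ htT).le hB0.le
      have b3 : truncOne t₁ ψ t * p (t - S) ≤ 1 * η :=
        mul_le_mul (truncOne_le_one t) hp1' hpp.le zero_le_one
      linarith

end FrontConstruction

/-! ### Fronts trapped by a slow pair. -/

section FrontConstruction

variable {b c r h : ℝ}

/-- A regular super-solution and a slow pair near `-∞` give a monotone wavefront, which is trapped,
near `-∞`, between the members of the slow pair. -/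
theorem exists_front_of_slowPair {T : ℝ} {ψ φ p q f g : ℝ → ℝ} (hb : 0 < b) (hr₀ : 0 ≤ r)
    (hr₁ : r ≤ 1) (hc : 2 * √(1 - r) < c) (hh : 0 ≤ h)
    (hs : IsRegularSuperSolution b c r h ψ φ) (hp : IsSlowPair b c r h T p q f g) :
    ∃ (x y : ℝ → ℝ) (S : ℝ), IsMonotoneWavefront b c r h x (fun t => 1 - y (t + c * h)) ∧
      ∀ᶠ t in atBot, (f t ≤ x t ∧ x t ≤ p t + φ (t + S)) ∧ g t ≤ y t ∧ y t ≤ q t + ψ (t + S) := by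
  obtain ⟨t₁, t₂, D, ht, ν, k, M, -, -, hk, hM, -, -, hev⟩ :=
    hs.exists_truncated hb.le hr₀ hr₁ hc hh
  obtain ⟨S, G, hS₁, hS₂, hG2, hG0, hGφ, hGt, hGl, hGN⟩ := ht.exists_params (b := b) (h := h) hk hM
    hev hp.tendsto_p hp.tendsto_q hp.pos_p hp.pos_q
  have hc0 : 0 ≤ c := by linarith [Real.sqrt_nonneg (1 - r)]
  have hch : 0 ≤ c * h := mul_nonneg hc0 hh
  obtain ⟨K, hK⟩ : ∃ K, b + 3 ≤ K := ⟨_, le_rfl⟩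
  have hsh (a : ℝ) : Tendsto (fun t : ℝ => t + a) atBot atBot :=
    tendsto_atBot_add_const_right _ _ tendsto_id
  have hsh' (a : ℝ) : Tendsto (fun t : ℝ => t - a) atBot atBot :=
    tendsto_atBot_add_const_right _ _ tendsto_id
  have hp0 : Tendsto p atBot (𝓝 0) := by
    refine squeeze_zero_norm' ?_ (by simpa using hp.tendsto_p.abs)
    filter_upwards [eventually_le_atBot (-1 : ℝ)] with t ht
    rw [Real.norm_eq_abs]
    have : 1 ≤ |t| := by rw [abs_of_neg (by linarith)]; linarith
    nlinarith [abs_nonneg (p t)]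
  set u : ℝ → ℝ := fun t => φ t + p (t - S) + G t with hu
  set v : ℝ → ℝ := fun t => ψ t + q (t - S) with hv
  have hpC (t : ℝ) (htS : t - S ≤ -T) : ContDiffAt ℝ 2 (fun s => p (s - S)) t :=
    (hp.contDiffAt_p _ htS).comp t (contDiffAt_id.sub contDiffAt_const)
  have hqC (t : ℝ) (htS : t - S ≤ -T) : ContDiffAt ℝ 2 (fun s => q (s - S)) t :=
    (hp.contDiffAt_q _ htS).comp t (contDiffAt_id.sub contDiffAt_const)
  have hu_pos (t : ℝ) (h2 : t ≤ t₂) : p (t - S) ≤ u t := by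
    have := hGφ t h2
    have := ht.comp₂.pos h2
    simp only [hu]; linarith
  have hv_pos (t : ℝ) (h1 : t ≤ t₁) : q (t - S) ≤ v t := by
    have := ht.comp₁.pos h1
    simp only [hv]; linarith
  have hD₁ (d : ℝ) (hd : d ∈ D) : d < t₁ := (ht.lt_min d hd).trans_le (min_le_left _ _)
  have hD₂ (d : ℝ) (hd : d ∈ D) : d < t₂ := (ht.lt_min d hd).trans_le (min_le_right _ _)
  obtain ⟨hsu, hsu0, hsv0, hsup₁, hsup₂⟩ := profileMap_truncOne_le (b := b) (c := c) (h := h)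
    (K := K) (r := r) (φ := u) (ψ := v) (t₁ := t₁) (t₂ := t₂) (D := D) hb.le hr₀ hr₁ hK
    (fun t h2 => ((ht.comp₂.continuousAt h2).add (hpC t (by linarith)).continuousAt).add
      hG2.continuous.continuousAt)
    (fun t h1 => (ht.comp₁.continuousAt h1).add (hqC t (by linarith)).continuousAt)
    (fun t h2 => (hp.pos_p _ (by linarith)).le.trans (hu_pos t h2))
    (fun t h1 => (hp.pos_q _ (by linarith)).le.trans (hv_pos t h1))
    (by simp only [hu, hGt, ht.comp₂.eq_one]; linarith [hp.pos_p _ hS₂])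
    (by simp only [hv, ht.comp₁.eq_one]; linarith [hp.pos_q _ hS₁])
    (by simpa using (ht.comp₂.tendsto_atBot.add (hp0.comp (hsh' S))).add hGl)
    (by simpa using ht.comp₁.tendsto_atBot.add (hp.tendsto_q.comp (hsh' S)))
    (fun t h2 hD => ((ht.comp₂.contDiffAt h2.le hD).add (hpC t (by linarith))).add hG2.contDiffAt)
    (fun t h1 hD => (ht.comp₁.contDiffAt h1.le hD).add (hqC t (by linarith)))
    (fun d hd => by
      have := (ht.comp₂.jump d hd).add (ht.comp₂.eventually_differentiableAt (hD₂ d hd))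
        ((hpC d (by linarith [hD₂ d hd])).add (hG2.contDiffAt (x := d)))
      simpa only [hu, add_assoc] using this)
    (fun d hd => (ht.comp₁.jump d hd).add (ht.comp₁.eventually_differentiableAt (hD₁ d hd))
        (hqC d (by linarith [hD₁ d hd])))
    ht.lt_min
    (fun t h2 hD hlt => by
      have htS : t - S ≤ -T := by linarith
      have h1 := bzOp₁_perturb_le (c := c) (r := r) (φ := φ) (ψ' := truncOne t₁ ψ)
        (p := fun s => p (s - S)) (q := fun s => q (s - S)) (g := G) (ψ'' := truncOne t₁ v) (t := t)
        hr₀ hr₁ (ht.comp₂.contDiffAt h2.le hD) (hpC t htS) hG2.contDiffAt (ht.comp₂.pos h2.le).le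
        (hp.pos_p _ htS).le (hp.pos_q _ htS).le (hG0 t)
        (truncOne_nonneg (fun s hs => (ht.comp₁.pos hs).le) t) (hGφ t h2.le) hlt
        (truncOne_le_add (hp.pos_q _ htS).le fun _ => le_rfl)
      rw [bzOp₁_comp_sub] at h1
      have h3 := hp.super₁ _ htS
      have h4 := hGN t h2.le hD
      linarith)
    (fun t h1 hD hlt => by
      have htS : t - S ≤ -T := by linarith
      have htS' : t - c * h - S ≤ -T := by linarith
      have h2 := bzOp₂_perturb_le (b := b) (c := c) (h := h) (φ := truncOne t₂ φ) (ψ := ψ)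
        (p := fun s => p (s - S)) (q := fun s => q (s - S)) (φ' := truncOne t₂ u) (t := t)
        hb.le (ht.comp₁.contDiffAt h1.le hD) (hqC t htS)
        (truncOne_nonneg (fun s hs => (ht.comp₂.pos hs).le) _)
        (hp.pos_p _ htS').le (hp.pos_q _ htS).le (ht.comp₁.pos h1.le).le hlt
        (truncOne_le_add (hp.pos_p _ htS').le fun _ => by
          simp only [hu]; linarith [hG0 (t - c * h)])
      rw [bzOp₂_comp_sub] at h2
      have h3 := hp.super₂ _ htS
      have h4 := ht.nonpos₂ t h1.le hD (by
        have := hp.pos_q _ htS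
        simp only [hv] at hlt
        linarith)
      linarith)
  -- the sub-solution
  obtain ⟨hau, hsub₁, hsub₂⟩ := hp.sub hb.le hc0 hh hr₀ hr₁ hK
  set a₁ := extendConst (-T) 0 fun t => max 0 (f t) with ha₁
  set a₂ := extendConst (-T) 0 fun t => max 0 (g t) with ha₂
  -- The monotone separators required by `exists_monotone_fixedPoint`: the slow super-solution moved
  -- by `S`, frozen beyond `-T` and cut at `1`. It lies above the truncated sub-solution and below
  -- the perturbed super-solution.
  have mono (w : ℝ → ℝ) (hw : MonotoneOn w (Iic (-T))) :
      Monotone fun t => min 1 (w (min (t - S) (-T))) := fun s t hst => by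
    refine min_le_min_left _ (hw (mem_Iic.2 (min_le_right _ _)) (mem_Iic.2 (min_le_right _ _)) ?_)
    exact min_le_min_right _ (by linarith)
  have below (w z : ℝ → ℝ) (hw0 : ∀ t ≤ -T, 0 < w t) (hw1 : ∀ t ≤ -T, w t ≤ 1)
      (hzw : ∀ t ≤ -T, z t ≤ w t) :
      (fun t => extendConst (-T) 0 (fun s => max 0 (z s)) (t + -S)) ≤
        fun t => min 1 (w (min (t - S) (-T))) := fun t => by
    beta_reduce
    rw [← sub_eq_add_neg]
    rcases le_or_gt (t - S) (-T) with h1 | h1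
    · simp only [extendConst_of_le h1, min_eq_left h1]
      exact max_le (le_min zero_le_one (hw0 _ h1).le)
        (le_min ((hzw _ h1).trans (hw1 _ h1)) (hzw _ h1))
    · simp only [extendConst_of_lt h1, min_eq_right h1.le]
      exact le_min zero_le_one (hw0 _ le_rfl).le
  have above (w z : ℝ → ℝ) (τ : ℝ) (hτ : τ - S ≤ -T) (hwz : ∀ t ≤ τ, w (t - S) ≤ z t) :
      (fun t => min 1 (w (min (t - S) (-T)))) ≤ truncOne τ z := fun t => by
    rw [truncOne]
    rcases le_or_gt t τ with h1 | h1
    · simp only [extendConst_of_le h1, min_eq_left (show t - S ≤ -T by linarith)]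
      exact min_le_min_left _ (hwz t h1)
    · rw [extendConst_of_lt h1]
      exact min_le_left _ _
  obtain ⟨x, y, hxm, hym, hax, hxu, hay, hyv, hx, hy⟩ := exists_monotone_fixedPoint (b := b)
    (c := c) (h := h) (K := K) (r := r) hb.le hr₀ hr₁ hK (hau.shift (-S)) hsu
    (mono p hp.mono_p) (mono q hp.mono_q) (below p f hp.pos_p hp.le_one_p hp.le_p)
    (below q g hp.pos_q hp.le_one_q hp.le_q) (above p u t₂ hS₂ hu_pos) (above q v t₁ hS₁ hv_pos)
    (fun t => by rw [profileMap₁_shift]; exact hsub₁ _)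
    (fun t => by rw [profileMap₂_shift]; exact hsub₂ _) hsup₁ hsup₂
  have hxy : UnitPair x y := ⟨hxm.measurable, hym.measurable,
    fun t => ⟨(hau.mem₁ _).1.trans (hax t), (hxu t).trans (hsu.mem₁ t).2⟩,
    fun t => ⟨(hau.mem₂ _).1.trans (hay t), (hyv t).trans (hsu.mem₂ t).2⟩⟩
  have hx0 : Tendsto x atBot (𝓝 0) := tendsto_of_tendsto_of_tendsto_of_le_of_le
    tendsto_const_nhds hsu0 (fun t => (hxy.mem₁ t).1) hxu
  have hy0 : Tendsto y atBot (𝓝 0) := tendsto_of_tendsto_of_tendsto_of_le_of_le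
    tendsto_const_nhds hsv0 (fun t => (hxy.mem₂ t).1) hyv
  have hfx (t : ℝ) (htT : t ≤ -T) : f t ≤ x (t + S) := by
    have := hax (t + S)
    simp only [add_neg_cancel_right, ha₁, extendConst_of_le htT] at this
    exact (le_max_right _ _).trans this
  have hgy (t : ℝ) (htT : t ≤ -T) : g t ≤ y (t + S) := by
    have := hay (t + S)
    simp only [add_neg_cancel_right, ha₂, extendConst_of_le htT] at this
    exact (le_max_right _ _).trans this
  obtain ⟨τ, hτ⟩ := eventually_atBot.1 (hp.pos_f.and (eventually_le_atBot (-T)))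
  -- Translating back by `S` preserves the normalization of the slow pair; the shift then affects
  -- only the fast terms.
  refine ⟨fun t => x (t + S), fun t => y (t + S), S, ?_, ?_⟩
  · refine isMonotoneWavefront_of_fixedPoint (K := K) (φ := fun t => x (t + S))
      (ψ := fun t => y (t + S)) (τ := τ) hb hr₀ hr₁ hK (hxy.shift S)
      (fun s t hst => hxm (by linarith)) (fun s t hst => hym (by linarith)) ?_ ?_
      (hx0.comp (hsh S)) (hy0.comp (hsh S)) fun t ht => (hτ t ht).1.trans_le (hfx t (hτ t ht).2)
    · exact funext fun t => by rw [profileMap₁_shift, hx]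
    · exact funext fun t => by rw [profileMap₂_shift, hy]
  · filter_upwards [eventually_le_atBot (-T), (hsh S).eventually (eventually_le_atBot t₁),
      (hsh S).eventually (eventually_le_atBot t₂)] with t h0 h1 h2
    refine ⟨⟨hfx t h0, ?_⟩, hgy t h0, ?_⟩
    · have h3 := (hxu (t + S)).trans (truncOne_le h2)
      simp only [hu, add_sub_cancel_right] at h3
      linarith [hG0 (t + S)]
    · have h3 := (hyv (t + S)).trans (truncOne_le h1)
      simp only [hv, add_sub_cancel_right] at h3
      linarith

end FrontConstruction

/-! ### The slow pair for `r < 1`. -/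

section ExponentialPair

/-- The exponential sum `a e^{lt} + d e^{zt}`. -/
def expSum (a l d z t : ℝ) : ℝ := a * Real.exp (l * t) + d * Real.exp (z * t)

lemma deriv_expSum (a l d z : ℝ) : deriv (expSum a l d z) = expSum (a * l) l (d * z) z := by
  have hE (B t : ℝ) : HasDerivAt (fun t => Real.exp (B * t)) (Real.exp (B * t) * B) t := by
    have := ((hasDerivAt_id t).const_mul B).exp
    simpa using this
  ext t
  have := (((hE l t).const_mul a).fun_add ((hE z t).const_mul d)).deriv
  rw [show expSum a l d z = fun t => a * Real.exp (l * t) + d * Real.exp (z * t) from rfl, this,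
    expSum]
  ring

lemma contDiff_expSum (a l d z : ℝ) : ContDiff ℝ 2 (expSum a l d z) := by
  unfold expSum; fun_prop

lemma tendsto_expSum {a l d z : ℝ} (hl : 0 < l) (hz : 0 < z) :
    Tendsto (expSum a l d z) atBot (𝓝 0) := by
  have h (y : ℝ) (hy : 0 < y) : Tendsto (fun t => Real.exp (y * t)) atBot (𝓝 0) :=
    Real.tendsto_exp_atBot.comp (tendsto_id.const_mul_atBot hy)
  have := ((h l hl).const_mul a).add ((h z hz).const_mul d)
  rw [mul_zero, mul_zero, add_zero] at this
  exact this

lemma tendsto_id_mul_exp_atBot {l : ℝ} (hl : 0 < l) :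
    Tendsto (fun t => t * Real.exp (l * t)) atBot (𝓝 0) := by
  have h := (tendsto_polynomial_mul_exp_atBot Polynomial.X).comp (tendsto_id.const_mul_atBot hl)
  have := h.const_mul l⁻¹
  simp only [mul_zero] at this
  refine this.congr fun t => ?_
  simp only [Function.comp, Polynomial.eval_X, id]
  field_simp

lemma bz_roots {c r : ℝ} (hr₁ : r ≤ 1) (hc : 2 * √(1 - r) < c) :
    0 ≤ bzLambda c r ∧ bzLambda c r < bzMu c r ∧ bzMu c r ≤ c ∧
      bzLambda c r * (c - bzLambda c r) = 1 - r := by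
  have hs := Real.sq_sqrt (show 0 ≤ 1 - r by linarith)
  have hs0 := Real.sqrt_nonneg (1 - r)
  have hd0 : 0 < c ^ 2 - 4 * (1 - r) := by nlinarith
  have hd := Real.sq_sqrt hd0.le
  have hd1 := Real.sqrt_pos.2 hd0
  have hle : √(c ^ 2 - 4 * (1 - r)) ≤ c := Real.sqrt_le_iff.2 ⟨by linarith, by linarith⟩
  unfold bzLambda bzMu
  exact ⟨by linarith, by linarith, by linarith, by nlinarith⟩

/-- The slow pair for `r < 1`. -/
theorem exists_slowPair_of_lt_one {b c r h ζ : ℝ} (hb : 0 < b) (hr₀ : 0 < r) (hr₁ : r < 1)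
    (hc : 2 * √(1 - r) < c) (hh : 0 ≤ h) (h₁ : bzLambda c r < ζ) (h₂ : ζ < 2 * bzLambda c r)
    (h₃ : ζ < bzMu c r) :
    ∃ T A₂ k m : ℝ, IsSlowPair b c r h T (expSum 1 (bzLambda c r) 1 ζ)
      (expSum (b * Real.exp (-(bzLambda c r * (c * h))) / (1 - r)) (bzLambda c r) A₂ ζ)
      (expSum 1 (bzLambda c r) (-k) ζ)
      (expSum (b * Real.exp (-(bzLambda c r * (c * h))) / (1 - r)) (bzLambda c r) (-m) ζ) := by
  obtain ⟨-, -, hμc, hll⟩ := bz_roots hr₁.le hc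
  have hχ := bz_char_neg hr₁.le hc h₁ h₃
  set l := bzLambda c r with hl
  have hl0 : 0 < l := by linarith
  have hζ0 : 0 < ζ := by linarith
  have hc0 : 0 < c := by linarith
  have hch : 0 ≤ c * h := mul_nonneg hc0.le hh
  have h1r : 0 < 1 - r := by linarith
  -- `A₁` and, below, `A₂` solve the linearized second equation for the forcings `e^{lt}` and
  -- `e^{ζt}`, since `l (c - l) = 1 - r` and `ζ (c - ζ) = ρ`.
  set A₁ := b * Real.exp (-(l * (c * h))) / (1 - r) with hA₁
  have hA₁0 : 0 < A₁ := by positivity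
  set κ := -(ζ ^ 2 - c * ζ + (1 - r)) with hκ
  have hκ0 : 0 < κ := by linarith
  set ρ := ζ * (c - ζ) with hρ
  have hρ0 : 0 < ρ := mul_pos hζ0 (by linarith)
  set A₂ := b * Real.exp (-(ζ * (c * h))) / ρ with hA₂
  have hA₂0 : 0 < A₂ := by positivity
  have hexp (y : ℝ) (hy : 0 < y) : Tendsto (fun t => Real.exp (y * t)) atBot (𝓝 0) :=
    Real.tendsto_exp_atBot.comp (tendsto_id.const_mul_atBot hy)
  have sm (y C e : ℝ) (hy : 0 < y) (he : 0 < e) :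
      ∀ᶠ t in atBot, C * Real.exp (y * t) < e := by
    have := (hexp y hy).const_mul C
    rw [mul_zero] at this
    exact this.eventually (gt_mem_nhds he)
  -- Quadratic terms are of order `e^{2lt} = e^{(2l-ζ)t} e^{ζt}`. Since `ζ < 2l`, left of `R` they
  -- are dominated by the gain `κ e^{ζt}` from the negative characteristic polynomial at `ζ`.
  obtain ⟨R, hR⟩ := eventually_atBot.1 (((sm (2 * l - ζ) (2 * (A₁ + A₂)) κ (by linarith) hκ0).and
    (sm l 2 1 hl0 one_pos)).and ((sm l (A₁ + A₂) 1 hl0 one_pos).and (eventually_le_atBot (0 : ℝ))))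
  have hneg (t : ℝ) (ht : t ≤ -(-R)) : t ≤ 0 := by
    rw [neg_neg] at ht; exact (hR t ht).2.2
  have hζl (t : ℝ) (ht : t ≤ -(-R)) : Real.exp (ζ * t) ≤ Real.exp (l * t) :=
    Real.exp_le_exp.2 (mul_le_mul_of_nonpos_right h₁.le (hneg t ht))
  have hlζ (t : ℝ) (ht : t ≤ -(-R)) : Real.exp (l * t) ^ 2 ≤ Real.exp (ζ * t) := by
    rw [sq, ← Real.exp_add]
    exact Real.exp_le_exp.2 (by linarith [mul_le_mul_of_nonpos_right h₂.le (hneg t ht)])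
  have hsplit (t : ℝ) : Real.exp (l * t) ^ 2 = Real.exp ((2 * l - ζ) * t) * Real.exp (ζ * t) := by
    rw [sq, ← Real.exp_add, ← Real.exp_add]; ring_nf
  have hdel (y t : ℝ) : Real.exp (y * (t - c * h)) = Real.exp (-(y * (c * h))) * Real.exp (y * t) := by
    rw [← Real.exp_add]; ring_nf
  have e₁ : (1 - r) * A₁ = b * Real.exp (-(l * (c * h))) := by rw [hA₁]; field_simp
  have e₂ : ρ * A₂ = b * Real.exp (-(ζ * (c * h))) := by rw [hA₂]; field_simp
  have hell : l * l - c * l = -(1 - r) := by linarith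
  have hζζ : ζ * ζ - c * ζ = -ρ := by rw [hρ]; ring
  -- The first entry pays for the term `-f²` of the sub-solution; the second makes `f` nonpositive
  -- at the endpoint `R = -T`. The two entries of `m` do the same in the second equation.
  set k := max (1 / κ) (Real.exp (-(ζ - l) * R)) with hk
  have hk1 : 1 ≤ k * κ := by
    have : 1 / κ ≤ k := le_max_left _ _
    rwa [div_le_iff₀ hκ0] at this
  have hk0 : 0 < k := lt_max_of_lt_right (Real.exp_pos _)
  set m := max ((b * k + b * A₁) / ρ) (A₁ * Real.exp (-(ζ - l) * R)) with hm
  have hm1 : b * k + b * A₁ ≤ m * ρ := by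
    have : (b * k + b * A₁) / ρ ≤ m := le_max_left _ _
    rwa [div_le_iff₀ hρ0] at this
  have hm0 : 0 < m := lt_max_of_lt_left (by positivity)
  have hend : Real.exp (-(ζ - l) * R) * Real.exp (ζ * R) = Real.exp (l * R) := by
    rw [← Real.exp_add]; ring_nf
  have mono (a d : ℝ) (ha : 0 < a) (hd : 0 < d) (S : Set ℝ) : MonotoneOn (expSum a l d ζ) S :=
    fun s _ t _ hst => by
      unfold expSum
      gcongr
  have posE (a d t : ℝ) (ha : 0 < a) (hd : 0 < d) : 0 < expSum a l d ζ t := by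
    unfold expSum; positivity
  refine ⟨-R, A₂, k, m, ?_⟩
  constructor
  · exact fun t _ => (contDiff_expSum ..).contDiffAt
  · exact fun t _ => (contDiff_expSum ..).contDiffAt
  · exact fun t _ => (contDiff_expSum ..).contDiffAt
  · exact fun t _ => (contDiff_expSum ..).contDiffAt
  · exact fun t _ => posE _ _ _ one_pos one_pos
  · exact fun t _ => posE _ _ _ hA₁0 hA₂0
  · intro t ht
    have h1 := (hR t (by linarith)).1.2
    have h2 := hζl t ht
    unfold expSum; linarith
  · intro t ht
    have h1 := (hR t (by linarith)).2.1
    have h2 := hζl t ht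
    unfold expSum; linarith [mul_le_mul_of_nonneg_left h2 hA₂0.le]
  · exact mono _ _ one_pos one_pos _
  · exact mono _ _ hA₁0 hA₂0 _
  · intro t ht
    have h1 := (hR t (by linarith)).1.1
    have h2 := hζl t ht
    have h3 := hsplit t
    have hE := Real.exp_pos (l * t)
    have hZ := Real.exp_pos (ζ * t)
    simp only [bzOp₁, deriv_expSum, expSum]
    set E := Real.exp (l * t)
    set Z := Real.exp (ζ * t)
    set W := Real.exp ((2 * l - ζ) * t)
    have b1 : (E + Z) * (r * (A₁ * E + A₂ * Z)) ≤ (2 * E) * (1 * ((A₁ + A₂) * E)) := by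
      gcongr
      · linarith
      · linarith [mul_le_mul_of_nonneg_left h2 hA₂0.le]
    have b2 : 2 * (A₁ + A₂) * W * Z ≤ κ * Z := by gcongr
    have b3 : 1 * l * l * E + 1 * ζ * ζ * Z - c * (1 * l * E + 1 * ζ * Z) + (1 - r) * (E + Z) =
        -κ * Z := by
      rw [hκ]
      linear_combination E * hell
    have b4 : 2 * (A₁ + A₂) * E ^ 2 = 2 * (A₁ + A₂) * W * Z := by rw [h3]; ring
    linarith [sq_nonneg (E + Z)]
  · intro t ht
    have hE := Real.exp_pos (l * t)
    have hZ := Real.exp_pos (ζ * t)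
    have hX := Real.exp_pos (-(l * (c * h)))
    have hY := Real.exp_pos (-(ζ * (c * h)))
    simp only [bzOp₂, deriv_expSum, expSum, hdel]
    set E := Real.exp (l * t)
    set Z := Real.exp (ζ * t)
    set X := Real.exp (-(l * (c * h)))
    set Y := Real.exp (-(ζ * (c * h)))
    have b1 : A₁ * l * l * E + A₂ * ζ * ζ * Z - c * (A₁ * l * E + A₂ * ζ * Z) =
        -(b * (1 * (X * E) + 1 * (Y * Z))) := by
      linear_combination A₁ * E * hell + A₂ * Z * hζζ - E * e₁ - Z * e₂
    have b2 : 0 ≤ b * (1 * (X * E) + 1 * (Y * Z)) * (A₁ * E + A₂ * Z) := by positivity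
    linarith
  · have := (tendsto_id_mul_exp_atBot hl0).add (tendsto_id_mul_exp_atBot hζ0)
    rw [add_zero] at this
    refine this.congr fun t => ?_
    simp only [expSum]; ring
  · exact tendsto_expSum hl0 hζ0
  · intro t _
    have := Real.exp_pos (ζ * t)
    simp only [expSum]; linarith [mul_pos hk0 this]
  · intro t _
    have := Real.exp_pos (ζ * t)
    simp only [expSum]; linarith [mul_pos hm0 this, mul_pos hA₂0 this]
  · simp only [expSum, neg_neg]
    have : Real.exp (-(ζ - l) * R) * Real.exp (ζ * R) ≤ k * Real.exp (ζ * R) :=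
      mul_le_mul_of_nonneg_right (le_max_right _ _) (Real.exp_pos _).le
    linarith
  · simp only [expSum, neg_neg]
    have : A₁ * Real.exp (-(ζ - l) * R) * Real.exp (ζ * R) ≤ m * Real.exp (ζ * R) :=
      mul_le_mul_of_nonneg_right (le_max_right _ _) (Real.exp_pos _).le
    rw [mul_assoc, hend] at this
    linarith
  · filter_upwards [sm (ζ - l) k 1 (by linarith) one_pos] with t ht
    have : Real.exp (ζ * t) = Real.exp ((ζ - l) * t) * Real.exp (l * t) := by
      rw [← Real.exp_add]; ring_nf
    simp only [expSum, this]
    linarith [mul_lt_mul_of_pos_right ht (Real.exp_pos (l * t))]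
  · exact tendsto_expSum hl0 hζ0
  · exact tendsto_expSum hl0 hζ0
  · intro t ht hf
    have h2 := hlζ t ht
    have hE := Real.exp_pos (l * t)
    have hZ := Real.exp_pos (ζ * t)
    simp only [bzOp₁, deriv_expSum]
    have hgm : 0 ≤ r * max 0 (expSum A₁ l (-m) ζ t) := mul_nonneg hr₀.le (le_max_left _ _)
    generalize r * max 0 (expSum A₁ l (-m) ζ t) = y at *
    simp only [expSum] at *
    set E := Real.exp (l * t)
    set Z := Real.exp (ζ * t)
    have b1 : 0 ≤ (1 * E + -k * Z) * y := mul_nonneg hf.le hgm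
    have b2 : (1 * E + -k * Z) ^ 2 ≤ E ^ 2 := by
      refine pow_le_pow_left₀ hf.le ?_ 2
      linarith [mul_pos hk0 hZ]
    have b3 : 1 * l * l * E + -k * ζ * ζ * Z - c * (1 * l * E + -k * ζ * Z) +
        (1 - r) * (1 * E + -k * Z) = k * κ * Z := by
      rw [hκ]
      linear_combination E * hell
    have b4 : 1 * Z ≤ k * κ * Z := mul_le_mul_of_nonneg_right hk1 hZ.le
    linarith
  · intro t ht hg
    have h2 := hlζ t ht
    have hE := Real.exp_pos (l * t)
    have hZ := Real.exp_pos (ζ * t)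
    have hX := Real.exp_pos (-(l * (c * h)))
    have hX1 : Real.exp (-(l * (c * h))) ≤ 1 := Real.exp_le_one_iff.2 (neg_nonpos.2 (mul_nonneg hl0.le hch))
    have hY := Real.exp_pos (-(ζ * (c * h)))
    have hY1 : Real.exp (-(ζ * (c * h))) ≤ 1 := Real.exp_le_one_iff.2 (neg_nonpos.2 (mul_nonneg hζ0.le hch))
    simp only [bzOp₂, deriv_expSum]
    simp only [expSum, hdel] at *
    set E := Real.exp (l * t)
    set Z := Real.exp (ζ * t)
    set X := Real.exp (-(l * (c * h)))
    set Y := Real.exp (-(ζ * (c * h)))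
    set y := max 0 (1 * (X * E) + -k * (Y * Z)) with hy
    have y1 : 1 * (X * E) + -k * (Y * Z) ≤ y := le_max_right _ _
    have y0 : 0 ≤ y := le_max_left _ _
    have y2 : y ≤ E := max_le hE.le (by
      have : X * E ≤ 1 * E := mul_le_mul_of_nonneg_right hX1 hE.le
      have : 0 ≤ k * (Y * Z) := by positivity
      linarith)
    have b1 : A₁ * l * l * E + -m * ζ * ζ * Z - c * (A₁ * l * E + -m * ζ * Z) =
        m * ρ * Z - b * (X * E) := by
      linear_combination A₁ * E * hell - m * Z * hζζ - E * e₁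
    have b2 : y * (A₁ * E + -m * Z) ≤ E * (A₁ * E) := by
      refine mul_le_mul y2 ?_ hg.le hE.le
      linarith [mul_pos hm0 hZ]
    have b3 : b * (y * (A₁ * E + -m * Z)) ≤ b * (A₁ * Z) := by
      refine mul_le_mul_of_nonneg_left (b2.trans ?_) hb.le
      linarith [mul_le_mul_of_nonneg_left h2 hA₁0.le]
    have b4 : k * (Y * Z) ≤ k * (1 * Z) := by gcongr
    have b5 : (b * k + b * A₁) * Z ≤ m * ρ * Z := mul_le_mul_of_nonneg_right hm1 hZ.le
    have b6 : b * (X * E - k * (1 * Z)) ≤ b * y := mul_le_mul_of_nonneg_left (by linarith) hb.le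
    linarith

end ExponentialPair

/-! ### Expansions in `1/s` up to order `s^{-3/2}`. -/

section Jets

/-- `f = A + B / s + C / s^{3/2} + o(s^{-3/2})` as `s → +∞`. -/
def HasJet (f : ℝ → ℝ) (A B C : ℝ) : Prop :=
  ∃ e : ℝ → ℝ, Tendsto e atTop (𝓝 0) ∧
    ∀ᶠ s in atTop, f s = A + B * (√s)⁻¹ ^ 2 + (C + e s) * (√s)⁻¹ ^ 3

lemma tendsto_inv_sqrt : Tendsto (fun s : ℝ => (√s)⁻¹) atTop (𝓝 0) :=
  tendsto_inv_atTop_zero.comp Real.tendsto_sqrt_atTop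

variable {f g : ℝ → ℝ} {A B C A' B' C' : ℝ}

lemma hasJet_const (A : ℝ) : HasJet (fun _ => A) A 0 0 :=
  ⟨fun _ => 0, tendsto_const_nhds, Eventually.of_forall fun s => by ring⟩

lemma HasJet.add (hf : HasJet f A B C) (hg : HasJet g A' B' C') :
    HasJet (fun s => f s + g s) (A + A') (B + B') (C + C') := by
  obtain ⟨e, he, h⟩ := hf
  obtain ⟨e', he', h'⟩ := hg
  refine ⟨fun s => e s + e' s, by simpa using he.add he', ?_⟩
  filter_upwards [h, h'] with s h h'
  rw [h, h']; ring

lemma HasJet.mul (hf : HasJet f A B C) (hg : HasJet g A' B' C') :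
    HasJet (fun s => f s * g s) (A * A') (A * B' + B * A') (A * C' + C * A') := by
  obtain ⟨e, he, h⟩ := hf
  obtain ⟨e', he', h'⟩ := hg
  refine ⟨fun s => A * e' s + A' * e s + (√s)⁻¹ * (B * B') +
    (√s)⁻¹ ^ 2 * (B * (C' + e' s) + B' * (C + e s)) + (√s)⁻¹ ^ 3 * ((C + e s) * (C' + e' s)), ?_, ?_⟩
  · have hx := tendsto_inv_sqrt
    have h1 : Tendsto (fun s => C + e s) atTop (𝓝 (C + 0)) := he.const_add C
    have h2 : Tendsto (fun s => C' + e' s) atTop (𝓝 (C' + 0)) := he'.const_add C'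
    have := ((((he'.const_mul A).add (he.const_mul A')).add (hx.mul_const (B * B'))).add
      ((hx.pow 2).mul ((h2.const_mul B).add (h1.const_mul B')))).add ((hx.pow 3).mul (h1.mul h2))
    simpa using this
  · filter_upwards [h, h'] with s h h'
    rw [h, h']; ring

lemma HasJet.congr (hf : HasJet f A B C) (h : ∀ᶠ s in atTop, g s = f s) (hA : A = A') (hB : B = B')
    (hC : C = C') : HasJet g A' B' C' := by
  subst hA hB hC
  obtain ⟨e, he, h'⟩ := hf
  refine ⟨e, he, ?_⟩
  filter_upwards [h, h'] with s h h'
  rw [h, h']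

lemma HasJet.const_mul (hf : HasJet f A B C) (k : ℝ) :
    HasJet (fun s => k * f s) (k * A) (k * B) (k * C) :=
  ((hasJet_const k).mul hf).congr (Eventually.of_forall fun _ => rfl) rfl (by ring) (by ring)

lemma HasJet.sub (hf : HasJet f A B C) (hg : HasJet g A' B' C') :
    HasJet (fun s => f s - g s) (A - A') (B - B') (C - C') :=
  (hf.add (hg.const_mul (-1))).congr (Eventually.of_forall fun s => by ring) (by ring) (by ring)
    (by ring)

lemma hasJet_sq : HasJet (fun s => (√s)⁻¹ ^ 2) 0 1 0 :=
  ⟨fun _ => 0, tendsto_const_nhds, Eventually.of_forall fun s => by ring⟩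

lemma hasJet_cube : HasJet (fun s => (√s)⁻¹ ^ 3) 0 0 1 :=
  ⟨fun _ => 0, tendsto_const_nhds, Eventually.of_forall fun s => by ring⟩

lemma HasJet.eventually_pos (hf : HasJet f 0 0 C) (hC : 0 < C) : ∀ᶠ s in atTop, 0 < f s := by
  obtain ⟨e, he, h⟩ := hf
  filter_upwards [h, he.eventually (lt_mem_nhds (neg_neg_of_pos hC)), eventually_gt_atTop 0] with
    s h h' hs
  have : 0 < C + e s := by linarith
  have : 0 < √s := Real.sqrt_pos.2 hs
  rw [h]
  simp only [zero_mul, add_zero, zero_add]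
  positivity

lemma HasJet.tendsto (hf : HasJet f A B C) : Tendsto f atTop (𝓝 A) := by
  obtain ⟨e, he, h⟩ := hf
  have hx := tendsto_inv_sqrt
  have := (((hx.pow 2).const_mul B).const_add A).add ((he.const_add C).mul (hx.pow 3))
  simp only [ne_eq, OfNat.ofNat_ne_zero, not_false_eq_true, zero_pow, mul_zero, add_zero] at this
  exact this.congr' (h.mono fun s hs => hs.symm)

/-- A function that vanishes faster than `1/√s` times one that is `O(1/s)`. -/
lemma HasJet.small_mul (hf : HasJet f 0 B C) {d : ℝ → ℝ}
    (hd : Tendsto (fun s => d s * √s) atTop (𝓝 0)) : HasJet (fun s => d s * f s) 0 0 0 := by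
  obtain ⟨e, he, h⟩ := hf
  refine ⟨fun s => d s * √s * (B + (C + e s) * (√s)⁻¹), ?_, ?_⟩
  · have := hd.mul (((he.const_add C).mul tendsto_inv_sqrt).const_add B)
    simpa using this
  · filter_upwards [h, eventually_gt_atTop 0] with s h hs
    have : √s ≠ 0 := (Real.sqrt_pos.2 hs).ne'
    rw [h]
    field_simp
    ring

lemma inv_sqrt_sq {s : ℝ} (hs : 0 < s) : (√s)⁻¹ ^ 2 = 1 / s := by
  rw [inv_pow, Real.sq_sqrt hs.le, one_div]

/-- Reciprocals of functions asymptotic to `s / (2 c)`. -/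
lemma hasJet_inv {c : ℝ} (hc : 0 < c) {ρ : ℝ → ℝ}
    (hρ : Tendsto (fun s => ρ s * (√s)⁻¹) atTop (𝓝 0)) :
    HasJet (fun s => (s / (2 * c) + ρ s)⁻¹) 0 (2 * c) 0 := by
  have h1 : Tendsto (fun s => 1 / (2 * c) + ρ s * (√s)⁻¹ * (√s)⁻¹) atTop (𝓝 (1 / (2 * c))) := by
    simpa using (hρ.mul tendsto_inv_sqrt).const_add (1 / (2 * c))
  have hc' : (1 / (2 * c)) ≠ 0 := by positivity
  refine ⟨fun s => -(2 * c) * (1 / (2 * c) + ρ s * (√s)⁻¹ * (√s)⁻¹)⁻¹ * (ρ s * (√s)⁻¹), ?_, ?_⟩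
  · simpa using ((h1.inv₀ hc').const_mul (-(2 * c))).mul hρ
  · filter_upwards [eventually_gt_atTop 0, h1.eventually_ne hc'] with s hs hne
    have hs' : √s ≠ 0 := (Real.sqrt_pos.2 hs).ne'
    have e1 : s = √s ^ 2 := (Real.sq_sqrt hs.le).symm
    set x := √s with hx
    have e2 : s / (2 * c) + ρ s = x ^ 2 * (1 / (2 * c) + ρ s * x⁻¹ * x⁻¹) := by
      have : x ^ 2 * (ρ s * x⁻¹ * x⁻¹) = ρ s := by field_simp
      rw [mul_add, this, ← e1]; ring
    rw [e2]
    set D := 1 / (2 * c) + ρ s * x⁻¹ * x⁻¹ with hD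
    have e3 : ρ s * x⁻¹ = (D - 1 / (2 * c)) * x := by rw [hD]; field_simp; ring
    rw [e3]
    field_simp
    ring

end Jets

/-! ### The approximate slow manifold for `r = 1`. -/

section SlowManifold

/-- The reciprocal of the slow variable, as a function of `s = -t`. -/
def slowU (c a σ s : ℝ) : ℝ := s / (2 * c) + (a * Real.log s + σ * (√s)⁻¹)

/-- The derivative of `slowU`. -/
def slowW (c a σ s : ℝ) : ℝ := 1 / (2 * c) + a / s - σ / 2 * (√s)⁻¹ ^ 3

/-- Minus the derivative of `slowW`. -/
def slowW' (a σ s : ℝ) : ℝ := a / s ^ 2 - 3 * σ / 4 * (√s)⁻¹ ^ 5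

variable {c a σ k : ℝ}

lemma hasDerivAt_inv_sqrt {s : ℝ} (hs : 0 < s) :
    HasDerivAt (fun s => (√s)⁻¹) (-(1 / 2) * (√s)⁻¹ ^ 3) s := by
  have hs' : √s ≠ 0 := (Real.sqrt_pos.2 hs).ne'
  refine ((Real.hasDerivAt_sqrt hs.ne').inv hs').congr_deriv ?_
  field_simp

lemma hasDerivAt_slowU {s : ℝ} (hs : 0 < s) :
    HasDerivAt (slowU c a σ) (slowW c a σ s) s := by
  refine (((hasDerivAt_id s).div_const (2 * c)).add
    (((Real.hasDerivAt_log hs.ne').const_mul a).add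
      ((hasDerivAt_inv_sqrt hs).const_mul σ))).congr_deriv ?_
  unfold slowW; ring

lemma hasDerivAt_slowW {s : ℝ} (hs : 0 < s) :
    HasDerivAt (slowW c a σ) (-slowW' a σ s) s := by
  have h1 : HasDerivAt (fun s : ℝ => a / s) (-a / s ^ 2) s := by
    refine ((hasDerivAt_const s a).div (hasDerivAt_id s) hs.ne').congr_deriv ?_
    simp
  refine ((h1.const_add (1 / (2 * c))).sub
    (((hasDerivAt_inv_sqrt hs).pow 3).const_mul (σ / 2))).congr_deriv ?_
  unfold slowW'
  push_cast
  ring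

lemma tendsto_log_mul_inv_sqrt : Tendsto (fun s => Real.log s * (√s)⁻¹) atTop (𝓝 0) := by
  have h := (Real.isLittleO_log_id_atTop.tendsto_div_nhds_zero).comp Real.tendsto_sqrt_atTop
  have h2 := h.const_mul 2
  rw [mul_zero] at h2
  refine h2.congr' ?_
  filter_upwards [eventually_gt_atTop 0] with s hs
  simp only [Function.comp, id, Real.log_sqrt hs.le]
  ring

/-- The logarithm enters the reciprocal only at order `log s / s²`, which is `o(s^{-3/2})`. This is
what lets a correction `σ/√s` outweigh it. -/
lemma hasJet_slowU_inv (hc : 0 < c) : HasJet (fun s => (slowU c a σ s)⁻¹) 0 (2 * c) 0 := by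
  refine hasJet_inv hc ?_
  have := (tendsto_log_mul_inv_sqrt.const_mul a).add
    ((tendsto_inv_sqrt.mul tendsto_inv_sqrt).const_mul σ)
  simp only [mul_zero, add_zero] at this
  exact this.congr fun s => by ring

lemma tendsto_log_add_sub_log (hk : 0 ≤ k) :
    Tendsto (fun s => (Real.log (s + k) - Real.log s) * √s) atTop (𝓝 0) := by
  have h0 : Tendsto (fun s : ℝ => k * (√s)⁻¹) atTop (𝓝 0) := by
    simpa using tendsto_inv_sqrt.const_mul k
  refine tendsto_of_tendsto_of_tendsto_of_le_of_le' tendsto_const_nhds h0 ?_ ?_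
  · filter_upwards [eventually_gt_atTop 0] with s hs
    have : Real.log s ≤ Real.log (s + k) := Real.log_le_log hs (by linarith)
    have := Real.sqrt_nonneg s
    exact mul_nonneg (by linarith) this
  · filter_upwards [eventually_gt_atTop 0] with s hs
    have hs' : 0 < √s := Real.sqrt_pos.2 hs
    have h1 : Real.log (s + k) - Real.log s ≤ k / s := by
      rw [← Real.log_div (by linarith) hs.ne']
      have := Real.log_le_sub_one_of_pos (show 0 < (s + k) / s by positivity)
      have e : (s + k) / s - 1 = k / s := by field_simp; ring
      linarith
    calc (Real.log (s + k) - Real.log s) * √s ≤ k / s * √s := by gcongr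
      _ = k * (√s)⁻¹ := by
        nth_rewrite 1 [← Real.sq_sqrt hs.le]
        field_simp

lemma tendsto_inv_sqrt_add_sub (hk : 0 ≤ k) :
    Tendsto (fun s => ((√(s + k))⁻¹ - (√s)⁻¹) * √s) atTop (𝓝 0) := by
  have h1 : Tendsto (fun s : ℝ => s / (s + k)) atTop (𝓝 1) := by
    have h2 : Tendsto (fun s : ℝ => 1 - k * (s + k)⁻¹) atTop (𝓝 (1 - k * 0)) :=
      ((tendsto_inv_atTop_zero.comp (tendsto_atTop_add_const_right _ k tendsto_id)).const_mul
        k).const_sub 1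
    rw [mul_zero, sub_zero] at h2
    refine h2.congr' ?_
    filter_upwards [eventually_gt_atTop 0] with s hs
    have : s + k ≠ 0 := by positivity
    field_simp
    ring
  have h3 := ((Real.continuous_sqrt.tendsto 1).comp h1).sub_const 1
  rw [Real.sqrt_one, sub_self] at h3
  refine h3.congr' ?_
  filter_upwards [eventually_gt_atTop 0] with s hs
  have hs' : 0 < √s := Real.sqrt_pos.2 hs
  simp only [Function.comp]
  rw [Real.sqrt_div hs.le]
  field_simp

lemma tendsto_slowU_shift (hk : 0 ≤ k) : Tendsto (fun s =>
    (a * (Real.log (s + k) - Real.log s) + σ * ((√(s + k))⁻¹ - (√s)⁻¹)) * √s) atTop (𝓝 0) := by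
  have := ((tendsto_log_add_sub_log hk).const_mul a).add
    ((tendsto_inv_sqrt_add_sub hk).const_mul σ)
  simp only [mul_zero, add_zero] at this
  exact this.congr fun s => by ring

lemma hasJet_slowU_shift_inv (hc : 0 < c) (hk : 0 ≤ k) :
    HasJet (fun s => (slowU c a σ (s + k))⁻¹) 0 (2 * c) 0 := by
  have hx := tendsto_inv_sqrt
  have h1 := ((hx.mul hx).mul (tendsto_slowU_shift (a := a) (σ := σ) hk)).add
    ((hx.const_mul (k / (2 * c))).add
      ((tendsto_log_mul_inv_sqrt.const_mul a).add ((hx.mul hx).const_mul σ)))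
  simp only [mul_zero, add_zero] at h1
  refine (hasJet_inv hc (ρ := fun s => k / (2 * c) + (a * Real.log (s + k) + σ * (√(s + k))⁻¹))
    (h1.congr' ?_)).congr (Eventually.of_forall fun s => ?_) rfl rfl rfl
  · filter_upwards [eventually_gt_atTop 0] with s hs
    have hs' : 0 < √s := Real.sqrt_pos.2 hs
    field_simp
    ring
  · simp only [slowU]; congr 1; ring

lemma eventually_slowU_pos (hc : 0 < c) : ∀ᶠ s in atTop, 0 < slowU c a σ s := by
  obtain ⟨e, he, h⟩ := hasJet_slowU_inv (a := a) (σ := σ) hc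
  have h1 : Tendsto (fun s => 2 * c + e s * (√s)⁻¹) atTop (𝓝 (2 * c + 0 * 0)) :=
    (he.mul tendsto_inv_sqrt).const_add _
  filter_upwards [h, h1.eventually (lt_mem_nhds (show 0 < 2 * c + 0 * 0 by simpa using hc)),
    eventually_gt_atTop 0] with s h h1 hs
  have hs' : 0 < (√s)⁻¹ := inv_pos.2 (Real.sqrt_pos.2 hs)
  have : (slowU c a σ s)⁻¹ = (√s)⁻¹ ^ 2 * (2 * c + e s * (√s)⁻¹) := by rw [h]; ring
  rw [← inv_pos, this]
  positivity

/-- The shift changes `slowU` by `k/(2c)` plus `o(s^{-1/2})`; divided by `slowU ~ s/(2c)` this gives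
`-k/s` and an error `o(s^{-3/2})`. -/
lemma hasJet_slowU_ratio (hc : 0 < c) (hk : 0 ≤ k) :
    HasJet (fun s => slowU c a σ s * (slowU c a σ (s + k))⁻¹) 1 (-k) 0 := by
  have hY := hasJet_slowU_shift_inv (a := a) (σ := σ) hc hk
  have hd := hY.small_mul (tendsto_slowU_shift (a := a) (σ := σ) hk)
  refine (((hasJet_const 1).sub (hY.const_mul (k / (2 * c)))).sub hd).congr ?_ (by ring)
    (by field_simp; ring) (by ring)
  have hpos : ∀ᶠ s in atTop, 0 < slowU c a σ (s + k) :=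
    (tendsto_atTop_add_const_right _ k tendsto_id).eventually (eventually_slowU_pos hc)
  filter_upwards [hpos] with s hs
  have e : slowU c a σ s = slowU c a σ (s + k) - (k / (2 * c) +
      (a * (Real.log (s + k) - Real.log s) + σ * ((√(s + k))⁻¹ - (√s)⁻¹))) := by
    unfold slowU; ring
  have := hs.ne'
  rw [e]
  field_simp
  ring

lemma hasJet_slowW : HasJet (slowW c a σ) (1 / (2 * c)) a (-(σ / 2)) := by
  refine (((hasJet_const (1 / (2 * c))).add (hasJet_sq.const_mul a)).sub
    (hasJet_cube.const_mul (σ / 2))).congr ?_ (by ring) (by ring) (by ring)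
  filter_upwards [eventually_gt_atTop 0] with s hs
  rw [inv_sqrt_sq hs, slowW]; ring

lemma hasJet_slowW' : HasJet (slowW' a σ) 0 0 0 := by
  refine (((hasJet_sq.mul hasJet_sq).const_mul a).sub
    ((hasJet_cube.mul hasJet_sq).const_mul (3 * σ / 4))).congr ?_ (by ring) (by ring) (by ring)
  filter_upwards [eventually_gt_atTop 0] with s hs
  have : (√s)⁻¹ ^ 5 = (√s)⁻¹ ^ 3 * (√s)⁻¹ ^ 2 := by ring
  rw [slowW', this, inv_sqrt_sq hs]; ring

/-- The first slow variable as a polynomial in the second one. -/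
def slowP (b β y : ℝ) : ℝ := y ^ 2 / (2 * b) + β * y ^ 3

/-- `φ'' - c φ' + φ (ψ - φ)` on the slow curve, divided by `y³`. -/
def slowBracket₁ (b c β y w w' : ℝ) : ℝ :=
  (3 * y / b + 12 * β * y ^ 2) * w ^ 2 + (1 / b + 3 * β * y) * w' - c * w * (1 / b + 3 * β * y) +
    (1 / (2 * b) + β * y) * (1 - y / (2 * b) - β * y ^ 2)

/-- `ψ'' - c ψ' + b φ(t - c h) (1 - ψ)` on the slow curve, divided by `y²`; here `R` is the quotient
of the delayed and the actual value. -/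
def slowBracket₂ (b c β y w w' R : ℝ) : ℝ :=
  2 * y * w ^ 2 + w' - c * w + (R ^ 2 / 2 + b * β * y * R ^ 3) * (1 - y)

/-- The coefficient of the logarithm in the slow variable. -/
def slowA (b c h : ℝ) : ℝ := -(c ^ 2 * (1 + h + 1 / b) - 4) / (3 * c ^ 2)

/-- The cubic coefficient of the slow curve. -/
def slowBeta (b c h : ℝ) : ℝ := (slowA b c h + h + 1 - 1 / c ^ 2) / (2 * b)

/-- `slowA` and `slowBeta` solve the two linear equations that annihilate the `1/s` coefficients of
both brackets. The surviving term `s^{-3/2}` comes only from `-σ/2 s^{-3/2}` in `slowW`, through `-c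
w`, and so has the sign of `σ`. -/
lemma hasJet_slowBracket₁ {b h : ℝ} (hb : 0 < b) (hc : 0 < c) :
    HasJet (fun s => slowBracket₁ b c (slowBeta b c h) (slowU c (slowA b c h) σ s)⁻¹
      (slowW c (slowA b c h) σ s) (slowW' (slowA b c h) σ s)) 0 0 (c * σ / (2 * b)) := by
  have hy := hasJet_slowU_inv (a := slowA b c h) (σ := σ) hc
  have hw := hasJet_slowW (c := c) (a := slowA b c h) (σ := σ)
  have hw' := hasJet_slowW' (a := slowA b c h) (σ := σ)
  set β := slowBeta b c h with hβ
  have hy2 := hy.mul hy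
  have t1 := ((hy.const_mul (3 / b)).add (hy2.const_mul (12 * β))).mul (hw.mul hw)
  have t2 := ((hasJet_const (1 / b)).add (hy.const_mul (3 * β)))
  have t3 := ((hasJet_const (1 / (2 * b))).add (hy.const_mul β)).mul
    (((hasJet_const 1).sub (hy.const_mul (1 / (2 * b)))).sub (hy2.const_mul β))
  refine (((t1.add (t2.mul hw')).sub ((hw.const_mul c).mul t2)).add t3).congr
    (Eventually.of_forall fun s => ?_) ?_ ?_ ?_
  · simp only [slowBracket₁]; ring
  · field_simp; ring
  · rw [hβ, slowBeta, slowA]; field_simp; ring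
  · field_simp; ring

lemma hasJet_slowBracket₂ {b h : ℝ} (hb : 0 < b) (hc : 0 < c) (hh : 0 ≤ h) :
    HasJet (fun s => slowBracket₂ b c (slowBeta b c h) (slowU c (slowA b c h) σ s)⁻¹
      (slowW c (slowA b c h) σ s) (slowW' (slowA b c h) σ s)
      (slowU c (slowA b c h) σ s * (slowU c (slowA b c h) σ (s + c * h))⁻¹)) 0 0 (c * σ / 2) := by
  have hy := hasJet_slowU_inv (a := slowA b c h) (σ := σ) hc
  have hw := hasJet_slowW (c := c) (a := slowA b c h) (σ := σ)
  have hw' := hasJet_slowW' (a := slowA b c h) (σ := σ)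
  have hR := hasJet_slowU_ratio (a := slowA b c h) (σ := σ) hc (mul_nonneg hc.le hh)
  set β := slowBeta b c h with hβ
  have hR2 := hR.mul hR
  have t1 := (hy.const_mul 2).mul (hw.mul hw)
  have t2 := ((hR2.const_mul (1 / 2)).add ((hy.const_mul (b * β)).mul (hR2.mul hR))).mul
    ((hasJet_const 1).sub hy)
  refine (((t1.add hw').sub (hw.const_mul c)).add t2).congr
    (Eventually.of_forall fun s => ?_) ?_ ?_ ?_
  · simp only [slowBracket₂]; ring
  · field_simp; ring
  · rw [hβ, slowBeta]; field_simp; ring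
  · field_simp; ring

end SlowManifold

/-! ### The slow curve as a function of time, and its truncation. -/

section CriticalPair

/-- A sub-solution that stays positive is truncated by subtracting a fast exponential. -/
lemma isSlowPair_sub_exp {b c h T : ℝ} {p q P Q : ℝ → ℝ} (hb : 0 < b) (hc : 0 < c) (hh : 0 ≤ h)
    (hpC : ∀ t ≤ -T, ContDiffAt ℝ 2 p t) (hqC : ∀ t ≤ -T, ContDiffAt ℝ 2 q t)
    (hPC : ∀ t ≤ -T, ContDiffAt ℝ 2 P t) (hQC : ∀ t ≤ -T, ContDiffAt ℝ 2 Q t)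
    (hP0 : ∀ t ≤ -T, 0 < P t) (hQ0 : ∀ t ≤ -T, 0 < Q t)
    (hPp : ∀ t ≤ -T, P t ≤ p t) (hQq : ∀ t ≤ -T, Q t ≤ q t)
    (hp1 : ∀ t ≤ -T, p t ≤ 1) (hq1 : ∀ t ≤ -T, q t ≤ 1)
    (hpm : MonotoneOn p (Iic (-T))) (hqm : MonotoneOn q (Iic (-T)))
    (hs₁ : ∀ t ≤ -T, bzOp₁ c 1 p q t ≤ 0) (hs₂ : ∀ t ≤ -T, bzOp₂ b c h p q t ≤ 0)
    (hS₁ : ∀ t ≤ -T, 0 ≤ bzOp₁ c 1 P Q t) (hS₂ : ∀ t ≤ -T, 0 ≤ bzOp₂ b c h P Q t)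
    (hpl : Tendsto (fun t => t * p t) atBot (𝓝 0)) (hql : Tendsto q atBot (𝓝 0))
    (hPl : Tendsto P atBot (𝓝 0)) (hQl : Tendsto Q atBot (𝓝 0))
    (hsmall : ∀ t ≤ -T, P t * (1 + 4 * b / c ^ 2) + Q t ≤ c ^ 2 / 4)
    (hslow : ∀ η, ∀ᶠ t in atBot, η * Real.exp (c / 2 * t) < P t) :
    ∃ η, 0 < η ∧ IsSlowPair b c 1 h T p q (fun t => P t - η * Real.exp (c / 2 * t))
      (fun t => Q t - (1 + 4 * b / c ^ 2) * η * Real.exp (c / 2 * t)) := by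
  -- The rate `c/2` minimizes `z² - c z`, so subtracting `X = η e^{ct/2}` gains `c² X / 4`. The
  -- factor `θ` in the second component makes its gain `c² θ X / 4` cover the loss `b X` caused by
  -- lowering the delayed `P`.
  set θ := 1 + 4 * b / c ^ 2 with hθ
  have hch : 0 ≤ c * h := mul_nonneg hc.le hh
  have hθ0 : 1 ≤ θ := by rw [hθ]; linarith [show 0 ≤ 4 * b / c ^ 2 by positivity]
  have hθb : b ≤ c ^ 2 / 4 * θ := by
    have : c ^ 2 / 4 * θ = c ^ 2 / 4 + b := by rw [hθ]; field_simp
    rw [this]; linarith [show 0 ≤ c ^ 2 / 4 by positivity]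
  -- With this value `η e^{ct/2}` equals `P + Q` at `-T`, so both differences are nonpositive there.
  set η := (P (-T) + Q (-T)) * Real.exp (c / 2 * T) with hη
  have hη0 : 0 < η := mul_pos (add_pos (hP0 _ le_rfl) (hQ0 _ le_rfl)) (Real.exp_pos _)
  have hE (C t : ℝ) : HasDerivAt (fun t => C * Real.exp (c / 2 * t))
      (C * (c / 2) * Real.exp (c / 2 * t)) t := by
    have := (((hasDerivAt_id t).const_mul (c / 2)).exp).const_mul C
    refine this.congr_deriv ?_
    simp only [id, mul_one]; ring
  have hE1 (C : ℝ) : deriv (fun t => C * Real.exp (c / 2 * t)) =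
      fun t => C * (c / 2) * Real.exp (c / 2 * t) := funext fun t => (hE C t).deriv
  have hE2 (C t : ℝ) : deriv (deriv fun t => C * Real.exp (c / 2 * t)) t =
      C * (c / 2) * (c / 2) * Real.exp (c / 2 * t) := by rw [hE1, hE1]
  have hEC (C t : ℝ) : ContDiffAt ℝ 2 (fun t => C * Real.exp (c / 2 * t)) t := by fun_prop
  have hEl (C : ℝ) : Tendsto (fun t => C * Real.exp (c / 2 * t)) atBot (𝓝 0) := by
    have := (Real.tendsto_exp_atBot.comp
      (tendsto_id.const_mul_atBot (show 0 < c / 2 by positivity))).const_mul C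
    simpa using this
  have hEnd : η * Real.exp (c / 2 * -T) = P (-T) + Q (-T) := by
    rw [hη, mul_assoc, ← Real.exp_add]; simp
  refine ⟨η, hη0, ?_⟩
  constructor
  · exact hpC
  · exact hqC
  · exact fun t ht => (hPC t ht).sub (hEC _ t)
  · exact fun t ht => (hQC t ht).sub (hEC _ t)
  · exact fun t ht => (hP0 t ht).trans_le (hPp t ht)
  · exact fun t ht => (hQ0 t ht).trans_le (hQq t ht)
  · exact hp1
  · exact hq1
  · exact hpm
  · exact hqm
  · exact hs₁
  · exact hs₂
  · exact hpl
  · exact hql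
  · intro t ht
    have : 0 < η * Real.exp (c / 2 * t) := by positivity
    linarith [hPp t ht]
  · intro t ht
    have : 0 < θ * η * Real.exp (c / 2 * t) := by positivity
    linarith [hQq t ht]
  · simp only [hEnd]
    linarith [hQ0 _ (le_refl (-T))]
  · have h1 := hP0 _ (le_refl (-T))
    have h2 := hQ0 _ (le_refl (-T))
    have h3 : 1 * (P (-T) + Q (-T)) ≤ θ * (P (-T) + Q (-T)) :=
      mul_le_mul_of_nonneg_right hθ0 (by linarith)
    simp only [mul_assoc, hEnd]
    linarith
  · filter_upwards [hslow η] with t ht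
    linarith
  · simpa using hPl.sub (hEl η)
  · simpa using hQl.sub (hEl (θ * η))
  · intro t ht hf
    have h1 := hS₁ t ht
    have h2 := hsmall t ht
    have hP := hP0 t ht
    have hQ := hQ0 t ht
    have hX : 0 < η * Real.exp (c / 2 * t) := by positivity
    simp only [bzOp₁] at h1 ⊢
    rw [(hPC t ht).deriv_deriv_sub (hEC η t),
      ((hPC t ht).deriv_sub_eventuallyEq (hEC η t)).eq_of_nhds, hE2, hE1]
    have h3 : (P t - η * Real.exp (c / 2 * t)) * (Q t - θ * η * Real.exp (c / 2 * t)) ≤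
        (P t - η * Real.exp (c / 2 * t)) * max 0 (Q t - θ * η * Real.exp (c / 2 * t)) :=
      mul_le_mul_of_nonneg_left (le_max_right _ _) hf.le
    rw [mul_assoc θ η] at h3 ⊢
    generalize max 0 (Q t - θ * (η * Real.exp (c / 2 * t))) = y at *
    have e1 : η * (c / 2) * (c / 2) * Real.exp (c / 2 * t) =
      c ^ 2 / 4 * (η * Real.exp (c / 2 * t)) := by ring
    have e2 : η * (c / 2) * Real.exp (c / 2 * t) = c / 2 * (η * Real.exp (c / 2 * t)) := by ring
    beta_reduce
    rw [e1, e2]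
    generalize η * Real.exp (c / 2 * t) = X at *
    -- The losses `-θ P X - Q X` in the product of the two differences are covered by the linear
    -- gain.
    have h4 : (P t * θ + Q t) * X ≤ c ^ 2 / 4 * X := mul_le_mul_of_nonneg_right h2 hX.le
    have h5 : 1 * (X * X) ≤ θ * (X * X) := mul_le_mul_of_nonneg_right hθ0 (by positivity)
    have h6 : 0 ≤ P t * X := by positivity
    linarith
  · intro t ht hg
    have ht' : t - c * h ≤ -T := by linarith
    have h1 := hS₂ t ht
    have hP := hP0 _ ht'
    have hX : 0 < η * Real.exp (c / 2 * t) := by positivity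
    have hX' : η * Real.exp (c / 2 * (t - c * h)) ≤ η * Real.exp (c / 2 * t) := by
      gcongr; linarith
    have hX'0 : 0 < η * Real.exp (c / 2 * (t - c * h)) := by positivity
    have hQ1 := (hQq t ht).trans (hq1 t ht)
    simp only [bzOp₂] at h1 ⊢
    rw [(hQC t ht).deriv_deriv_sub (hEC (θ * η) t),
      ((hQC t ht).deriv_sub_eventuallyEq (hEC (θ * η) t)).eq_of_nhds, hE2, hE1]
    have hy := le_max_right 0 (P (t - c * h) - η * Real.exp (c / 2 * (t - c * h)))
    generalize max 0 (P (t - c * h) - η * Real.exp (c / 2 * (t - c * h))) = y at *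
    have e1 : θ * η * (c / 2) * (c / 2) * Real.exp (c / 2 * t) =
      c ^ 2 / 4 * (θ * (η * Real.exp (c / 2 * t))) := by ring
    have e2 : θ * η * (c / 2) * Real.exp (c / 2 * t) =
      c / 2 * (θ * (η * Real.exp (c / 2 * t))) := by ring
    beta_reduce
    rw [e1, e2]
    rw [mul_assoc θ η] at hg ⊢
    generalize η * Real.exp (c / 2 * t) = X at *
    generalize η * Real.exp (c / 2 * (t - c * h)) = X' at *
    generalize P (t - c * h) = P' at *
    have h3 : b * ((P' - X') * (1 - (Q t - θ * X))) ≤ b * (y * (1 - (Q t - θ * X))) := by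
      have : 0 ≤ θ * X := by positivity
      exact mul_le_mul_of_nonneg_left (mul_le_mul_of_nonneg_right hy (by linarith)) hb.le
    have h4 : b * X ≤ c ^ 2 / 4 * θ * X := mul_le_mul_of_nonneg_right hθb hX.le
    have h5 : b * X' ≤ b * X := mul_le_mul_of_nonneg_left hX' hb.le
    have h6 : 0 ≤ b * (P' * (θ * X)) := by positivity
    have h7 : 0 ≤ b * (X' * (Q t - θ * X)) := by positivity
    linarith

variable {b c h a β σ : ℝ}

/-- The slow variable as a function of time. -/
def slowQ (c a σ t : ℝ) : ℝ := (slowU c a σ (-t))⁻¹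

lemma hasDerivAt_slowQ {t : ℝ} (ht : t < 0) (hU : 0 < slowU c a σ (-t)) :
    HasDerivAt (slowQ c a σ) (slowQ c a σ t ^ 2 * slowW c a σ (-t)) t := by
  have h1 : HasDerivAt (fun t => slowU c a σ (-t)) (slowW c a σ (-t) * -1) t :=
    (hasDerivAt_slowU (show 0 < -t by linarith)).comp t (hasDerivAt_neg t)
  refine (h1.inv hU.ne').congr_deriv ?_
  simp only [slowQ]
  field_simp

lemma hasDerivAt_slowW_neg {t : ℝ} (ht : t < 0) :
    HasDerivAt (fun t => slowW c a σ (-t)) (slowW' a σ (-t)) t :=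
  ((hasDerivAt_slowW (show 0 < -t by linarith)).comp t (hasDerivAt_neg t)).congr_deriv (by ring)

lemma contDiffAt_slowQ {t : ℝ} (ht : t < 0) (hU : 0 < slowU c a σ (-t)) :
    ContDiffAt ℝ 2 (slowQ c a σ) t := by
  have hn : ContDiffAt ℝ 2 (fun t : ℝ => -t) t := contDiffAt_id.neg
  have h0 : -t ≠ 0 := by linarith
  have hs : ContDiffAt ℝ 2 (fun t : ℝ => (√(-t))⁻¹) t :=
    (hn.sqrt h0).inv (Real.sqrt_pos.2 (by linarith)).ne'
  have hU' : ContDiffAt ℝ 2 (fun t => slowU c a σ (-t)) t :=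
    (hn.div_const _).add ((contDiffAt_const.mul (hn.log h0)).add (contDiffAt_const.mul hs))
  exact hU'.inv hU.ne'

lemma eventually_nhds_slowU_pos {t : ℝ} (ht : t < 0) (hU : 0 < slowU c a σ (-t)) :
    ∀ᶠ s in 𝓝 t, s < 0 ∧ 0 < slowU c a σ (-s) := by
  have h1 : HasDerivAt (fun t => slowU c a σ (-t)) (slowW c a σ (-t) * -1) t :=
    (hasDerivAt_slowU (show 0 < -t by linarith)).comp t (hasDerivAt_neg t)
  exact Filter.Eventually.and (show ∀ᶠ s in 𝓝 t, s < 0 from Iio_mem_nhds ht)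
    (h1.continuousAt.eventually (lt_mem_nhds hU))

lemma hasDerivAt_slowP {f : ℝ → ℝ} {f' t : ℝ} (hb : 0 < b) (hf : HasDerivAt f f' t) :
    HasDerivAt (fun t => slowP b β (f t)) ((f t / b + 3 * β * f t ^ 2) * f') t := by
  refine (((hf.pow 2).div_const (2 * b)).add ((hf.pow 3).const_mul β)).congr_deriv ?_
  push_cast
  field_simp

lemma deriv_slowP {t : ℝ} (hb : 0 < b) (ht : t < 0) (hU : 0 < slowU c a σ (-t)) :
    deriv (fun t => slowP b β (slowQ c a σ t)) t =
      slowQ c a σ t ^ 3 * slowW c a σ (-t) * (1 / b + 3 * β * slowQ c a σ t) := by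
  rw [(hasDerivAt_slowP hb (hasDerivAt_slowQ ht hU)).deriv]
  ring

/-- On the curve `y' = y² w`, so a factor `y³ > 0` comes out and the sign of the operator is that of
the bracket. -/
lemma bzOp₁_slow {t : ℝ} (hb : 0 < b) (ht : t < 0) (hU : 0 < slowU c a σ (-t)) :
    bzOp₁ c 1 (fun t => slowP b β (slowQ c a σ t)) (slowQ c a σ) t = slowQ c a σ t ^ 3 *
      slowBracket₁ b c β (slowQ c a σ t) (slowW c a σ (-t)) (slowW' a σ (-t)) := by
  have hq := hasDerivAt_slowQ ht hU
  have hev : deriv (fun t => slowP b β (slowQ c a σ t)) =ᶠ[𝓝 t] fun t =>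
      slowQ c a σ t ^ 3 * slowW c a σ (-t) * (1 / b + 3 * β * slowQ c a σ t) :=
    (eventually_nhds_slowU_pos ht hU).mono fun s hs => deriv_slowP hb hs.1 hs.2
  have h2 := ((hq.pow 3).mul (hasDerivAt_slowW_neg (c := c) (a := a) (σ := σ) ht)).mul
    ((hq.const_mul (3 * β)).const_add (1 / b))
  have h3 : deriv (deriv fun t => slowP b β (slowQ c a σ t)) t = _ := hev.deriv_eq.trans h2.deriv
  rw [bzOp₁, h3, hev.eq_of_nhds]
  simp only [slowBracket₁, slowP, Pi.pow_apply, Pi.mul_apply]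
  push_cast
  field_simp
  ring

lemma bzOp₂_slow {t : ℝ} (hb : 0 < b) (ht : t < 0) (hU : 0 < slowU c a σ (-t)) :
    bzOp₂ b c h (fun t => slowP b β (slowQ c a σ t)) (slowQ c a σ) t = slowQ c a σ t ^ 2 *
      slowBracket₂ b c β (slowQ c a σ t) (slowW c a σ (-t)) (slowW' a σ (-t))
        (slowU c a σ (-t) * (slowU c a σ (-t + c * h))⁻¹) := by
  have hq := hasDerivAt_slowQ ht hU
  have hev : deriv (slowQ c a σ) =ᶠ[𝓝 t] fun t => slowQ c a σ t ^ 2 * slowW c a σ (-t) :=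
    (eventually_nhds_slowU_pos ht hU).mono fun s hs => (hasDerivAt_slowQ hs.1 hs.2).deriv
  have h2 := (hq.pow 2).mul (hasDerivAt_slowW_neg (c := c) (a := a) (σ := σ) ht)
  have h3 : deriv (deriv (slowQ c a σ)) t = _ := hev.deriv_eq.trans h2.deriv
  have hY : slowQ c a σ (t - c * h) = slowQ c a σ t *
      (slowU c a σ (-t) * (slowU c a σ (-t + c * h))⁻¹) := by
    rw [slowQ, slowQ, ← mul_assoc, inv_mul_cancel₀ hU.ne', one_mul]
    congr 2; ring
  rw [bzOp₂, h3, hev.eq_of_nhds]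
  simp only [hY, slowBracket₂, slowP, Pi.pow_apply]
  generalize slowU c a σ (-t) * (slowU c a σ (-t + c * h))⁻¹ = R
  push_cast
  field_simp

end CriticalPair

/-! ### The slow pair for `r = 1`. -/

section CriticalExistence

variable {b c h a β σ : ℝ}

lemma tendsto_mul_slowU_inv (hc : 0 < c) :
    Tendsto (fun s => s * (slowU c a σ s)⁻¹) atTop (𝓝 (2 * c)) := by
  obtain ⟨e, he, h⟩ := hasJet_slowU_inv (a := a) (σ := σ) hc
  have h1 : Tendsto (fun s => 2 * c + e s * (√s)⁻¹) atTop (𝓝 (2 * c)) := by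
    simpa using (he.mul tendsto_inv_sqrt).const_add (2 * c)
  refine h1.congr' ?_
  filter_upwards [h, eventually_gt_atTop 0] with s h hs
  have e1 : (√s)⁻¹ ^ 3 = (√s)⁻¹ ^ 2 * (√s)⁻¹ := by ring
  rw [h, e1, inv_sqrt_sq hs]
  field_simp
  ring

/-- The smallness of `|β| y` keeps the derivative `y/b + 3 β y²` nonnegative on the whole interval.
-/
lemma slowP_mono {x y : ℝ} (hb : 0 < b) (hx : 0 ≤ x) (hxy : x ≤ y)
    (hy : |β| * y ≤ 1 / (8 * b)) : slowP b β x ≤ slowP b β y := by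
  have h1 : |β| * x ≤ 1 / (8 * b) := (mul_le_mul_of_nonneg_left hxy (abs_nonneg _)).trans hy
  have h2 : -(|β| * (y ^ 2 + y * x + x ^ 2)) ≤ β * (y ^ 2 + y * x + x ^ 2) := by
    rw [← neg_mul]
    exact mul_le_mul_of_nonneg_right (neg_abs_le β) (by nlinarith [mul_nonneg hx (hx.trans hxy)])
  have h3 : |β| * y * (y + x) ≤ 1 / (8 * b) * (y + x) :=
    mul_le_mul_of_nonneg_right hy (by linarith)
  have h4 : |β| * x * x ≤ 1 / (8 * b) * x := mul_le_mul_of_nonneg_right h1 hx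
  have h5 : 1 / (8 * b) * x ≤ 1 / (8 * b) * y := mul_le_mul_of_nonneg_left hxy (by positivity)
  have h6 : 0 ≤ 1 / (8 * b) * (y + x) := mul_nonneg (by positivity) (by linarith)
  have h7 : 0 ≤ (y - x) * (4 * (1 / (8 * b) * (y + x)) + β * (y ^ 2 + y * x + x ^ 2)) :=
    mul_nonneg (by linarith) (by linarith)
  have h8 : slowP b β y - slowP b β x =
      (y - x) * (4 * (1 / (8 * b) * (y + x)) + β * (y ^ 2 + y * x + x ^ 2)) := by
    unfold slowP; field_simp; ring
  linarith

lemma le_slowP {y : ℝ} (hb : 0 < b) (hy0 : 0 ≤ y) (hy : |β| * y ≤ 1 / (8 * b)) :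
    y ^ 2 / (4 * b) ≤ slowP b β y := by
  have h2 : -(|β| * y) * y ^ 2 ≤ β * y * y ^ 2 :=
    mul_le_mul_of_nonneg_right
      (by rw [← neg_mul]; exact mul_le_mul_of_nonneg_right (neg_abs_le β) hy0) (by positivity)
  have h3 : |β| * y * y ^ 2 ≤ 1 / (8 * b) * y ^ 2 :=
    mul_le_mul_of_nonneg_right hy (by positivity)
  have h4 : slowP b β y - y ^ 2 / (4 * b) = 2 * (1 / (8 * b) * y ^ 2) + β * y * y ^ 2 := by
    unfold slowP; field_simp; ring
  have h5 : 0 ≤ 1 / (8 * b) * y ^ 2 := by positivity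
  linarith

/-- The slow curve carries a super- and a sub-solution. -/
theorem exists_slowPair_of_eq_one (hb : 0 < b) (hc : 0 < c) (hh : 0 ≤ h) :
    ∃ T η, IsSlowPair b c 1 h T
      (fun t => slowP b (slowBeta b c h) (slowQ c (slowA b c h) (-1) t))
      (slowQ c (slowA b c h) (-1))
      (fun t => slowP b (slowBeta b c h) (slowQ c (slowA b c h) 1 t) -
        η * Real.exp (c / 2 * t))
      (fun t => slowQ c (slowA b c h) 1 t -
        (1 + 4 * b / c ^ 2) * η * Real.exp (c / 2 * t)) := by
  have J₁ (σ : ℝ) := hasJet_slowBracket₁ (σ := σ) (h := h) hb hc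
  have J₂ (σ : ℝ) := hasJet_slowBracket₂ (σ := σ) hb hc hh
  set a := slowA b c h with ha
  set β := slowBeta b c h with hβ
  have hY (σ : ℝ) : Tendsto (fun s => (slowU c a σ s)⁻¹) atTop (𝓝 0) :=
    (hasJet_slowU_inv hc).tendsto
  have hP (σ : ℝ) : Tendsto (fun s => slowP b β (slowU c a σ s)⁻¹) atTop (𝓝 0) := by
    have := (((hY σ).pow 2).div_const (2 * b)).add (((hY σ).pow 3).const_mul β)
    simpa [slowP] using this
  have hUpos (σ : ℝ) : ∀ᶠ s in atTop, 0 < slowU c a σ s := eventually_slowU_pos hc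
  have hsm (σ : ℝ) : ∀ᶠ s in atTop, |β| * (slowU c a σ s)⁻¹ ≤ 1 / (8 * b) := by
    have := (hY σ).const_mul |β|
    rw [mul_zero] at this
    exact this.eventually (ge_mem_nhds (by positivity))
  have hW : ∀ᶠ s in atTop, 0 < slowW c a (-1) s :=
    (hasJet_slowW (c := c) (a := a) (σ := -1)).tendsto.eventually
      (lt_mem_nhds (show 0 < 1 / (2 * c) by positivity))
  have hS : ∀ᶠ s in atTop, slowP b β (slowU c a 1 s)⁻¹ * (1 + 4 * b / c ^ 2) +
      (slowU c a 1 s)⁻¹ ≤ c ^ 2 / 4 := by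
    have := ((hP 1).mul_const (1 + 4 * b / c ^ 2)).add (hY 1)
    rw [zero_mul, zero_add] at this
    exact this.eventually (ge_mem_nhds (by positivity))
  -- `σ = 1` makes both brackets positive, hence a sub-solution; `σ = -1` makes them negative, hence
  -- a super-solution.
  have B₁ := (J₁ 1).eventually_pos (by rw [mul_one]; positivity)
  have B₂ := (J₂ 1).eventually_pos (by rw [mul_one]; positivity)
  have B₁' := (((J₁ (-1)).const_mul (-1)).congr (Eventually.of_forall fun _ => rfl) (by ring)
    (by ring) rfl).eventually_pos
      (by rw [show -1 * (c * -1 / (2 * b)) = c / (2 * b) by ring]; positivity)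
  have B₂' := (((J₂ (-1)).const_mul (-1)).congr (Eventually.of_forall fun _ => rfl) (by ring)
    (by ring) rfl).eventually_pos
      (by rw [show -1 * (c * -1 / 2) = c / 2 by ring]; positivity)
  obtain ⟨T, hT⟩ := eventually_atTop.1 ((eventually_gt_atTop (0 : ℝ)).and <| (hUpos 1).and <|
    (hUpos (-1)).and <| (hsm 1).and <| (hsm (-1)).and <| hW.and <| hS.and <| B₁.and <| B₂.and <|
    B₁'.and <| B₂'.and <| ((hY (-1)).eventually (ge_mem_nhds one_pos)).and
      ((hP (-1)).eventually (ge_mem_nhds one_pos)))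
  have H (t : ℝ) (ht : t ≤ -T) := hT (-t) (by linarith)
  have hneg (t : ℝ) (ht : t ≤ -T) : t < 0 := by linarith [(H t ht).1]
  have hQ (σ : ℝ) : Tendsto (slowQ c a σ) atBot (𝓝 0) := (hY σ).comp tendsto_neg_atBot_atTop
  have hP' (σ : ℝ) : Tendsto (fun t => slowP b β (slowQ c a σ t)) atBot (𝓝 0) :=
    (hP σ).comp tendsto_neg_atBot_atTop
  have hsP : ContDiff ℝ 2 (slowP b β) := by unfold slowP; fun_prop
  have hle (t : ℝ) (ht : t ≤ -T) : slowQ c a 1 t ≤ slowQ c a (-1) t := by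
    obtain ⟨-, -, h3, -⟩ := H t ht
    refine inv_anti₀ h3 ?_
    have : 0 ≤ (√(-t))⁻¹ := by positivity
    unfold slowU
    linarith
  have hqm : MonotoneOn (slowQ c a (-1)) (Iic (-T)) := by
    have hd (t : ℝ) (ht : t ≤ -T) := hasDerivAt_slowQ (hneg t ht) (H t ht).2.2.1
    refine monotoneOn_of_deriv_nonneg (convex_Iic _)
      (fun t ht => (hd t ht).continuousAt.continuousWithinAt)
      (fun t ht => (hd t (interior_subset (s := Iic (-T)) ht)).differentiableAt.differentiableWithinAt)
      fun t ht => ?_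
    have ht' : t ≤ -T := interior_subset (s := Iic (-T)) ht
    rw [(hd t ht').deriv]
    have := (H t ht').2.2.2.2.2.1
    positivity
  have hpos (t : ℝ) (ht : t ≤ -T) : 0 < slowQ c a (-1) t := inv_pos.2 (H t ht).2.2.1
  have hpos' (t : ℝ) (ht : t ≤ -T) : 0 < slowQ c a 1 t := inv_pos.2 (H t ht).2.1
  have hPlow (t : ℝ) (ht : t ≤ -T) : slowQ c a 1 t ^ 2 / (4 * b) ≤ slowP b β (slowQ c a 1 t) :=
    le_slowP hb (hpos' t ht).le (H t ht).2.2.2.1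
  obtain ⟨η, -, hη⟩ := isSlowPair_sub_exp (T := T) (h := h)
    (p := fun t => slowP b β (slowQ c a (-1) t)) (q := slowQ c a (-1))
    (P := fun t => slowP b β (slowQ c a 1 t)) (Q := slowQ c a 1) hb hc hh
    (fun t ht => hsP.contDiffAt.comp t (contDiffAt_slowQ (hneg t ht) (H t ht).2.2.1))
    (fun t ht => contDiffAt_slowQ (hneg t ht) (H t ht).2.2.1)
    (fun t ht => hsP.contDiffAt.comp t (contDiffAt_slowQ (hneg t ht) (H t ht).2.1))
    (fun t ht => contDiffAt_slowQ (hneg t ht) (H t ht).2.1)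
    (fun t ht => (by have := hpos' t ht; positivity : 0 < slowQ c a 1 t ^ 2 / (4 * b)).trans_le
      (hPlow t ht))
    hpos'
    (fun t ht => slowP_mono hb (hpos' t ht).le (hle t ht) (H t ht).2.2.2.2.1)
    hle
    (fun t ht => (H t ht).2.2.2.2.2.2.2.2.2.2.2.2)
    (fun t ht => (H t ht).2.2.2.2.2.2.2.2.2.2.2.1)
    (fun s hs t ht hst => slowP_mono hb (hpos s hs).le (hqm hs ht hst) (H t ht).2.2.2.2.1)
    hqm
    (fun t ht => by
      rw [bzOp₁_slow hb (hneg t ht) (H t ht).2.2.1]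
      have h1 := (H t ht).2.2.2.2.2.2.2.2.2.1
      exact mul_nonpos_of_nonneg_of_nonpos (pow_pos (hpos t ht) 3).le
        (by unfold slowQ; linarith))
    (fun t ht => by
      rw [bzOp₂_slow hb (hneg t ht) (H t ht).2.2.1]
      have h1 := (H t ht).2.2.2.2.2.2.2.2.2.2.1
      exact mul_nonpos_of_nonneg_of_nonpos (pow_pos (hpos t ht) 2).le
        (by unfold slowQ; linarith))
    (fun t ht => by
      rw [bzOp₁_slow hb (hneg t ht) (H t ht).2.1]
      have h1 := (H t ht).2.2.2.2.2.2.2.1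
      exact mul_nonneg (pow_pos (hpos' t ht) 3).le (by unfold slowQ; linarith))
    (fun t ht => by
      rw [bzOp₂_slow hb (hneg t ht) (H t ht).2.1]
      have h1 := (H t ht).2.2.2.2.2.2.2.2.1
      exact mul_nonneg (pow_pos (hpos' t ht) 2).le (by unfold slowQ; linarith))
    (by
      have h1 := (tendsto_mul_slowU_inv (a := a) (σ := -1) hc).comp tendsto_neg_atBot_atTop
      have h2 := ((hQ (-1)).div_const (2 * b)).add (((hQ (-1)).pow 2).const_mul β)
      have h3 := (h1.mul h2).neg
      simp only [zero_div, ne_eq, OfNat.ofNat_ne_zero, not_false_eq_true, zero_pow, mul_zero,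
        add_zero, neg_zero] at h3
      refine h3.congr fun t => ?_
      simp only [Function.comp, slowQ, slowP]
      ring)
    (hQ _) (hP' _) (hQ _)
    (fun t ht => (H t ht).2.2.2.2.2.2.1)
    (by
      intro η
      -- Since `-t y → 2c`, eventually `y > c/(-t)`, so `slowP` exceeds `c²/(4 b t²)` and beats any
      -- multiple of `e^{ct/2}`.
      have h1 := ((tendsto_mul_slowU_inv (a := a) (σ := 1) hc).comp
        tendsto_neg_atBot_atTop).eventually (lt_mem_nhds (show c < 2 * c by linarith))
      have h2 := ((tendsto_id_mul_exp_atBot (show 0 < c / 4 by positivity)).pow 2).const_mul η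
      simp only [ne_eq, OfNat.ofNat_ne_zero, not_false_eq_true, zero_pow, mul_zero] at h2
      filter_upwards [h1, h2.eventually (gt_mem_nhds (show 0 < c ^ 2 / (4 * b) by positivity)),
        eventually_le_atBot (-T)] with t h1 h2 ht
      have ht0 := hneg t ht
      refine lt_of_lt_of_le ?_ (hPlow t ht)
      have e1 : (t * Real.exp (c / 4 * t)) ^ 2 = t ^ 2 * Real.exp (c / 2 * t) := by
        rw [mul_pow, ← Real.exp_nat_mul]
        congr 2; push_cast; ring
      rw [e1] at h2
      have h3 : c < -t * slowQ c a 1 t := h1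
      have h4 : c ^ 2 < (-t * slowQ c a 1 t) ^ 2 := by gcongr
      have ht2 : 0 < t ^ 2 := sq_pos_of_neg ht0
      refine lt_of_mul_lt_mul_left (a := t ^ 2) ?_ ht2.le
      calc t ^ 2 * (η * Real.exp (c / 2 * t)) = η * (t ^ 2 * Real.exp (c / 2 * t)) := by ring
        _ < c ^ 2 / (4 * b) := h2
        _ ≤ (-t * slowQ c a 1 t) ^ 2 / (4 * b) := by gcongr
        _ = _ := by ring)
  exact ⟨T, η, hη⟩

end CriticalExistence

/-! ### Asymptotic expansions along the slow curve. -/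

section Asymptotics

open Asymptotics

variable {b c h a β σ : ℝ}

lemma tendsto_polynomial_mul_exp_mul_atBot (P : Polynomial ℝ) {l : ℝ} (hl : 0 < l) :
    Tendsto (fun t => P.eval t * Real.exp (l * t)) atBot (𝓝 0) := by
  refine ((tendsto_polynomial_mul_exp_atBot (P.comp (Polynomial.C l⁻¹ * Polynomial.X))).comp
    (tendsto_id.const_mul_atBot hl)).congr fun t => ?_
  simp [inv_mul_cancel_left₀ hl.ne']

lemma isBigO_of_sandwich {α : Type*} {l : Filter α} {f g x w : α → ℝ} (hf : f =O[l] w)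
    (hg : g =O[l] w) (h : ∀ᶠ t in l, f t ≤ x t ∧ x t ≤ g t) : x =O[l] w := by
  refine IsBigO.trans (IsBigO.of_bound 1 ?_) (hf.norm_left.add hg.norm_left)
  filter_upwards [h] with t ht
  rw [one_mul, Real.norm_eq_abs, Real.norm_eq_abs, Real.norm_eq_abs, Real.norm_eq_abs]
  refine le_trans ?_ (le_abs_self _)
  exact abs_le.2 ⟨by linarith [neg_abs_le (f t), abs_nonneg (g t)],
    by linarith [le_abs_self (g t), abs_nonneg (f t)]⟩

lemma isBigO_inv_pow {F : ℝ → ℝ} {n : ℕ}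
    (hF : (fun t => t ^ n * F t) =O[atBot] (fun _ => (1 : ℝ))) :
    F =O[atBot] (fun t : ℝ => 1 / t ^ n) := by
  refine ((isBigO_refl (fun t : ℝ => 1 / t ^ n) atBot).mul hF).congr' ?_
    (Eventually.of_forall fun t => mul_one _)
  filter_upwards [eventually_lt_atBot 0] with t ht
  have := ht.ne
  field_simp

/-- The loss `ν - ζ` absorbs the factor `t` and the shift. Thus the fast super-solution, wherever it
was shifted, enters only the error terms. -/
lemma isBigO_exp_of_isBigO_id_mul_exp {Φ : ℝ → ℝ} {ν ζ S : ℝ}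
    (hΦ : Φ =O[atBot] (fun t => t * Real.exp (ν * t))) (hζ : ζ < ν) :
    (fun t => Φ (t + S)) =O[atBot] (fun t => Real.exp (ζ * t)) := by
  have h1 := hΦ.comp_tendsto (tendsto_atBot_add_const_right atBot S tendsto_id)
  refine h1.trans ?_
  have h2 := (tendsto_polynomial_mul_exp_mul_atBot
    ((Polynomial.X + Polynomial.C S) * Polynomial.C (Real.exp (ν * S)))
    (sub_pos.2 hζ)).isBigO_one ℝ
  refine (h2.mul (isBigO_refl (fun t => Real.exp (ζ * t)) atBot)).congr (fun t => ?_)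
    fun t => one_mul _
  simp only [Polynomial.eval_mul, Polynomial.eval_add, Polynomial.eval_X, Polynomial.eval_C,
    Function.comp, id, mul_assoc, ← Real.exp_add]
  ring_nf

lemma isBigO_pow_mul_of_isBigO_exp {F : ℝ → ℝ} {ζ : ℝ} (hζ : 0 < ζ) (n : ℕ)
    (hF : F =O[atBot] (fun t => Real.exp (ζ * t))) :
    (fun t => t ^ n * F t) =O[atBot] (fun _ => (1 : ℝ)) := by
  refine ((isBigO_refl (fun t : ℝ => t ^ n) atBot).mul hF).trans ?_
  have := (tendsto_polynomial_mul_exp_mul_atBot (Polynomial.X ^ n) hζ).isBigO_one ℝ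
  simpa using this

/-- Write `slowU(s + k) = s/(2c) + ρ` with `ρ = a log s + d`. Then `s² (1/slowU - 2c/s) = -4c² ρ +
4c² ρ²/slowU`, where `d` is bounded and `ρ²/s → 0`. The shift changes only `d`, so it does not
influence the logarithmic coefficient. -/
lemma isBigO_slowU_shift_inv (hc : 0 < c) (k : ℝ) :
    (fun s => s ^ 2 * ((slowU c a σ (s + k))⁻¹ - 2 * c / s) + 4 * c ^ 2 * a * Real.log s)
      =O[atTop] (fun _ => (1 : ℝ)) := by
  have hk : Tendsto (fun s : ℝ => s + k) atTop atTop := tendsto_atTop_add_const_right _ k tendsto_id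
  have hlog : Tendsto (fun s => Real.log (s + k) - Real.log s) atTop (𝓝 0) := by
    have h1 : Tendsto (fun s : ℝ => 1 + k * s⁻¹) atTop (𝓝 1) := by
      simpa using (tendsto_inv_atTop_zero.const_mul k).const_add (1 : ℝ)
    have h2 := (Real.continuousAt_log one_ne_zero).tendsto.comp h1
    rw [Real.log_one] at h2
    refine h2.congr' ?_
    filter_upwards [eventually_gt_atTop 0, hk.eventually_gt_atTop 0] with s hs hs'
    rw [Function.comp, ← Real.log_div hs'.ne' hs.ne']
    congr 1; field_simp
  set d : ℝ → ℝ := fun s => k / (2 * c) + a * (Real.log (s + k) - Real.log s) +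
    σ * (√(s + k))⁻¹ with hd
  have hdl : Tendsto d atTop (𝓝 (k / (2 * c))) := by
    simpa using ((hlog.const_mul a).const_add (k / (2 * c))).add
      ((tendsto_inv_sqrt.comp hk).const_mul σ)
  have hy := (tendsto_mul_slowU_inv (a := a) (σ := σ) hc).comp hk
  have hs1 : Tendsto (fun s : ℝ => s / (s + k)) atTop (𝓝 1) := by
    have h2 : Tendsto (fun s : ℝ => 1 - k * (s + k)⁻¹) atTop (𝓝 1) := by
      simpa using ((tendsto_inv_atTop_zero.comp hk).const_mul k).const_sub 1
    refine h2.congr' ?_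
    filter_upwards [hk.eventually_gt_atTop 0] with s hs
    field_simp; ring
  have hρ : Tendsto (fun s => (a * Real.log s + d s) * (√s)⁻¹) atTop (𝓝 0) := by
    have := (tendsto_log_mul_inv_sqrt.const_mul a).add (hdl.mul tendsto_inv_sqrt)
    simp only [mul_zero, add_zero] at this
    exact this.congr fun s => by ring
  have hlim := (hdl.neg.add ((hρ.pow 2).mul (hs1.mul hy))).const_mul (4 * c ^ 2)
  refine (hlim.isBigO_one ℝ).congr' ?_ EventuallyEq.rfl
  filter_upwards [eventually_gt_atTop 0, hk.eventually_gt_atTop 0,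
    hk.eventually (eventually_slowU_pos (a := a) (σ := σ) hc)] with s hs hs' hU
  have hsq : ((a * Real.log s + d s) * (√s)⁻¹) ^ 2 = (a * Real.log s + d s) ^ 2 / s := by
    rw [mul_pow, inv_sqrt_sq hs]; ring
  have hUe : slowU c a σ (s + k) = s / (2 * c) + (a * Real.log s + d s) := by
    simp only [slowU, hd]; ring
  simp only [Function.comp, hsq]
  rw [hUe] at hU ⊢
  generalize d s = e at *
  have h2 : 0 < s + 2 * c * (a * Real.log s + e) := by
    have := mul_pos (show 0 < 2 * c by positivity) hU
    have e1 : 2 * c * (s / (2 * c) + (a * Real.log s + e)) =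
      s + 2 * c * (a * Real.log s + e) := by field_simp
    rwa [e1] at this
  have h3 : (s / (2 * c) + (a * Real.log s + e))⁻¹ =
      2 * c / (s + 2 * c * (a * Real.log s + e)) := by field_simp
  rw [h3]
  obtain ⟨ρ, hρe⟩ : ∃ ρ, ρ = a * Real.log s + e := ⟨_, rfl⟩
  obtain rfl : e = ρ - a * Real.log s := by rw [hρe]; ring
  rw [← hρe] at h2 ⊢
  generalize Real.log s = L at *
  obtain ⟨W, hW⟩ : ∃ W, W = s + 2 * c * ρ := ⟨_, rfl⟩
  obtain rfl : ρ = (W - s) / (2 * c) := by rw [hW]; field_simp; ring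
  rw [← hW] at h2 ⊢
  field_simp
  ring

/-- The logarithm is the cross term in the square of `2c/s - 4c² a log s/s² + O(1/s²)`. The cubic
term of `slowP` is `O(s^{-3})`, so `β` does not appear. -/
lemma isBigO_slowP_slowU_inv (hb : 0 < b) (hc : 0 < c) :
    (fun s => s ^ 3 * slowP b β (slowU c a σ s)⁻¹ - 2 * c ^ 2 / b * s +
      8 * c ^ 3 * a / b * Real.log s) =O[atTop] (fun _ => (1 : ℝ)) := by
  have hE := isBigO_slowU_shift_inv (a := a) (σ := σ) hc 0
  simp only [add_zero] at hE
  set E : ℝ → ℝ := fun s => s ^ 2 * ((slowU c a σ s)⁻¹ - 2 * c / s) +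
    4 * c ^ 2 * a * Real.log s with hEd
  have hy := (tendsto_mul_slowU_inv (a := a) (σ := σ) hc)
  have hx := tendsto_inv_sqrt
  have hl := tendsto_log_mul_inv_sqrt
  have h1 := ((hl.pow 2).const_mul (8 * c ^ 4 * a ^ 2 / b)).isBigO_one ℝ
  have h2 := (((hx.mul hl).const_mul (4 * c ^ 2 * a)).const_sub (2 * c)).isBigO_one ℝ
  have h3 := (hx.pow 2).isBigO_one ℝ
  have h4 := ((hy.pow 3).const_mul β).isBigO_one ℝ
  have h12 := ((h2.mul hE).congr_right (g₂ := fun _ => (1 : ℝ)) fun _ => one_mul 1).const_mul_left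
    (1 / b)
  have hEE := (hE.mul hE).congr_right (g₂ := fun _ => (1 : ℝ)) fun _ => one_mul 1
  have h13 := ((h3.mul hEE).congr_right (g₂ := fun _ => (1 : ℝ)) fun _ => one_mul 1).const_mul_left
    (1 / (2 * b))
  have h5 := ((h1.add h12).add h13).add h4
  refine h5.congr' ?_ EventuallyEq.rfl
  filter_upwards [eventually_gt_atTop 0] with s hs
  have e1 : (√s)⁻¹ ^ 2 = 1 / s := inv_sqrt_sq hs
  have e2 : (√s)⁻¹ * (Real.log s * (√s)⁻¹) = Real.log s / s := by
    rw [show (√s)⁻¹ * (Real.log s * (√s)⁻¹) = Real.log s * (√s)⁻¹ ^ 2 by ring, e1]; ring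
  have e3 : (Real.log s * (√s)⁻¹) ^ 2 = Real.log s ^ 2 / s := by rw [mul_pow, e1]; ring
  simp only [e1, e2, e3, hEd, slowP]
  generalize (slowU c a σ s)⁻¹ = y
  generalize Real.log s = L
  field_simp
  ring

lemma isBigO_slowQ_shift (hc : 0 < c) (k : ℝ) :
    (fun t => slowQ c a σ (t + k) - (-(2 * c / t) - 4 * c ^ 2 * a * (Real.log (-t) / t ^ 2)))
      =O[atBot] (fun t : ℝ => 1 / t ^ 2) := by
  refine isBigO_inv_pow ((((isBigO_slowU_shift_inv (a := a) (σ := σ) hc (-k)).comp_tendsto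
    tendsto_neg_atBot_atTop)).congr' ?_ EventuallyEq.rfl)
  filter_upwards [eventually_lt_atBot 0] with t ht
  simp only [Function.comp, slowQ]
  rw [show -(t + k) = -t + -k by ring]
  have := ht.ne
  field_simp
  ring

lemma isBigO_slowP_slowQ (hb : 0 < b) (hc : 0 < c) :
    (fun t => slowP b β (slowQ c a σ t) -
      (2 * c ^ 2 / b / t ^ 2 + 8 * c ^ 3 * a / b * (Real.log (-t) / t ^ 3)))
      =O[atBot] (fun t : ℝ => 1 / t ^ 3) := by
  refine isBigO_inv_pow ((((isBigO_slowP_slowU_inv (a := a) (σ := σ) (β := β) hb hc).comp_tendsto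
    tendsto_neg_atBot_atTop)).neg_left.congr' ?_ EventuallyEq.rfl)
  filter_upwards [eventually_lt_atBot 0] with t ht
  simp only [Function.comp, slowQ]
  have := ht.ne
  generalize slowP b β (slowU c a σ (-t))⁻¹ = y
  field_simp
  ring

end Asymptotics

/-! ### Fronts with the prescribed asymptotics. -/

section Fronts

open Asymptotics

variable {b c r h : ℝ} {ψ φ : ℝ → ℝ}

/-- The curves with `σ = 1` and `σ = -1` have the same expansion to the claimed order, and the
subtracted exponential and the fast terms are exponentially small, so the front is squeezed. -/
theorem exists_critical_front (hb : 0 < b) (hc : 0 < c) (hh : 0 ≤ h)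
    (hs : IsRegularSuperSolution b c 1 h ψ φ) :
    ∃ x θ, IsMonotoneWavefront b c 1 h x θ ∧ CriticalAsymptotics b c h x θ := by
  have hc' : 2 * √(1 - 1) < c := by simpa using hc
  obtain ⟨-, -, -, -, ν, -, -, -, hν, -, -, hψO, hφO, -⟩ :=
    hs.exists_truncated hb.le zero_le_one le_rfl hc' hh
  obtain ⟨T, η, hp⟩ := exists_slowPair_of_eq_one hb hc hh
  obtain ⟨x, y, S, hw, hev⟩ := exists_front_of_slowPair hb zero_le_one le_rfl hc' hh hs hp
  have hν2 : 0 < ν / 2 := by linarith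
  have hν3 : ν / 2 < ν := by linarith
  have hexp (A : ℝ) : (fun t => A * Real.exp (c / 2 * t)) =O[atBot]
      (fun t => Real.exp (c / 2 * t)) := (isBigO_refl _ _).const_mul_left A
  have ea : 8 * c ^ 3 * slowA b c h / b =
      -(8 * c / (3 * b) * (c ^ 2 * (1 + h + 1 / b) - 4)) := by
    unfold slowA; field_simp
  have ea' : 4 * c ^ 2 * slowA b c h = -(4 / 3 * (c ^ 2 * (1 + h + 1 / b) - 4)) := by
    unfold slowA; field_simp
  refine ⟨x, _, hw, ?_, ?_⟩
  · have h1 := (isBigO_slowP_slowQ (a := slowA b c h) (β := slowBeta b c h) (σ := 1) hb hc).sub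
      (isBigO_inv_pow (isBigO_pow_mul_of_isBigO_exp (by positivity) 3 (hexp η)))
    have h2 := (isBigO_slowP_slowQ (a := slowA b c h) (β := slowBeta b c h) (σ := -1) hb hc).add
      (isBigO_inv_pow (isBigO_pow_mul_of_isBigO_exp hν2 3
        (isBigO_exp_of_isBigO_id_mul_exp (S := S) hφO hν3)))
    refine isBigO_of_sandwich h1 h2 ?_
    filter_upwards [hev] with t ht
    rw [ea]
    constructor <;> linarith [ht.1.1, ht.1.2]
  · have hsh : Tendsto (fun t => t + c * h) atBot atBot :=
      tendsto_atBot_add_const_right _ _ tendsto_id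
    have h1 := (isBigO_slowQ_shift (a := slowA b c h) (σ := 1) hc (c * h)).sub
      (isBigO_inv_pow (isBigO_pow_mul_of_isBigO_exp (by positivity) 2
        (hexp ((1 + 4 * b / c ^ 2) * η * Real.exp (c / 2 * (c * h))))))
    have h2 := (isBigO_slowQ_shift (a := slowA b c h) (σ := -1) hc (c * h)).add
      (isBigO_inv_pow (isBigO_pow_mul_of_isBigO_exp hν2 2
        (isBigO_exp_of_isBigO_id_mul_exp (S := c * h + S) hψO hν3)))
    refine isBigO_of_sandwich h2.neg_left h1.neg_left ?_
    filter_upwards [hsh.eventually hev] with t ht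
    obtain ⟨-, h3, h4⟩ := ht
    rw [mul_add, Real.exp_add] at h3
    rw [add_assoc t] at h4
    rw [ea']
    constructor <;> linarith

theorem exists_noncritical_front (hb : 0 < b) (hr₀ : 0 < r) (hr₁ : r < 1)
    (hc : 2 * √(1 - r) < c) (hh : 0 ≤ h) (hs : IsRegularSuperSolution b c r h ψ φ) :
    ∃ x θ, IsMonotoneWavefront b c r h x θ ∧ NoncriticalAsymptotics b c r x θ := by
  obtain ⟨-, -, -, -, ν, -, -, hν₁, -, -, -, hψO, hφO, -⟩ :=
    hs.exists_truncated hb.le hr₀.le hr₁.le hc hh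
  obtain ⟨hl, hlμ, -, hll⟩ := bz_roots hr₁.le hc
  have hl0 : 0 < bzLambda c r := by
    refine hl.lt_of_ne fun h0 => ?_
    rw [← h0] at hll
    linarith
  -- `ζ < 2λ` and `ζ < μ` are what the slow pair needs; `ζ < ν` puts the fast terms into the error
  -- `O(e^{ζt})`, so `ε = ζ - λ`.
  obtain ⟨ζ, h₁, h₂⟩ := exists_between
    (show bzLambda c r < min (2 * bzLambda c r) (min (bzMu c r) ν) from
      lt_min (by linarith) (lt_min hlμ hν₁))
  simp only [lt_min_iff] at h₂
  obtain ⟨h₂, h₃, h₄⟩ := h₂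
  obtain ⟨T, A₂, k, m, hp⟩ := exists_slowPair_of_lt_one hb hr₀ hr₁ hc hh h₁ h₂ h₃
  obtain ⟨x, y, S, hw, hev⟩ := exists_front_of_slowPair hb hr₀.le hr₁.le hc hh hs hp
  have hexp (A : ℝ) : (fun t => A * Real.exp (ζ * t)) =O[atBot]
      (fun t => Real.exp (ζ * t)) := (isBigO_refl _ _).const_mul_left A
  have hr1 : 1 - r ≠ 0 := by linarith
  refine ⟨x, _, hw, ζ - bzLambda c r, sub_pos.2 h₁, ?_, ?_⟩
  · rw [add_sub_cancel]
    refine isBigO_of_sandwich (hexp (-k))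
      ((hexp 1).add (isBigO_exp_of_isBigO_id_mul_exp (S := S) hφO h₄)) ?_
    filter_upwards [hev] with t ht
    obtain ⟨⟨h3, h4⟩, -⟩ := ht
    simp only [expSum] at h3 h4
    constructor <;> linarith
  · have hsh : Tendsto (fun t => t + c * h) atBot atBot :=
      tendsto_atBot_add_const_right _ _ tendsto_id
    rw [add_sub_cancel]
    refine isBigO_of_sandwich ((hexp (A₂ * Real.exp (ζ * (c * h)))).add
      (isBigO_exp_of_isBigO_id_mul_exp (S := c * h + S) hψO h₄)).neg_left
      (hexp (-m * Real.exp (ζ * (c * h)))).neg_left ?_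
    filter_upwards [hsh.eventually hev] with t ht
    obtain ⟨-, h3, h4⟩ := ht
    simp only [expSum, mul_add, Real.exp_add] at h3 h4
    rw [add_assoc t] at h4
    -- The advance by `c h` in `θ` cancels the delay factor `e^{-λch}` of the slow pair.
    have e1 : b * Real.exp (-(bzLambda c r * (c * h))) / (1 - r) *
        (Real.exp (bzLambda c r * t) * Real.exp (bzLambda c r * (c * h))) =
        b * Real.exp (bzLambda c r * t) / (1 - r) := by
      rw [Real.exp_neg]; field_simp
    rw [e1] at h3 h4
    constructor <;> linarith

end Fronts

end

theorem theorem17 (b c r h : ℝ) (hb : 0 < b) (hr₀ : 0 < r) (hr₁ : r ≤ 1) (hh : 0 ≤ h)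
    (hc : 2 * √(1 - r) < c)
    (hsuper : ∃ ψ φ : ℝ → ℝ, IsRegularSuperSolution b c r h ψ φ) :
    ∃ φ θ : ℝ → ℝ, IsMonotoneWavefront b c r h φ θ ∧
      (r = 1 → CriticalAsymptotics b c h φ θ) ∧
      (r < 1 → NoncriticalAsymptotics b c r φ θ) := by
  obtain ⟨ψ, φ, hs⟩ := hsuper
  rcases hr₁.eq_or_lt with rfl | hr₁
  · obtain ⟨x, θ, hw, ha⟩ := exists_critical_front hb (by simpa using hc) hh hs
    exact ⟨x, θ, hw, fun _ => ha, fun h => absurd h (lt_irrefl _)⟩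
  · obtain ⟨x, θ, hw, ha⟩ := exists_noncritical_front hb hr₀ hr₁ hc hh hs
    exact ⟨x, θ, hw, fun h => absurd h hr₁.ne, fun _ => ha⟩
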